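/- **Lemma 3.14.** Fix an integer $k\ge 1$ and let $q=e^{\pi i/(k+2)}$, $[i]=\dfrac{q^{i}-q^{-i}}{q-q^{-1}}$ and $\delta=-[2]$. Let $\mathcal L$ be the $\mathbb C$-linear monoidal category with objects the natural numbers $0,1,2,\dots$, in which a morphism $m\to n$ is a $\mathbb C$-linear combination of planar diagrams in a rectangle with $m$ dots on the bottom edge and $n$ dots on the top edge, every dot being joined to exactly one other dot by non-crossing lines, up to isotopy. Composition $g\circ f$ stacks $g$ on top of $f$, every closed loop being replaced by the factor $\delta$; the monoidal product is $m\otimes n=m+n$ on objects and horizontal juxtaposition on diagrams. Let $TL$ be the idempotent completion of the additive completion of $\mathcal L$, with the induced monoidal structure. Define $f_i:i\to i$ for $0\le i\le k+1$ by $f_0=1_0$, $f_1=1_1$ and, for $2\le i\le k+1$, $$f_i=f_{i-1}\otimes 1_1+\frac{[i-1]}{[i]}\,(f_{i-1}\otimes 1_1)\circ U_{i-1}\circ(f_{i-1}\otimes 1_1),$$ where $U_{i-1}=1_{i-2}\otimes(\cup\circ\cap):i\to i$, with $\cap:2\to0$ the cap and $\cup:0\to2$ the cup. These are idempotents (the Jones–Wenzl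 projections); write $F_i=(i,f_i)$ for the corresponding objects of $TL$. Let $(F_{k+1})$ be the two-sided monoidal ideal of morphisms of $TL$ generated by $1_{F_{k+1}}$, that is, the smallest class of morphisms which contains $1_{F_{k+1}}$ and all zero morphisms and is closed under sums and under composition and monoidal product, on either side, with arbitrary morphisms. Let $\widetilde{TL}=TL/(F_{k+1})$. Let $\cap^{(k)}:2k\to0$ and $\cup^{(k)}:0\to2k$ be the diagrams of $k$ nested caps and of $k$ nested cups, and let $$e_k=\cap^{(k)}\circ(f_k\otimes f_k):F_k\otimes F_k\to F_0,\qquad c_k=(f_k\otimes f_k)\circ\cup^{(k)}:F_0\to F_k\otimes F_k ,$$ where $F_0$ is the unit object. Then in $\widetilde{TL}$ $$c_k\circ e_k=(-1)^k\,1_{F_k}\otimes 1_{F_k}:F_k\otimes F_k\to F_k\otimes F_k .$$ -/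

import Mathlib

open CategoryTheory

attribute [-instance] CategoryTheory.catToReflQuiver

namespace TemperleyLieb

section Gluing

variable {A B C : Type}

/-- `A ⊕ B` inside the glued set of dots `(A ⊕ C) ⊕ B`. -/
def inFirst : A ⊕ B → (A ⊕ C) ⊕ B := Sum.elim (Sum.inl ∘ Sum.inl) Sum.inr

/-- `B ⊕ C` inside the glued set of dots `(A ⊕ C) ⊕ B`. -/
def inSecond : B ⊕ C → (A ⊕ C) ⊕ B := Sum.elim Sum.inr (Sum.inl ∘ Sum.inr)

/-- Stacking a diagram with dots `A` (bottom) and `B` (top) below a diagram with dots `B` (bottom)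
and `C` (top): two dots are equivalent if they lie on the same connected component of the
stacked picture. -/
def glue (r : Setoid (A ⊕ B)) (s : Setoid (B ⊕ C)) : Setoid ((A ⊕ C) ⊕ B) :=
  Relation.EqvGen.setoid fun x y =>
    (∃ a b, r a b ∧ inFirst a = x ∧ inFirst b = y) ∨
    (∃ a b, s a b ∧ inSecond a = x ∧ inSecond b = y)

/-- The outer dots which are connected in the stacked picture. -/
def stack (r : Setoid (A ⊕ B)) (s : Setoid (B ⊕ C)) : Setoid (A ⊕ C) :=
  (glue r s).comap Sum.inl

/-- The number of closed loops: components of the stacked picture without outer dots. -/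
noncomputable def loops (r : Setoid (A ⊕ B)) (s : Setoid (B ⊕ C)) : ℕ :=
  Nat.card {q : Quotient (glue r s) // ∀ x : A ⊕ C, (Quotient.mk _ (Sum.inl x)) ≠ q}

/-- A two-colouring of the dots which is constant on components. -/
def Resp {X : Type} (r : Setoid X) (φ : X → Bool) : Prop := ∀ x y, r x y → φ x = φ y

theorem glue_resp (r : Setoid (A ⊕ B)) (s : Setoid (B ⊕ C)) (φ : (A ⊕ C) ⊕ B → Bool) :
    Resp (glue r s) φ ↔ Resp r (φ ∘ inFirst) ∧ Resp s (φ ∘ inSecond) := by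
  constructor
  · intro h
    exact ⟨fun x y hxy => h _ _ (.rel _ _ (.inl ⟨x, y, hxy, rfl, rfl⟩)),
      fun x y hxy => h _ _ (.rel _ _ (.inr ⟨x, y, hxy, rfl, rfl⟩))⟩
  · rintro ⟨h1, h2⟩ x y hxy
    induction hxy with
    | rel x y h =>
      rcases h with ⟨a, b, hab, rfl, rfl⟩ | ⟨a, b, hab, rfl, rfl⟩
      · exact h1 _ _ hab
      · exact h2 _ _ hab
    | refl x => rfl
    | symm x y _ ih => exact ih.symm
    | trans x y z _ _ ih1 ih2 => exact ih1.trans ih2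

theorem resp_ext {X : Type} {r s : Setoid X} (h : ∀ φ, Resp r φ ↔ Resp s φ) : r = s := by
  classical
  have key : ∀ r s : Setoid X, (∀ φ, Resp r φ ↔ Resp s φ) → ∀ x y, r x y → s x y := by
    intro r s h x y hxy
    have h1 : Resp s (fun z => decide (s x z)) := by
      intro a b hab
      simp only [decide_eq_decide]
      exact ⟨fun h => s.trans h hab, fun h => s.trans h (s.symm hab)⟩
    have h2 := (h _).2 h1 x y hxy
    simp only [decide_eq_decide] at h2
    exact h2.1 (s.refl x)
  ext x y
  exact ⟨key r s h x y, key s r (fun φ => (h φ).symm) x y⟩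

open Classical in
theorem card_extend {X Y : Type} [Finite X] [Finite Y] (r : Setoid (X ⊕ Y)) (α : X → Bool) :
    Nat.card {β : Y → Bool // Resp r (Sum.elim α β)} =
      if Resp (r.comap Sum.inl) α then
        2 ^ Nat.card {q : Quotient r // ∀ x : X, (Quotient.mk _ (Sum.inl x)) ≠ q} else 0 := by
  split_ifs with h
  · have e : {β : Y → Bool // Resp r (Sum.elim α β)} ≃
        ({q : Quotient r // ∀ x : X, (Quotient.mk _ (Sum.inl x)) ≠ q} → Bool) := by
      refine
        { toFun := fun β q => Quotient.lift (Sum.elim α β.1) β.2 q.1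
          invFun := fun f => ⟨fun y =>
            if hq : ∃ x : X, (Quotient.mk r (Sum.inl x)) = Quotient.mk r (Sum.inr y)
              then α hq.choose
              else f ⟨Quotient.mk r (Sum.inr y), fun x hx => hq ⟨x, hx⟩⟩, ?_⟩
          left_inv := ?_
          right_inv := ?_ }
      · have hα : ∀ x x', Quotient.mk r (Sum.inl x) = Quotient.mk r (Sum.inl x') → α x = α x' :=
          fun x x' hx => h x x' (Quotient.exact (s := r) hx)
        rintro (x | y) (x' | y') hxy
        · exact h x x' hxy
        · have hq : ∃ x : X, (Quotient.mk r (Sum.inl x)) = Quotient.mk r (Sum.inr y') :=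
            ⟨x, Quotient.sound hxy⟩
          simp only [Sum.elim_inl, Sum.elim_inr, dif_pos hq]
          exact hα _ _ ((Quotient.sound hxy).trans hq.choose_spec.symm)
        · have hq : ∃ x : X, (Quotient.mk r (Sum.inl x)) = Quotient.mk r (Sum.inr y) :=
            ⟨x', (Quotient.sound hxy).symm⟩
          simp only [Sum.elim_inl, Sum.elim_inr, dif_pos hq]
          exact hα _ _ (hq.choose_spec.trans (Quotient.sound hxy))
        · have e : Quotient.mk r (Sum.inr y) = Quotient.mk r (Sum.inr y') := Quotient.sound hxy
          simp only [Sum.elim_inr, e]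
      · rintro ⟨β, hβ⟩
        ext y
        dsimp only
        split_ifs with hq
        · exact hβ _ _ (Quotient.exact hq.choose_spec)
        · rfl
      · intro f
        funext ⟨q, hq⟩
        induction q using Quotient.inductionOn with
        | h z =>
          rcases z with x | y
          · exact absurd rfl (hq x)
          · have hn : ¬ ∃ x : X, (Quotient.mk r (Sum.inl x)) = Quotient.mk r (Sum.inr y) :=
              fun ⟨x, hx⟩ => hq x hx
            simp [hn]
    rw [Nat.card_congr e, Nat.card_fun]
    simp
  · have : IsEmpty {β : Y → Bool // Resp r (Sum.elim α β)} :=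
      ⟨fun β => h fun x x' hx => β.2 (Sum.inl x) (Sum.inl x') hx⟩
    simp

open Classical in
/-- The 0-1 matrix recording which two-colourings of the dots are constant on components. -/
noncomputable def mat (r : Setoid (A ⊕ B)) (α : A → Bool) (β : B → Bool) : ℕ :=
  if Resp r (Sum.elim α β) then 1 else 0

theorem mat_false (r : Setoid (A ⊕ B)) : mat r (fun _ => false) (fun _ => false) = 1 := by
  unfold mat
  rw [if_pos]
  rintro (x | x) (y | y) _ <;> rfl

theorem mat_inj {r s : Setoid (A ⊕ B)} (h : mat r = mat s) : r = s := by
  apply resp_ext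
  intro φ
  have := congrFun (congrFun h (φ ∘ Sum.inl)) (φ ∘ Sum.inr)
  simp only [mat, Sum.elim_comp_inl_inr] at this
  split_ifs at this <;> simp_all

theorem mat_stack [Finite A] [Fintype B] [Finite C] [DecidableEq B]
    (r : Setoid (A ⊕ B)) (s : Setoid (B ⊕ C))
    (α : A → Bool) (γ : C → Bool) :
    ∑ β, mat r α β * mat s β γ = 2 ^ loops r s * mat (stack r s) α γ := by
  classical
  have h := card_extend (glue r s) (Sum.elim α γ)
  have e : ∀ β : B → Bool, Resp (glue r s) (Sum.elim (Sum.elim α γ) β) ↔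
      Resp r (Sum.elim α β) ∧ Resp s (Sum.elim β γ) := by
    intro β
    rw [glue_resp]
    have h1 : Sum.elim (Sum.elim α γ) β ∘ inFirst = Sum.elim α β := by
      ext (x | x) <;> rfl
    have h2 : Sum.elim (Sum.elim α γ) β ∘ inSecond = Sum.elim β γ := by
      ext (x | x) <;> rfl
    rw [h1, h2]
  have h1 : ∑ β, mat r α β * mat s β γ =
      Nat.card {β : B → Bool // Resp (glue r s) (Sum.elim (Sum.elim α γ) β)} := by
    rw [Nat.card_eq_fintype_card, Fintype.card_subtype, Finset.card_filter]
    refine Finset.sum_congr rfl fun β _ => ?_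
    simp only [mat, e β, ite_and]
    split_ifs <;> simp
  rw [h1, h, mat, loops, stack]
  split_ifs <;> simp

/-- A scaled matrix determines the scale and the relation. -/
theorem scaled_mat_inj {r s : Setoid (A ⊕ B)} {a b : ℕ}
    (h : ∀ α β, 2 ^ a * mat r α β = 2 ^ b * mat s α β) : a = b ∧ r = s := by
  have hab : a = b := by
    have := h (fun _ => false) (fun _ => false)
    rw [mat_false, mat_false, mul_one, mul_one] at this
    exact Nat.pow_right_injective le_rfl this
  subst hab
  refine ⟨rfl, mat_inj ?_⟩
  funext α β
  exact Nat.eq_of_mul_eq_mul_left (by positivity) (h α β)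

theorem stack_assoc {D : Type} [Fintype A] [Fintype B] [Fintype C] [Fintype D]
    (r : Setoid (A ⊕ B)) (s : Setoid (B ⊕ C)) (t : Setoid (C ⊕ D)) :
    loops r s + loops (stack r s) t = loops s t + loops r (stack s t) ∧
      stack (stack r s) t = stack r (stack s t) := by
  classical
  apply scaled_mat_inj
  intro α δ
  have h1 : 2 ^ (loops r s + loops (stack r s) t) * mat (stack (stack r s) t) α δ =
      ∑ γ, ∑ β, mat r α β * (mat s β γ * mat t γ δ) := by
    rw [pow_add, mul_assoc, ← mat_stack, Finset.mul_sum]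
    refine Finset.sum_congr rfl fun γ _ => ?_
    rw [← mul_assoc, ← mat_stack, Finset.sum_mul]
    exact Finset.sum_congr rfl fun β _ => mul_assoc _ _ _
  have h2 : 2 ^ (loops s t + loops r (stack s t)) * mat (stack r (stack s t)) α δ =
      ∑ β, ∑ γ, mat r α β * (mat s β γ * mat t γ δ) := by
    rw [pow_add, mul_assoc, ← mat_stack, Finset.mul_sum]
    refine Finset.sum_congr rfl fun β _ => ?_
    rw [mul_left_comm, ← mat_stack, Finset.mul_sum]
  rw [h1, h2, Finset.sum_comm]

/-- The components of the identity diagram: vertical strands. -/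
def idRel (A : Type) : Setoid (A ⊕ A) := Setoid.ker (Sum.elim id id)

open Classical in
theorem mat_idRel (α β : A → Bool) :
    mat (idRel A) α β = if α = β then 1 else 0 := by
  unfold mat
  congr 1
  rw [eq_iff_iff]
  constructor
  · intro h
    funext a
    exact h (Sum.inl a) (Sum.inr a) rfl
  · rintro rfl (x | x) (y | y) h <;> exact congrArg α h

theorem id_stack [Fintype A] [Fintype B] (r : Setoid (A ⊕ B)) :
    loops (idRel A) r = 0 ∧ stack (idRel A) r = r := by
  classical
  apply scaled_mat_inj
  intro α β
  rw [← mat_stack]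
  simp [mat_idRel]

theorem stack_id [Fintype A] [Fintype B] (r : Setoid (A ⊕ B)) :
    loops r (idRel B) = 0 ∧ stack r (idRel B) = r := by
  classical
  apply scaled_mat_inj
  intro α β
  rw [← mat_stack]
  simp [mat_idRel]

end Gluing

section Planarity

/-- Every dot is joined to exactly one other dot. -/
def IsMatching {X : Type} (r : Setoid X) : Prop := ∀ x, ∃! y, y ≠ x ∧ r x y

/-- `p` lists the dots in their cyclic order along the boundary of the rectangle; no two lines
`{a, c}` and `{b, d}` cross. -/
def IsNoncrossing {X : Type} (p : X → ℕ) (r : Setoid X) : Prop :=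
  ∀ a b c d, p a < p b → p b < p c → p c < p d → r a c → ¬ r b d

theorem IsMatching.exists_partner {X : Type} {r : Setoid X} (h : IsMatching r) :
    ∃ σ : X → X, (∀ x, σ (σ x) = x) ∧ (∀ x, σ x ≠ x) ∧ ∀ x y, r x y ↔ y = x ∨ y = σ x := by
  choose σ hσ using h
  have h2 : ∀ x y, r x y ↔ y = x ∨ y = σ x := by
    intro x y
    constructor
    · intro hxy
      by_cases hy : y = x
      · exact .inl hy
      · exact .inr ((hσ x).2 y ⟨hy, hxy⟩)
    · rintro (rfl | rfl)
      · exact r.refl y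
      · exact (hσ x).1.2
  refine ⟨σ, fun x => ?_, fun x => (hσ x).1.1, h2⟩
  exact ((hσ (σ x)).2 x ⟨(hσ x).1.1.symm, r.symm (hσ x).1.2⟩).symm

theorem sum_invariant_eq_zero {X : Type} [Fintype X] (σ : X → X) (h1 : ∀ x, σ (σ x) = x)
    (h2 : ∀ x, σ x ≠ x) (f : X → ZMod 2) (hf : ∀ x, f x + f (σ x) = 0) : ∑ x, f x = 0 :=
  Finset.sum_involution (fun x _ => σ x) (fun x _ => hf x) (fun x _ _ => h2 x)
    (fun _ _ => Finset.mem_univ _) (fun x _ => h1 x)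

open Classical in
theorem link_eq_zero {X : Type} [Fintype X] (p : X → ℕ) (hp : Function.Injective p)
    (r : Setoid X) (hr : IsNoncrossing p r) (σ : X → X) (h1 : ∀ x, σ (σ x) = x)
    (h2 : ∀ x, σ x ≠ x) (h3 : ∀ x y, r x y ↔ y = x ∨ y = σ x)
    (χ ψ : X → ZMod 2) (hχ : ∀ x, χ (σ x) = χ x) (hψ : ∀ x, ψ (σ x) = ψ x)
    (h : ∀ x, χ x * ψ x = 0) :
    ∑ x, ∑ y, χ x * ψ y * (if p x < p y then 1 else 0) = 0 := by
  refine sum_invariant_eq_zero σ h1 h2 _ fun x => ?_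
  rw [← Finset.sum_add_distrib]
  refine sum_invariant_eq_zero σ h1 h2 _ fun y => ?_
  rw [hχ, hψ]
  by_cases hz : χ x * ψ y = 0
  · simp [hz]
  have d1 : p x ≠ p y := fun e => hz (by rw [hp e]; exact h y)
  have d2 : p (σ x) ≠ p y := fun e => hz (by rw [← hχ x, hp e]; exact h y)
  have d3 : p x ≠ p (σ y) := fun e => hz (by rw [← hψ y, ← hp e]; exact h x)
  have d4 : p (σ x) ≠ p (σ y) := fun e => hz (by rw [← hχ x, ← hψ y, ← hp e]; exact h _)
  have rx : r x (σ x) := (h3 _ _).2 (.inr rfl)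
  have ry : r y (σ y) := (h3 _ _).2 (.inr rfl)
  have c : ∀ x x' y y', r x x' → r y y' → ¬ (p x < p y ∧ p y < p x' ∧ p x' < p y') :=
    fun x x' y y' h h' hh => hr x y x' y' hh.1 hh.2.1 hh.2.2 h h'
  have c1 := c x (σ x) y (σ y) rx ry
  have c2 := c x (σ x) (σ y) y rx (r.symm ry)
  have c3 := c (σ x) x y (σ y) (r.symm rx) ry
  have c4 := c (σ x) x (σ y) y (r.symm rx) (r.symm ry)
  have c5 := c y (σ y) x (σ x) ry rx
  have c6 := c (σ y) y x (σ x) (r.symm ry) rx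
  have c7 := c y (σ y) (σ x) x ry (r.symm rx)
  have c8 := c (σ y) y (σ x) x (r.symm ry) (r.symm rx)
  clear c hr
  rw [← mul_add, ← mul_add, ← mul_add]
  refine mul_eq_zero_of_right _ ?_
  split_ifs <;> first | rfl | (exfalso; omega)

theorem ends_le_two {K : Type} [Fintype K] [DecidableEq K] [Nonempty K] (s t : K → K)
    (hs : ∀ x, s (s x) = x) (ht : ∀ x, t (t x) = x)
    (conn : ∀ x y, Relation.EqvGen (fun x y => s x = y ∨ t x = y) x y) :
    (Finset.univ.filter fun x => s x = x).card + (Finset.univ.filter fun x => t x = x).card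
      ≤ 2 := by
  classical
  let G : SimpleGraph K :=
    { Adj := fun x y => x ≠ y ∧ (s x = y ∨ t x = y)
      symm := ⟨by
        rintro x y ⟨h1, h2 | h2⟩
        · exact ⟨h1.symm, .inl (by rw [← h2, hs])⟩
        · exact ⟨h1.symm, .inr (by rw [← h2, ht])⟩⟩
      loopless := ⟨fun x h => h.1 rfl⟩ }
  have hG : G.Connected := by
    rw [SimpleGraph.connected_iff]
    refine ⟨fun x y => ?_, inferInstance⟩
    induction conn x y with
    | rel x y h =>
      by_cases e : x = y
      · rw [e]
      · exact SimpleGraph.Adj.reachable (G := G) ⟨e, h⟩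
    | refl x => exact .refl _
    | symm x y _ ih => exact ih.symm
    | trans x y z _ _ h1 h2 => exact h1.trans h2
  have h1 := hG.card_vert_le_card_edgeSet_add_one
  have h2 := G.sum_degrees_eq_twice_card_edges
  rw [Nat.card_eq_fintype_card, Nat.card_eq_fintype_card, ← SimpleGraph.edgeFinset_card] at h1
  have h3 : ∀ x, G.degree x + ((if s x = x then 1 else 0) + (if t x = x then 1 else 0)) ≤ 2 := by
    intro x
    have hsub : G.neighborFinset x ⊆ ({s x, t x} : Finset K).erase x := by
      intro y hy
      rw [SimpleGraph.mem_neighborFinset] at hy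
      rcases hy with ⟨hy, h | h⟩ <;> simp [h, hy.symm]
    have hc := Finset.card_le_card hsub
    rw [SimpleGraph.card_neighborFinset_eq_degree] at hc
    refine le_trans (Nat.add_le_add_right hc _) ?_
    have hp := Finset.card_le_two (a := s x) (b := t x)
    split_ifs with a b b
    · simp [a, b]
    · rw [a, Finset.erase_insert (by simpa using Ne.symm b)]; simp
    · rw [b, Finset.pair_comm, Finset.erase_insert (by simpa using Ne.symm a)]; simp
    · exact (Finset.card_le_card (Finset.erase_subset _ _)).trans hp
  have h4 := Finset.sum_le_sum (s := Finset.univ) fun x _ => h3 x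
  rw [Finset.sum_add_distrib, Finset.sum_add_distrib, ← Finset.card_filter, ← Finset.card_filter,
    h2] at h4
  simp only [Finset.sum_const, Finset.card_univ, smul_eq_mul] at h4
  omega

theorem even_fixed {K : Type} [Fintype K] [DecidableEq K] (s : K → K) (hs : ∀ x, s (s x) = x) :
    ((Finset.univ.filter fun x => s x = x).card : ZMod 2) = Fintype.card K := by
  have h : ((Finset.univ.filter fun x => ¬ s x = x).card : ZMod 2) = 0 := by
    rw [Finset.card_eq_sum_ones, Nat.cast_sum]
    refine Finset.sum_involution (fun x _ => s x) (fun x _ => by decide)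
      (fun x hx _ => (Finset.mem_filter.1 hx).2) (fun x hx => ?_) (fun x _ => hs x)
    simp only [Finset.mem_filter, Finset.mem_univ, true_and] at hx ⊢
    rw [hs]
    exact Ne.symm hx
  have h2 := Finset.card_filter_add_card_filter_not (s := (Finset.univ : Finset K))
    (fun x => s x = x)
  rw [Finset.card_univ] at h2
  rw [← h2, Nat.cast_add, h, add_zero]

variable {A B C : Type} [Fintype A] [Fintype B] [Fintype C]

theorem isMatching_stack {r : Setoid (A ⊕ B)} {s : Setoid (B ⊕ C)}
    (hr : IsMatching r) (hs : IsMatching s) : IsMatching (stack r s) := by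
  classical
  obtain ⟨σ, σ1, σ2, σ3⟩ := hr.exists_partner
  obtain ⟨τ, τ1, τ2, τ3⟩ := hs.exists_partner
  let S : (A ⊕ C) ⊕ B → (A ⊕ C) ⊕ B := Sum.elim (Sum.elim (fun a => inFirst (σ (Sum.inl a)))
    (fun c => Sum.inl (Sum.inr c))) (fun b => inFirst (σ (Sum.inr b)))
  let T : (A ⊕ C) ⊕ B → (A ⊕ C) ⊕ B := Sum.elim (Sum.elim (fun a => Sum.inl (Sum.inl a))
    (fun c => inSecond (τ (Sum.inr c)))) (fun b => inSecond (τ (Sum.inl b)))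
  have S1 : ∀ x, S (inFirst x) = inFirst (σ x) := by rintro (x | x) <;> rfl
  have T1 : ∀ x, T (inSecond x) = inSecond (τ x) := by rintro (x | x) <;> rfl
  have F1 : Function.Injective (inFirst : A ⊕ B → (A ⊕ C) ⊕ B) := by
    rintro (x | x) (y | y) h <;> simp_all [inFirst]
  have F2 : Function.Injective (inSecond : B ⊕ C → (A ⊕ C) ⊕ B) := by
    rintro (x | x) (y | y) h <;> simp_all [inSecond]
  have SS : ∀ x, S (S x) = x := by
    rintro ((x | x) | x)
    · exact (S1 _).trans (congrArg inFirst (σ1 (Sum.inl x)))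
    · rfl
    · exact (S1 _).trans (congrArg inFirst (σ1 (Sum.inr x)))
  have TT : ∀ x, T (T x) = x := by
    rintro ((x | x) | x)
    · rfl
    · exact (T1 _).trans (congrArg inSecond (τ1 (Sum.inr x)))
    · exact (T1 _).trans (congrArg inSecond (τ1 (Sum.inl x)))
  have Sfix : ∀ x, S x = x ↔ ∃ c, x = Sum.inl (Sum.inr c) := by
    rintro ((x | x) | x)
    · exact ⟨fun h => absurd (F1 (a₁ := σ (Sum.inl x)) (a₂ := Sum.inl x) h) (σ2 _), by simp⟩
    · simp [S]
    · exact ⟨fun h => absurd (F1 (a₁ := σ (Sum.inr x)) (a₂ := Sum.inr x) h) (σ2 _), by simp⟩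
  have Tfix : ∀ x, T x = x ↔ ∃ a, x = Sum.inl (Sum.inl a) := by
    rintro ((x | x) | x)
    · simp [T]
    · exact ⟨fun h => absurd (F2 (a₁ := τ (Sum.inr x)) (a₂ := Sum.inr x) h) (τ2 _), by simp⟩
    · exact ⟨fun h => absurd (F2 (a₁ := τ (Sum.inl x)) (a₂ := Sum.inl x) h) (τ2 _), by simp⟩
  have gS : ∀ x, glue r s x (S x) := by
    have : ∀ x, glue r s (inFirst x) (S (inFirst x)) := fun x =>
      .rel _ _ (.inl ⟨x, σ x, (σ3 _ _).2 (.inr rfl), rfl, (S1 x).symm⟩)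
    rintro ((x | x) | x)
    · exact this (Sum.inl x)
    · exact .refl _
    · exact this (Sum.inr x)
  have gT : ∀ x, glue r s x (T x) := by
    have : ∀ x, glue r s (inSecond x) (T (inSecond x)) := fun x =>
      .rel _ _ (.inr ⟨x, τ x, (τ3 _ _).2 (.inr rfl), rfl, (T1 x).symm⟩)
    rintro ((x | x) | x)
    · exact .refl _
    · exact this (Sum.inr x)
    · exact this (Sum.inl x)
  intro x
  let K := {y : (A ⊕ C) ⊕ B // glue r s (Sum.inl x) y}
  let x0 : K := ⟨Sum.inl x, (glue r s).refl _⟩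
  let S' : K → K := fun y => ⟨S y.1, (glue r s).trans y.2 (gS _)⟩
  let T' : K → K := fun y => ⟨T y.1, (glue r s).trans y.2 (gT _)⟩
  have : Nonempty K := ⟨x0⟩
  have conn : ∀ y : K, ∀ z (h : glue r s y.1 z), Relation.EqvGen (fun x y => S' x = y ∨ T' x = y) y
      ⟨z, (glue r s).trans y.2 h⟩ := by
    have : ∀ y z, glue r s y z → ∀ (hy : glue r s (Sum.inl x) y) (hz : glue r s (Sum.inl x) z),
        Relation.EqvGen (fun x y => S' x = y ∨ T' x = y) (⟨y, hy⟩ : K) ⟨z, hz⟩ := by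
      intro y z hyz
      induction hyz with
      | rel y z h =>
        intro hy hz
        rcases h with ⟨a, b, hab, rfl, rfl⟩ | ⟨a, b, hab, rfl, rfl⟩
        · rcases (σ3 _ _).1 hab with rfl | rfl
          · exact .refl _
          · exact .rel _ _ (.inl (Subtype.ext (S1 a)))
        · rcases (τ3 _ _).1 hab with rfl | rfl
          · exact .refl _
          · exact .rel _ _ (.inr (Subtype.ext (T1 a)))
      | refl y => intro _ _; exact .refl _
      | symm y z _ ih => intro hy hz; exact (ih hz hy).symm
      | trans y z w h1 h2 ih1 ih2 =>
        intro hy hw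
        have hz : glue r s (Sum.inl x) z := (glue r s).trans hy h1
        exact (ih1 hy hz).trans _ _ _ (ih2 hz hw)
    exact fun y z h => this _ _ h _ _
  have two := ends_le_two S' T' (fun y => Subtype.ext (SS _)) (fun y => Subtype.ext (TT _))
    (fun y z => conn y z.1 ((glue r s).trans ((glue r s).symm y.2) z.2))
  have ev : ((Finset.univ.filter fun x => S' x = x).card +
      (Finset.univ.filter fun x => T' x = x).card : ZMod 2) = 0 := by
    rw [even_fixed S' (fun y => Subtype.ext (SS _)), even_fixed T' (fun y => Subtype.ext (TT _))]
    exact CharTwo.add_self_eq_zero _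
  let E : Finset K := Finset.univ.filter fun y => ∃ z, y.1 = Sum.inl z
  have Sfix' : ∀ y : K, S' y = y ↔ ∃ c, y.1 = Sum.inl (Sum.inr c) :=
    fun y => Subtype.ext_iff.trans (Sfix y.1)
  have Tfix' : ∀ y : K, T' y = y ↔ ∃ a, y.1 = Sum.inl (Sum.inl a) :=
    fun y => Subtype.ext_iff.trans (Tfix y.1)
  have hE : E.card = (Finset.univ.filter fun x => S' x = x).card +
      (Finset.univ.filter fun x => T' x = x).card := by
    rw [← Finset.card_union_of_disjoint]
    · congr 1
      ext y
      simp only [E, Finset.mem_filter, Finset.mem_univ, true_and, Finset.mem_union, Sfix', Tfix']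
      constructor
      · rintro ⟨z | z, h⟩
        · exact .inr ⟨z, h⟩
        · exact .inl ⟨z, h⟩
      · rintro (⟨z, h⟩ | ⟨z, h⟩) <;> exact ⟨_, h⟩
    · rw [Finset.disjoint_left]
      intro y h1 h2
      simp only [Finset.mem_filter, Finset.mem_univ, true_and, Sfix', Tfix'] at h1 h2
      obtain ⟨c, hc⟩ := h1
      obtain ⟨a, ha⟩ := h2
      simp [hc] at ha
  have hx0 : x0 ∈ E := Finset.mem_filter.2 ⟨Finset.mem_univ _, x, rfl⟩
  have hE2 : E.card = 2 := by
    have h0 : 0 < E.card := Finset.card_pos.2 ⟨_, hx0⟩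
    have h1 : E.card ≤ 2 := hE ▸ two
    have h3 : (E.card : ZMod 2) = 0 := by rw [hE, Nat.cast_add]; exact ev
    interval_cases E.card
    · exact absurd h3 (by decide)
    · rfl
  obtain ⟨y, hy⟩ : ∃ y, E.erase x0 = {y} := by
    rw [← Finset.card_eq_one, Finset.card_erase_of_mem hx0, hE2]
  have hyE : y ∈ E.erase x0 := by rw [hy]; simp
  obtain ⟨z, hz⟩ : ∃ z, y.1 = Sum.inl z := by
    have := (Finset.mem_erase.1 hyE).2
    simpa [E] using this
  refine ⟨z, ⟨?_, ?_⟩, ?_⟩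
  · rintro rfl
    exact (Finset.mem_erase.1 hyE).1 (Subtype.ext hz)
  · have := y.2
    rw [hz] at this
    exact this
  · rintro w ⟨hw1, hw2⟩
    have hw : (⟨Sum.inl w, hw2⟩ : K) ∈ E.erase x0 := by
      rw [Finset.mem_erase]
      refine ⟨fun h => hw1 (Sum.inl_injective (congrArg Subtype.val h)), ?_⟩
      exact Finset.mem_filter.2 ⟨Finset.mem_univ _, w, rfl⟩
    rw [hy, Finset.mem_singleton] at hw
    exact Sum.inl_injective ((congrArg Subtype.val hw).trans hz)

end Planarity

/-- The position of a dot along the boundary of the rectangle, starting at the bottom left corner: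
the bottom dots from left to right, then the top dots from right to left. -/
def pos (m n : ℕ) : Fin m ⊕ Fin n → ℕ := Sum.elim (fun i => i) (fun j => m + (n - 1 - j))

theorem pos_injective (m n : ℕ) : Function.Injective (pos m n) := by
  rintro (x | x) (y | y) h <;> simp only [pos, Sum.elim_inl, Sum.elim_inr] at h
  · exact congrArg _ (Fin.ext h)
  · omega
  · omega
  · exact congrArg _ (Fin.ext (by omega))

theorem sum_pairs {X : Type} [Fintype X] [DecidableEq X] (a b c d : X) (g : X → X → ZMod 2) :
    ∑ x, ∑ y, ((if x = a then 1 else 0) + (if x = c then 1 else 0)) *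
      ((if y = b then 1 else 0) + (if y = d then 1 else 0)) * g x y =
    g a b + g a d + (g c b + g c d) := by
  have h : ∀ (e f : X) (k : X → ZMod 2),
      ∑ x, ((if x = e then 1 else 0) + (if x = f then 1 else 0)) * k x = k e + k f := by
    intro e f k
    simp [add_mul, Finset.sum_add_distrib]
  simp_rw [mul_assoc, ← Finset.mul_sum, h]

theorem isNoncrossing_stack {m n p : ℕ} {r : Setoid (Fin m ⊕ Fin n)} {s : Setoid (Fin n ⊕ Fin p)}
    (hr : IsMatching r) (hs : IsMatching s)
    (hr' : IsNoncrossing (pos m n) r) (hs' : IsNoncrossing (pos n p) s) :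
    IsNoncrossing (pos m p) (stack r s) := by
  classical
  obtain ⟨σ, σ1, σ2, σ3⟩ := hr.exists_partner
  obtain ⟨τ, τ1, τ2, τ3⟩ := hs.exists_partner
  obtain ⟨ρ, ρ1, ρ2, ρ3⟩ := (isMatching_stack hr hs).exists_partner
  intro a b c d hab hbc hcd hac hbd
  -- the indicator function of a component
  let χ : (Fin m ⊕ Fin p) → (Fin m ⊕ Fin p) ⊕ Fin n → ZMod 2 :=
    fun x y => if glue r s (Sum.inl x) y then 1 else 0
  have gσ : ∀ y, glue r s (inFirst y) (inFirst (σ y)) := fun y =>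
    .rel _ _ (.inl ⟨y, σ y, (σ3 _ _).2 (.inr rfl), rfl, rfl⟩)
  have gτ : ∀ y, glue r s (inSecond y) (inSecond (τ y)) := fun y =>
    .rel _ _ (.inr ⟨y, τ y, (τ3 _ _).2 (.inr rfl), rfl, rfl⟩)
  have inv : ∀ x y z, glue r s y z → χ x z = χ x y := by
    intro x y z h
    have : glue r s (Sum.inl x) z ↔ glue r s (Sum.inl x) y :=
      ⟨fun h' => (glue r s).trans h' ((glue r s).symm h), fun h' => (glue r s).trans h' h⟩
    simp only [χ, this]
  have nab : ¬ glue r s (Sum.inl a) (Sum.inl b) := by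
    intro h
    rcases (ρ3 a c).1 hac with e | e
    · subst e; omega
    · rcases (ρ3 a b).1 h with e' | e'
      · subst e'; omega
      · rw [← e] at e'; subst e'; omega
  have disj : ∀ y, χ a y * χ b y = 0 := by
    intro y
    simp only [χ]
    split_ifs with h1 h2
    · exact absurd ((glue r s).trans h1 ((glue r s).symm h2)) nab
    all_goals simp
  have L1 := link_eq_zero (pos m n) (pos_injective m n) r hr' σ σ1 σ2 σ3 (χ a ∘ inFirst)
    (χ b ∘ inFirst) (fun y => inv _ _ _ (gσ y)) (fun y => inv _ _ _ (gσ y)) (fun y => disj _)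
  have L2 := link_eq_zero (pos n p) (pos_injective n p) s hs' τ τ1 τ2 τ3 (χ a ∘ inSecond)
    (χ b ∘ inSecond) (fun y => inv _ _ _ (gτ y)) (fun y => inv _ _ _ (gτ y)) (fun y => disj _)
  have P2 : ∀ x, ∑ y, (χ x ∘ inSecond) y = 0 := fun x =>
    sum_invariant_eq_zero τ τ1 τ2 _ fun y => by
      rw [Function.comp, Function.comp, inv _ _ _ (gτ y)]; exact CharTwo.add_self_eq_zero _
  have val : ∀ x y, x ≠ y → stack r s x y → ∀ z, χ x (Sum.inl z) =
      (if z = x then 1 else 0) + (if z = y then 1 else 0) := by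
    intro x y hne hxy z
    have : glue r s (Sum.inl x) (Sum.inl z) ↔ z = x ∨ z = y := by
      rcases (ρ3 x y).1 hxy with e | e
      · exact absurd e.symm hne
      · rw [e]; exact ρ3 x z
    simp only [χ, this]
    by_cases h1 : z = x <;> by_cases h2 : z = y <;> simp [h1, h2]
    · exact absurd (h1.symm.trans h2) hne
    · exact hne
    · exact hne.symm
  have L3 : ∑ x, ∑ y, χ a (Sum.inl x) * χ b (Sum.inl y) *
      (if pos m p x < pos m p y then 1 else 0) = 0 := by
    have Q4 := P2 b
    have hB : ∑ x, ∑ y, χ a (Sum.inr x) * χ b (Sum.inr y) *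
          (if pos n p (Sum.inl x) < pos n p (Sum.inl y) then 1 else 0) +
        ∑ x, ∑ y, χ a (Sum.inr x) * χ b (Sum.inr y) *
          (if pos m n (Sum.inr x) < pos m n (Sum.inr y) then 1 else 0) =
        (∑ x, χ a (Sum.inr x)) * ∑ y, χ b (Sum.inr y) := by
      rw [Finset.sum_mul_sum, ← Finset.sum_add_distrib]
      refine Finset.sum_congr rfl fun x _ => ?_
      rw [← Finset.sum_add_distrib]
      refine Finset.sum_congr rfl fun y _ => ?_
      rw [← mul_add]
      by_cases e : x = y
      · subst e; simp [disj]
      · have e' : (x : ℕ) ≠ y := fun h => e (Fin.ext h)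
        have hx := x.2
        have hy := y.2
        have e1 : pos n p (Sum.inl x) < pos n p (Sum.inl y) ↔ (x : ℕ) < y := Iff.rfl
        have e2 : pos m n (Sum.inr x) < pos m n (Sum.inr y) ↔ (y : ℕ) < x := by
          simp only [pos, Sum.elim_inr]; omega
        by_cases h : (x : ℕ) < y
        · rw [if_pos (e1.2 h), if_neg (fun h' => absurd (e2.1 h') (by omega))]; simp
        · rw [if_neg (fun h' => h (e1.1 h')), if_pos (e2.2 (by omega))]; simp
    have n1 : ∀ (x : Fin m) (y : Fin n), pos m n (Sum.inl x) < pos m n (Sum.inr y) := by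
      intro x y; simp only [pos, Sum.elim_inl, Sum.elim_inr]; omega
    have n2 : ∀ (x : Fin n) (y : Fin p), pos n p (Sum.inl x) < pos n p (Sum.inr y) := by
      intro x y; simp only [pos, Sum.elim_inl, Sum.elim_inr]; omega
    have n3 : ∀ (x : Fin m) (y : Fin p), pos m p (Sum.inl x) < pos m p (Sum.inr y) := by
      intro x y; simp only [pos, Sum.elim_inl, Sum.elim_inr]; omega
    have eA : ∀ x y : Fin m, (pos m n (Sum.inl x) < pos m n (Sum.inl y)) ↔
        (pos m p (Sum.inl x) < pos m p (Sum.inl y)) := fun _ _ => Iff.rfl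
    have eC : ∀ x y : Fin p, (pos n p (Sum.inr x) < pos n p (Sum.inr y)) ↔
        (pos m p (Sum.inr x) < pos m p (Sum.inr y)) := by
      intro x y; simp only [pos, Sum.elim_inr]; omega
    simp only [Fintype.sum_sum_type, Function.comp, inFirst, inSecond, Sum.elim_inl, Sum.elim_inr,
      n1, n2, n3, (n1 _ _).not_gt, (n2 _ _).not_gt, (n3 _ _).not_gt, if_true, if_false, mul_one,
      mul_zero, Finset.sum_const_zero, Finset.sum_add_distrib, eA, eC]
      at L1 L2 Q4 ⊢
    simp only [← Finset.mul_sum, ← Finset.sum_mul] at L1 L2 ⊢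
    have two : (2 : ZMod 2) = 0 := rfl
    linear_combination L1 + L2 - hB + ((∑ i, χ a (Sum.inl (Sum.inl i))) -
      ∑ i, χ a (Sum.inr i)) * Q4 -
      (∑ i, χ a (Sum.inl (Sum.inl i))) * (∑ i, χ b (Sum.inr i)) * two
  rw [show (∑ x, ∑ y, χ a (Sum.inl x) * χ b (Sum.inl y) *
      (if pos m p x < pos m p y then 1 else 0)) = (1 : ZMod 2) from ?_] at L3
  · exact absurd L3 (by decide)
  · have hac' : a ≠ c := by rintro rfl; omega
    have hbd' : b ≠ d := by rintro rfl; omega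
    simp only [val a c hac' hac, val b d hbd' hbd]
    rw [sum_pairs, if_pos hab, if_pos (hab.trans (hbc.trans hcd)), if_pos hcd, if_neg hbc.not_gt]
    decide

/-- A loop-free planar diagram `m → n`, up to isotopy: `m` dots on the bottom and `n` dots on the
top of a rectangle, every dot being joined to exactly one other dot, by non-crossing lines.
It is recorded by the relation of lying on the same line. -/
@[ext]
structure Diagram (m n : ℕ) where
  rel : Setoid (Fin m ⊕ Fin n)
  matching : IsMatching rel
  noncrossing : IsNoncrossing (pos m n) rel

theorem isMatching_idRel (n : ℕ) : IsMatching (idRel (Fin n)) := by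
  rintro (x | x)
  · refine ⟨Sum.inr x, ⟨by simp, rfl⟩, ?_⟩
    rintro (y | y) ⟨h1, h2⟩
    · exact absurd (congrArg Sum.inl (Eq.symm h2)) h1
    · exact congrArg Sum.inr (Eq.symm h2)
  · refine ⟨Sum.inl x, ⟨by simp, rfl⟩, ?_⟩
    rintro (y | y) ⟨h1, h2⟩
    · exact congrArg Sum.inl (Eq.symm h2)
    · exact absurd (congrArg Sum.inr (Eq.symm h2)) h1

theorem isNoncrossing_idRel (n : ℕ) : IsNoncrossing (pos n n) (idRel (Fin n)) := by
  intro a b c d hab hbc hcd hac hbd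
  have h1 : Sum.elim id id a = Sum.elim id id c := hac
  have h2 : Sum.elim id id b = Sum.elim id id d := hbd
  rcases a with a | a <;> rcases b with b | b <;> rcases c with c | c <;> rcases d with d | d <;>
    simp only [pos, Sum.elim_inl, Sum.elim_inr, id] at hab hbc hcd h1 h2 <;> subst h1 h2 <;> omega

/-- The identity diagram. -/
def Diagram.id (n : ℕ) : Diagram n n := ⟨idRel _, isMatching_idRel n, isNoncrossing_idRel n⟩

/-- Vertical stacking (`g` on top of `f`), with closed loops removed. -/
def Diagram.comp {m n p : ℕ} (f : Diagram m n) (g : Diagram n p) : Diagram m p :=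
  ⟨stack f.rel g.rel, isMatching_stack f.matching g.matching,
    isNoncrossing_stack f.matching g.matching f.noncrossing g.noncrossing⟩

/-- The number of closed loops which arise when stacking `g` on top of `f`. -/
noncomputable def Diagram.loops {m n p : ℕ} (f : Diagram m n) (g : Diagram n p) : ℕ :=
  TemperleyLieb.loops f.rel g.rel

/-- The cup, the unique diagram `0 → 2`. -/
def Diagram.cup : Diagram 0 2 where
  rel := ⊤
  matching := by
    rintro (x | x)
    · exact x.elim0
    · refine ⟨Sum.inr x.rev, ⟨?_, trivial⟩, ?_⟩
      · fin_cases x <;> decide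
      · rintro (y | y) ⟨h, -⟩
        · exact y.elim0
        · fin_cases x <;> fin_cases y <;> simp_all
  noncrossing := by
    rintro (a | a) (b | b) (c | c) (d | d) h1 h2 h3 <;>
      simp only [pos, Sum.elim_inl, Sum.elim_inr] at h1 h2 h3 <;> omega

/-- The cap, the unique diagram `2 → 0`. -/
def Diagram.cap : Diagram 2 0 where
  rel := ⊤
  matching := by
    rintro (x | x)
    · refine ⟨Sum.inl x.rev, ⟨?_, trivial⟩, ?_⟩
      · fin_cases x <;> decide
      · rintro (y | y) ⟨h, -⟩
        · fin_cases x <;> fin_cases y <;> simp_all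
        · exact y.elim0
    · exact x.elim0
  noncrossing := by
    rintro (a | a) (b | b) (c | c) (d | d) h1 h2 h3 <;>
      simp only [pos, Sum.elim_inl, Sum.elim_inr] at h1 h2 h3 <;> omega

section Tensor

variable {m m' n n' p p' : ℕ}

/-- The dots of the left and of the right factor in a horizontal juxtaposition. -/
def splitDots (m m' n n' : ℕ) :
    Fin (m + m') ⊕ Fin (n + n') ≃ (Fin m ⊕ Fin n) ⊕ (Fin m' ⊕ Fin n') :=
  (Equiv.sumCongr finSumFinEquiv.symm finSumFinEquiv.symm).trans (Equiv.sumSumSumComm _ _ _ _)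

/-- Horizontal juxtaposition: no dot on the left is joined to a dot on the right. -/
def juxtapose (r : Setoid (Fin m ⊕ Fin n)) (s : Setoid (Fin m' ⊕ Fin n')) :
    Setoid (Fin (m + m') ⊕ Fin (n + n')) where
  r x y := Sum.LiftRel r s (splitDots m m' n n' x) (splitDots m m' n n' y)
  iseqv :=
    { refl := fun x => by
        rcases splitDots m m' n n' x with a | a
        · exact .inl (r.refl a)
        · exact .inr (s.refl a)
      symm := fun {x y} h => by
        revert h
        generalize splitDots m m' n n' x = a
        generalize splitDots m m' n n' y = b
        rintro (h | h)
        · exact .inl (r.symm h)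
        · exact .inr (s.symm h)
      trans := fun {x y z} h h' => by
        revert h h'
        generalize splitDots m m' n n' x = a
        generalize splitDots m m' n n' y = b
        generalize splitDots m m' n n' z = c
        rintro (h | h) (h' | h')
        · exact .inl (r.trans h h')
        · exact .inr (s.trans h h') }

theorem juxtapose_iff (r : Setoid (Fin m ⊕ Fin n)) (s : Setoid (Fin m' ⊕ Fin n'))
    (x y : (Fin m ⊕ Fin n) ⊕ (Fin m' ⊕ Fin n')) :
    juxtapose r s ((splitDots m m' n n').symm x) ((splitDots m m' n n').symm y) ↔
      Sum.LiftRel r s x y := by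
  change Sum.LiftRel r s (splitDots m m' n n' _) (splitDots m m' n n' _) ↔ _
  rw [Equiv.apply_symm_apply, Equiv.apply_symm_apply]

theorem isMatching_juxtapose {r : Setoid (Fin m ⊕ Fin n)} {s : Setoid (Fin m' ⊕ Fin n')}
    (hr : IsMatching r) (hs : IsMatching s) : IsMatching (juxtapose r s) := by
  intro x
  obtain ⟨x, rfl⟩ := (splitDots m m' n n').symm.surjective x
  rcases x with x | x
  · obtain ⟨y, ⟨h1, h2⟩, h3⟩ := hr x
    refine ⟨(splitDots m m' n n').symm (Sum.inl y), ⟨by simpa using h1, ?_⟩, ?_⟩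
    · exact (juxtapose_iff r s _ _).2 (.inl h2)
    · rintro z ⟨z1, z2⟩
      obtain ⟨z, rfl⟩ := (splitDots m m' n n').symm.surjective z
      rw [juxtapose_iff] at z2
      cases z2 with
      | inl h => rw [h3 _ ⟨by simpa using z1, h⟩]
  · obtain ⟨y, ⟨h1, h2⟩, h3⟩ := hs x
    refine ⟨(splitDots m m' n n').symm (Sum.inr y), ⟨by simpa using h1, ?_⟩, ?_⟩
    · exact (juxtapose_iff r s _ _).2 (.inr h2)
    · rintro z ⟨z1, z2⟩
      obtain ⟨z, rfl⟩ := (splitDots m m' n n').symm.surjective z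
      rw [juxtapose_iff] at z2
      cases z2 with
      | inr h => rw [h3 _ ⟨by simpa using z1, h⟩]

theorem pos_splitDots (x : (Fin m ⊕ Fin n) ⊕ (Fin m' ⊕ Fin n')) :
    pos (m + m') (n + n') ((splitDots m m' n n').symm x) =
      Sum.elim (Sum.elim (fun i : Fin m => (i : ℕ)) (fun j : Fin n => m + m' + n' + (n - 1 - j)))
        (fun y => m + pos m' n' y) x := by
  rcases x with (x | x) | (x | x) <;> simp [splitDots, pos] <;> omega

theorem isNoncrossing_juxtapose {r : Setoid (Fin m ⊕ Fin n)} {s : Setoid (Fin m' ⊕ Fin n')}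
    (hr : IsNoncrossing (pos m n) r) (hs : IsNoncrossing (pos m' n') s) :
    IsNoncrossing (pos (m + m') (n + n')) (juxtapose r s) := by
  intro a b c d hab hbc hcd hac hbd
  obtain ⟨a, rfl⟩ := (splitDots m m' n n').symm.surjective a
  obtain ⟨b, rfl⟩ := (splitDots m m' n n').symm.surjective b
  obtain ⟨c, rfl⟩ := (splitDots m m' n n').symm.surjective c
  obtain ⟨d, rfl⟩ := (splitDots m m' n n').symm.surjective d
  rw [juxtapose_iff] at hac hbd
  simp only [pos_splitDots] at hab hbc hcd
  have lt' : ∀ y, pos m' n' y < m' + n' := by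
    rintro (y | y) <;> simp only [pos, Sum.elim_inl, Sum.elim_inr] <;> omega
  rcases hac with @⟨a, c, hac⟩ | @⟨a, c, hac⟩ <;> rcases hbd with @⟨b, d, hbd⟩ | @⟨b, d, hbd⟩ <;>
    simp only [Sum.elim_inl, Sum.elim_inr] at hab hbc hcd
  · refine hr a b c d ?_ ?_ ?_ hac hbd
    · rcases a with a | a <;> rcases b with b | b <;>
        simp only [Sum.elim_inl, Sum.elim_inr, pos] at hab ⊢ <;> omega
    · rcases b with b | b <;> rcases c with c | c <;>
        simp only [Sum.elim_inl, Sum.elim_inr, pos] at hbc ⊢ <;> omega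
    · rcases c with c | c <;> rcases d with d | d <;>
        simp only [Sum.elim_inl, Sum.elim_inr, pos] at hcd ⊢ <;> omega
  · have hb := lt' b
    have hd := lt' d
    rcases c with c | c <;> simp only [Sum.elim_inl, Sum.elim_inr] at hbc hcd <;> omega
  · have ha := lt' a
    have hc := lt' c
    rcases b with b | b <;> simp only [Sum.elim_inl, Sum.elim_inr] at hab hbc <;> omega
  · exact hs a b c d (by omega) (by omega) (by omega) hac hbd

/-- Horizontal juxtaposition of diagrams. -/
def Diagram.tensor (f : Diagram m n) (g : Diagram m' n') : Diagram (m + m') (n + n') :=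
  ⟨juxtapose f.rel g.rel, isMatching_juxtapose f.matching g.matching,
    isNoncrossing_juxtapose f.noncrossing g.noncrossing⟩

theorem mat_juxtapose (r : Setoid (Fin m ⊕ Fin n)) (s : Setoid (Fin m' ⊕ Fin n'))
    (α : Fin m → Bool) (α' : Fin m' → Bool) (β : Fin n → Bool) (β' : Fin n' → Bool) :
    mat (juxtapose r s) (Fin.append α α') (Fin.append β β') = mat r α β * mat s α' β' := by
  have h : Resp (juxtapose r s) (Sum.elim (Fin.append α α') (Fin.append β β')) ↔
      Resp r (Sum.elim α β) ∧ Resp s (Sum.elim α' β') := by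
    have hv : ∀ x, Sum.elim (Fin.append α α') (Fin.append β β')
        ((splitDots m m' n n').symm x) = Sum.elim (Sum.elim α β) (Sum.elim α' β') x := by
      rintro ((x | x) | (x | x)) <;> simp [splitDots]
    constructor
    · intro h
      constructor
      · intro x y hxy
        have := h _ _ ((juxtapose_iff r s (Sum.inl x) (Sum.inl y)).2 (.inl hxy))
        rwa [hv, hv] at this
      · intro x y hxy
        have := h _ _ ((juxtapose_iff r s (Sum.inr x) (Sum.inr y)).2 (.inr hxy))
        rwa [hv, hv] at this
    · rintro ⟨h1, h2⟩ x y hxy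
      obtain ⟨x, rfl⟩ := (splitDots m m' n n').symm.surjective x
      obtain ⟨y, rfl⟩ := (splitDots m m' n n').symm.surjective y
      rw [juxtapose_iff] at hxy
      rw [hv, hv]
      cases hxy with
      | inl h => exact h1 _ _ h
      | inr h => exact h2 _ _ h
  unfold mat
  by_cases h1 : Resp r (Sum.elim α β) <;> by_cases h2 : Resp s (Sum.elim α' β') <;>
    simp [h, h1, h2]

theorem append_surj (α : Fin (m + m') → Bool) :
    ∃ α₁ α₂, α = Fin.append (m := m) (n := m') α₁ α₂ :=
  ⟨_, _, (Fin.append_castAdd_natAdd (f := α)).symm⟩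

theorem stack_juxtapose (r : Setoid (Fin m ⊕ Fin n)) (r' : Setoid (Fin m' ⊕ Fin n'))
    (s : Setoid (Fin n ⊕ Fin p)) (s' : Setoid (Fin n' ⊕ Fin p')) :
    loops (juxtapose r r') (juxtapose s s') = loops r s + loops r' s' ∧
      stack (juxtapose r r') (juxtapose s s') = juxtapose (stack r s) (stack r' s') := by
  apply scaled_mat_inj
  intro α γ
  obtain ⟨α, α', rfl⟩ := append_surj α
  obtain ⟨γ, γ', rfl⟩ := append_surj γ
  rw [← mat_stack, mat_juxtapose, pow_add, mul_mul_mul_comm, ← mat_stack, ← mat_stack,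
    Finset.sum_mul_sum, ← Fintype.sum_prod_type', ← (Fin.appendEquiv n n').sum_comp]
  refine Finset.sum_congr rfl fun β _ => ?_
  simp only [Fin.appendEquiv, Equiv.coe_fn_mk, mat_juxtapose]
  exact mul_mul_mul_comm _ _ _ _

theorem juxtapose_id (m n : ℕ) :
    juxtapose (idRel (Fin m)) (idRel (Fin n)) = idRel (Fin (m + n)) := by
  classical
  apply mat_inj
  funext α β
  obtain ⟨α, α', rfl⟩ := append_surj α
  obtain ⟨β, β', rfl⟩ := append_surj β
  rw [mat_juxtapose, mat_idRel, mat_idRel, mat_idRel]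
  have : Fin.append α α' = Fin.append β β' ↔ α = β ∧ α' = β' := by
    have := (Fin.appendEquiv (α := Bool) m n).injective.eq_iff (a := (α, α')) (b := (β, β'))
    simpa [Fin.appendEquiv] using this
  simp only [this, ite_and]
  split_ifs <;> rfl

end Tensor

theorem Diagram.id_comp {m n : ℕ} (f : Diagram m n) :
    (Diagram.id m).comp f = f ∧ (Diagram.id m).loops f = 0 :=
  ⟨Diagram.ext (id_stack f.rel).2, (id_stack f.rel).1⟩

theorem Diagram.comp_id {m n : ℕ} (f : Diagram m n) :
    f.comp (Diagram.id n) = f ∧ f.loops (Diagram.id n) = 0 :=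
  ⟨Diagram.ext (stack_id f.rel).2, (stack_id f.rel).1⟩

theorem Diagram.assoc {m n p q : ℕ} (f : Diagram m n) (g : Diagram n p) (h : Diagram p q) :
    (f.comp g).comp h = f.comp (g.comp h) ∧
      f.loops g + (f.comp g).loops h = g.loops h + f.loops (g.comp h) :=
  ⟨Diagram.ext (stack_assoc f.rel g.rel h.rel).2, (stack_assoc f.rel g.rel h.rel).1⟩

theorem Diagram.tensor_comp {m m' n n' p p' : ℕ} (f : Diagram m n) (f' : Diagram m' n')
    (g : Diagram n p) (g' : Diagram n' p') :
    (f.tensor f').comp (g.tensor g') = (f.comp g).tensor (f'.comp g') ∧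
      (f.tensor f').loops (g.tensor g') = f.loops g + f'.loops g' :=
  ⟨Diagram.ext (stack_juxtapose f.rel f'.rel g.rel g'.rel).2,
    (stack_juxtapose f.rel f'.rel g.rel g'.rel).1⟩

theorem Diagram.tensor_id (m n : ℕ) :
    (Diagram.id m).tensor (Diagram.id n) = Diagram.id (m + n) :=
  Diagram.ext (juxtapose_id m n)

theorem tensor_rel_iff {m m' n n' : ℕ} (f : Diagram m n) (g : Diagram m' n')
    (x y : (Fin m ⊕ Fin n) ⊕ (Fin m' ⊕ Fin n')) :
    (f.tensor g).rel ((splitDots m m' n n').symm x) ((splitDots m m' n n').symm y) ↔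
      Sum.LiftRel f.rel g.rel x y :=
  juxtapose_iff f.rel g.rel x y

section Relations

variable {m₁ m₂ m₃ n₁ n₂ n₃ : ℕ}

theorem tensor_assoc_rel (f : Diagram m₁ n₁) (g : Diagram m₂ n₂) (h : Diagram m₃ n₃)
    (x y : Fin (m₁ + m₂ + m₃) ⊕ Fin (n₁ + n₂ + n₃)) :
    ((f.tensor g).tensor h).rel x y ↔ (f.tensor (g.tensor h)).rel
      (Sum.map (Fin.cast (Nat.add_assoc _ _ _)) (Fin.cast (Nat.add_assoc _ _ _)) x)
      (Sum.map (Fin.cast (Nat.add_assoc _ _ _)) (Fin.cast (Nat.add_assoc _ _ _)) y) := by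
  have e : ∀ x : Fin (m₁ + m₂ + m₃) ⊕ Fin (n₁ + n₂ + n₃),
      splitDots m₁ (m₂ + m₃) n₁ (n₂ + n₃)
        (Sum.map (Fin.cast (Nat.add_assoc _ _ _)) (Fin.cast (Nat.add_assoc _ _ _)) x) =
      Sum.elim (fun z => Sum.map _root_.id (fun w => (splitDots m₂ m₃ n₂ n₃).symm (Sum.inl w))
          (splitDots m₁ m₂ n₁ n₂ z))
        (fun w => Sum.inr ((splitDots m₂ m₃ n₂ n₃).symm (Sum.inr w)))
        (splitDots (m₁ + m₂) m₃ (n₁ + n₂) n₃ x) := by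
    intro x
    obtain ⟨x, rfl⟩ := (splitDots (m₁ + m₂) m₃ (n₁ + n₂) n₃).symm.surjective x
    rw [Equiv.apply_symm_apply, ← Equiv.eq_symm_apply]
    rcases x with x | (x | x)
    · obtain ⟨x, rfl⟩ := (splitDots m₁ m₂ n₁ n₂).symm.surjective x
      rcases x with (x | x) | (x | x) <;> simp [splitDots] <;> rfl
    · simp [splitDots]; ext; simp [Nat.add_assoc]
    · simp [splitDots]; ext; simp [Nat.add_assoc]
  change Sum.LiftRel _ _ _ _ ↔ Sum.LiftRel _ _ _ _
  rw [e, e]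
  generalize splitDots (m₁ + m₂) m₃ (n₁ + n₂) n₃ x = a
  generalize splitDots (m₁ + m₂) m₃ (n₁ + n₂) n₃ y = b
  rcases a with a | a <;> rcases b with b | b <;>
    simp only [Sum.elim_inl, Sum.elim_inr, Sum.liftRel_inl_inl, Sum.liftRel_inr_inr,
      Sum.not_liftRel_inl_inr, Sum.not_liftRel_inr_inl]
  · change Sum.LiftRel _ _ _ _ ↔ _
    generalize splitDots m₁ m₂ n₁ n₂ a = a
    generalize splitDots m₁ m₂ n₁ n₂ b = b
    rcases a with a | a <;> rcases b with b | b <;>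
      simp [tensor_rel_iff]
  · generalize splitDots m₁ m₂ n₁ n₂ a = a
    rcases a with a | a <;> simp [tensor_rel_iff]
  · generalize splitDots m₁ m₂ n₁ n₂ b = b
    rcases b with b | b <;> simp [tensor_rel_iff]
  · rw [tensor_rel_iff, Sum.liftRel_inr_inr]

end Relations

theorem mat_cup (α : Fin 0 → Bool) (β : Fin 2 → Bool) :
    mat Diagram.cup.rel α β = if β 0 = β 1 then 1 else 0 := by
  unfold mat
  congr 1
  rw [eq_iff_iff]
  constructor
  · intro h
    exact h (Sum.inr 0) (Sum.inr 1) trivial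
  · rintro h (x | x) (y | y) -
    · exact x.elim0
    · exact x.elim0
    · exact y.elim0
    · fin_cases x <;> fin_cases y <;> simp [h]

theorem mat_cap (α : Fin 2 → Bool) (β : Fin 0 → Bool) :
    mat Diagram.cap.rel α β = if α 0 = α 1 then 1 else 0 := by
  unfold mat
  congr 1
  rw [eq_iff_iff]
  constructor
  · intro h
    exact h (Sum.inl 0) (Sum.inl 1) trivial
  · rintro h (x | x) (y | y) -
    · fin_cases x <;> fin_cases y <;> simp [h]
    · exact y.elim0
    · exact x.elim0
    · exact x.elim0

theorem Diagram.cup_cap : Diagram.cup.comp Diagram.cap = Diagram.id 0 ∧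
    Diagram.cup.loops Diagram.cap = 1 := by
  have h := scaled_mat_inj (r := stack Diagram.cup.rel Diagram.cap.rel) (s := idRel (Fin 0))
    (a := TemperleyLieb.loops Diagram.cup.rel Diagram.cap.rel) (b := 1) (by
      intro α β
      rw [← mat_stack]
      simp only [mat_cup, mat_cap, mat_idRel, Subsingleton.elim α β, if_true]
      decide)
  exact ⟨Diagram.ext h.2, h.1⟩

theorem mat_tensor {m m' n n' : ℕ} (f : Diagram m n) (g : Diagram m' n')
    (α : Fin (m + m') → Bool) (β : Fin (n + n') → Bool) :
    mat (f.tensor g).rel α β =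
      mat f.rel (fun i => α (Fin.castAdd m' i)) (fun i => β (Fin.castAdd n' i)) *
      mat g.rel (fun i => α (Fin.natAdd m i)) (fun i => β (Fin.natAdd n i)) := by
  obtain ⟨α, α', rfl⟩ := append_surj α
  obtain ⟨β, β', rfl⟩ := append_surj β
  simp [Diagram.tensor, mat_juxtapose]

theorem mat_id_one (α β : Fin 1 → Bool) :
    mat (Diagram.id 1).rel α β = if α 0 = β 0 then 1 else 0 := by
  have : α = β ↔ α 0 = β 0 := by rw [funext_iff, Fin.forall_fin_one]
  simp only [Diagram.id, mat_idRel, this]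

/-- The first zigzag relation. -/
theorem Diagram.zigzag :
    Diagram.comp (n := 3) (Diagram.tensor (Diagram.id 1) Diagram.cup) (Diagram.tensor Diagram.cap (Diagram.id 1)) =
      Diagram.id 1 ∧
    Diagram.loops (n := 3) (Diagram.tensor (Diagram.id 1) Diagram.cup) (Diagram.tensor Diagram.cap (Diagram.id 1)) = 0 := by
  have h1 : ∀ (α : Fin 1 → Bool) (β : Fin 3 → Bool),
      mat (A := Fin 1) (B := Fin 3) (Diagram.tensor (Diagram.id 1) Diagram.cup).rel α β =
        (if α 0 = β 0 then 1 else 0) * (if β 1 = β 2 then 1 else 0) := fun α β =>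
    (mat_tensor (Diagram.id 1) Diagram.cup α β).trans (by rw [mat_cup, mat_id_one]; first | done | rfl)
  have h2 : ∀ (β : Fin 3 → Bool) (γ : Fin 1 → Bool),
      mat (A := Fin 3) (B := Fin 1) (Diagram.tensor Diagram.cap (Diagram.id 1)).rel β γ =
        (if β 0 = β 1 then 1 else 0) * (if β 2 = γ 0 then 1 else 0) := fun β γ =>
    (mat_tensor Diagram.cap (Diagram.id 1) β γ).trans (by rw [mat_cap, mat_id_one]; first | done | rfl)
  have h := scaled_mat_inj
    (r := stack (B := Fin 3) (Diagram.tensor (Diagram.id 1) Diagram.cup).rel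
      (Diagram.tensor Diagram.cap (Diagram.id 1)).rel)
    (s := idRel (Fin 1))
    (a := TemperleyLieb.loops (B := Fin 3) (Diagram.tensor (Diagram.id 1) Diagram.cup).rel
      (Diagram.tensor Diagram.cap (Diagram.id 1)).rel) (b := 0) (fun α γ => by
      refine (mat_stack (B := Fin 3) _ _ _ _).symm.trans
        (((Finset.sum_congr rfl fun β _ => congrArg₂ _ (h1 α β) (h2 β γ))).trans ?_)
      refine Eq.trans ?_ (congrArg _ (mat_id_one α γ).symm)
      revert α γ
      decide)
  exact ⟨Diagram.ext h.2, h.1⟩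

/-- The second zigzag relation. -/
theorem Diagram.zigzag' :
    Diagram.comp (n := 3) (Diagram.tensor Diagram.cup (Diagram.id 1)) (Diagram.tensor (Diagram.id 1) Diagram.cap) =
      Diagram.id 1 ∧
    Diagram.loops (n := 3) (Diagram.tensor Diagram.cup (Diagram.id 1)) (Diagram.tensor (Diagram.id 1) Diagram.cap) = 0 := by
  have h1 : ∀ (α : Fin 1 → Bool) (β : Fin 3 → Bool),
      mat (A := Fin 1) (B := Fin 3) (Diagram.tensor Diagram.cup (Diagram.id 1)).rel α β =
        (if β 0 = β 1 then 1 else 0) * (if α 0 = β 2 then 1 else 0) := fun α β =>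
    (mat_tensor Diagram.cup (Diagram.id 1) α β).trans (by rw [mat_cup, mat_id_one]; first | done | rfl)
  have h2 : ∀ (β : Fin 3 → Bool) (γ : Fin 1 → Bool),
      mat (A := Fin 3) (B := Fin 1) (Diagram.tensor (Diagram.id 1) Diagram.cap).rel β γ =
        (if β 0 = γ 0 then 1 else 0) * (if β 1 = β 2 then 1 else 0) := fun β γ =>
    (mat_tensor (Diagram.id 1) Diagram.cap β γ).trans (by rw [mat_cap, mat_id_one]; first | done | rfl)
  have h := scaled_mat_inj
    (r := stack (B := Fin 3) (Diagram.tensor Diagram.cup (Diagram.id 1)).rel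
      (Diagram.tensor (Diagram.id 1) Diagram.cap).rel)
    (s := idRel (Fin 1))
    (a := TemperleyLieb.loops (B := Fin 3) (Diagram.tensor Diagram.cup (Diagram.id 1)).rel
      (Diagram.tensor (Diagram.id 1) Diagram.cap).rel) (b := 0) (fun α γ => by
      refine (mat_stack (B := Fin 3) _ _ _ _).symm.trans
        (((Finset.sum_congr rfl fun β _ => congrArg₂ _ (h1 α β) (h2 β γ))).trans ?_)
      refine Eq.trans ?_ (congrArg _ (mat_id_one α γ).symm)
      revert α γ
      decide)
  exact ⟨Diagram.ext h.2, h.1⟩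

/-- The root of unity `q = exp (π i / (k + 2))`. -/
noncomputable def q (k : ℕ) : ℂ := Complex.exp (Real.pi * Complex.I / (k + 2))

/-- The quantum integer `[n]`. -/
noncomputable def qint (k n : ℕ) : ℂ := (q k ^ n - (q k ^ n)⁻¹) / (q k - (q k)⁻¹)

/-- The value `δ = -[2]` of a closed loop. -/
noncomputable def loopValue (k : ℕ) : ℂ := -qint k 2

theorem q_pow_ne (k n : ℕ) (h1 : 1 ≤ n) (h2 : n ≤ k + 1) : q k ^ n - (q k ^ n)⁻¹ ≠ 0 := by
  intro h
  have hq : q k ^ n ≠ 0 := pow_ne_zero _ (Complex.exp_ne_zero _)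
  have h3 : q k ^ n * q k ^ n = 1 := by
    have := sub_eq_zero.1 h
    nth_rewrite 2 [this]
    exact mul_inv_cancel₀ hq
  rw [← pow_add, q, ← Complex.exp_nat_mul, Complex.exp_eq_one_iff] at h3
  obtain ⟨z, hz⟩ := h3
  have hk : (k : ℂ) + 2 ≠ 0 := by exact_mod_cast (by omega : k + 2 ≠ 0)
  have hpi : (Real.pi : ℂ) * Complex.I ≠ 0 :=
    mul_ne_zero (by exact_mod_cast Real.pi_ne_zero) Complex.I_ne_zero
  have h4 : ((n : ℂ)) = z * (k + 2) := by
    field_simp at hz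
    push_cast at hz
    linear_combination hz / 2
  have h6 : (n : ℤ) = z * (k + 2) := by exact_mod_cast h4
  rcases lt_trichotomy z 0 with hz0 | hz0 | hz0
  · nlinarith
  · subst hz0; omega
  · nlinarith

theorem q_ne_zero (k : ℕ) : q k ≠ 0 := Complex.exp_ne_zero _

theorem q_sub_inv_ne (k : ℕ) : q k - (q k)⁻¹ ≠ 0 := by
  simpa using q_pow_ne k 1 le_rfl (by omega)

theorem qint_ne_zero (k n : ℕ) (h1 : 1 ≤ n) (h2 : n ≤ k + 1) : qint k n ≠ 0 :=
  div_ne_zero (q_pow_ne k n h1 h2) (q_sub_inv_ne k)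

theorem qint_zero (k : ℕ) : qint k 0 = 0 := by simp [qint]

theorem qint_one (k : ℕ) : qint k 1 = 1 := by simp [qint, div_self (q_sub_inv_ne k)]

theorem qint_rec (k n : ℕ) : qint k 2 * qint k (n + 1) = qint k (n + 2) + qint k n := by
  have h1 := q_ne_zero k
  have h2 := q_sub_inv_ne k
  simp only [qint, div_mul_div_comm, ← add_div]
  rw [div_eq_div_iff (mul_ne_zero h2 h2) h2]
  field_simp
  ring

/-- The linear diagram category: objects are natural numbers, morphisms are linear combinations of
diagrams, and every closed loop is equal to the constant `δ`. Since each loop may be removed at the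
cost of a factor `δ`, the loop-free diagrams `m → n` form a basis of the morphisms `m ⟶ n`. -/
structure LinDiag (k : ℕ) where
  /-- the number of dots -/
  dots : ℕ

namespace LinDiag

variable {k : ℕ}

/-- Bilinear extension of stacking, each closed loop giving a factor `δ`. -/
noncomputable def compL (k m n p : ℕ) :
    (Diagram m n →₀ ℂ) →ₗ[ℂ] (Diagram n p →₀ ℂ) →ₗ[ℂ] (Diagram m p →₀ ℂ) :=
  Finsupp.linearCombination ℂ fun f => Finsupp.linearCombination ℂ fun g =>
    loopValue k ^ f.loops g • Finsupp.single (f.comp g) 1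

/-- Bilinear extension of juxtaposition. -/
noncomputable def tensorL (m n m' n' : ℕ) :
    (Diagram m n →₀ ℂ) →ₗ[ℂ] (Diagram m' n' →₀ ℂ) →ₗ[ℂ] (Diagram (m + m') (n + n') →₀ ℂ) :=
  Finsupp.linearCombination ℂ fun f => Finsupp.linearCombination ℂ fun g =>
    Finsupp.single (f.tensor g) 1

theorem compL_single {m n p : ℕ} (f : Diagram m n) (g : Diagram n p) :
    compL k m n p (Finsupp.single f 1) (Finsupp.single g 1) =
      loopValue k ^ f.loops g • Finsupp.single (f.comp g) 1 := by
  simp [compL]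

theorem tensorL_single {m n m' n' : ℕ} (f : Diagram m n) (g : Diagram m' n') :
    tensorL m n m' n' (Finsupp.single f 1) (Finsupp.single g 1) =
      Finsupp.single (f.tensor g) 1 := by
  simp [tensorL]

/-- Linear maps out of the span of the diagrams are determined on diagrams. -/
theorem induction_diagram {m n : ℕ} {P : (Diagram m n →₀ ℂ) → Prop} (f : Diagram m n →₀ ℂ)
    (h0 : P 0) (hadd : ∀ f g, P f → P g → P (f + g)) (hsmul : ∀ (c : ℂ) f, P f → P (c • f))
    (h : ∀ d, P (Finsupp.single d 1)) : P f := by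
  induction f using Finsupp.induction_linear with
  | zero => exact h0
  | add f g hf hg => exact hadd f g hf hg
  | single d c =>
    have := hsmul c _ (h d)
    rwa [Finsupp.smul_single_one] at this

noncomputable instance : Category (LinDiag k) where
  Hom X Y := Diagram X.dots Y.dots →₀ ℂ
  id X := Finsupp.single (Diagram.id X.dots) 1
  comp f g := compL k _ _ _ f g
  id_comp f := by
    induction f using induction_diagram with
    | h0 => simp
    | hadd f g hf hg => rw [map_add, hf, hg]
    | hsmul c f hf => rw [map_smul, hf]
    | h d => rw [compL_single, d.id_comp.1, d.id_comp.2, pow_zero, one_smul]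
  comp_id f := by
    induction f using induction_diagram with
    | h0 => simp
    | hadd f g hf hg => rw [map_add, LinearMap.add_apply, hf, hg]
    | hsmul c f hf => rw [map_smul, LinearMap.smul_apply, hf]
    | h d => rw [compL_single, d.comp_id.1, d.comp_id.2, pow_zero, one_smul]
  assoc f g h := by
    induction f using induction_diagram with
    | h0 => simp
    | hadd f f' hf hf' => simp only [map_add, LinearMap.add_apply, hf, hf']
    | hsmul c f hf => simp only [map_smul, LinearMap.smul_apply, hf]
    | h d =>
    induction g using induction_diagram with
    | h0 => simp
    | hadd f f' hf hf' => simp only [map_add, LinearMap.add_apply, hf, hf']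
    | hsmul c f hf => simp only [map_smul, LinearMap.smul_apply, hf]
    | h d' =>
    induction h using induction_diagram with
    | h0 => simp
    | hadd f f' hf hf' => simp only [map_add, hf, hf']
    | hsmul c f hf => simp only [map_smul, hf]
    | h d'' =>
      simp only [compL_single, map_smul, LinearMap.smul_apply, smul_smul, ← pow_add]
      rw [(Diagram.assoc d d' d'').1, (Diagram.assoc d d' d'').2]

noncomputable instance : Preadditive (LinDiag k) where
  homGroup X Y := inferInstanceAs (AddCommGroup (Diagram X.dots Y.dots →₀ ℂ))
  add_comp X Y Z f f' g := LinearMap.map_add₂ (compL k X.dots Y.dots Z.dots) f f' g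
  comp_add X Y Z f g g' := LinearMap.map_add (compL k X.dots Y.dots Z.dots f) g g'

noncomputable instance : Linear ℂ (LinDiag k) where
  homModule X Y := inferInstanceAs (Module ℂ (Diagram X.dots Y.dots →₀ ℂ))
  smul_comp X Y Z c f g := LinearMap.map_smul₂ (compL k X.dots Y.dots Z.dots) c f g
  comp_smul X Y Z f c g := LinearMap.map_smul (compL k X.dots Y.dots Z.dots f) c g

/-- A single diagram, as a morphism of the linear diagram category. -/
noncomputable def ofDiagram {m n : ℕ} (d : Diagram m n) : (mk m : LinDiag k) ⟶ mk n :=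
  Finsupp.single d 1

theorem ofDiagram_comp {m n p : ℕ} (d : Diagram m n) (d' : Diagram n p) :
    (ofDiagram d : (mk m : LinDiag k) ⟶ _) ≫ ofDiagram d' =
      loopValue k ^ d.loops d' • ofDiagram (d.comp d') :=
  compL_single d d'

theorem ofDiagram_id (n : ℕ) : (ofDiagram (Diagram.id n) : (mk n : LinDiag k) ⟶ _) = 𝟙 _ := rfl

/-- The monoidal product on objects: addition. -/
def tensorObj (X Y : LinDiag k) : LinDiag k := mk (X.dots + Y.dots)

/-- The monoidal product on morphisms: bilinear extension of juxtaposition. -/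
noncomputable def tensorHom {X Y X' Y' : LinDiag k} (f : X ⟶ Y) (g : X' ⟶ Y') :
    tensorObj X X' ⟶ tensorObj Y Y' := tensorL _ _ _ _ f g

section

variable {X Y Z X' Y' Z' : LinDiag k}

theorem add_tensor (f f' : X ⟶ Y) (g : X' ⟶ Y') :
    tensorHom (f + f') g = tensorHom f g + tensorHom f' g :=
  LinearMap.map_add₂ (tensorL X.dots Y.dots X'.dots Y'.dots) f f' g

theorem tensor_add (f : X ⟶ Y) (g g' : X' ⟶ Y') :
    tensorHom f (g + g') = tensorHom f g + tensorHom f g' :=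
  map_add (tensorL X.dots Y.dots X'.dots Y'.dots f) g g'

theorem smul_tensor (c : ℂ) (f : X ⟶ Y) (g : X' ⟶ Y') :
    tensorHom (c • f) g = c • tensorHom f g :=
  LinearMap.map_smul₂ (tensorL X.dots Y.dots X'.dots Y'.dots) c f g

theorem tensor_smul (c : ℂ) (f : X ⟶ Y) (g : X' ⟶ Y') :
    tensorHom f (c • g) = c • tensorHom f g :=
  map_smul (tensorL X.dots Y.dots X'.dots Y'.dots f) c g

theorem zero_tensor (g : X' ⟶ Y') : tensorHom (0 : X ⟶ Y) g = 0 := by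
  have := smul_tensor 0 (0 : X ⟶ Y) g
  simpa using this

theorem tensor_zero (f : X ⟶ Y) : tensorHom f (0 : X' ⟶ Y') = 0 := by
  have := tensor_smul 0 f (0 : X' ⟶ Y')
  simpa using this

theorem tensor_ofDiagram {m n m' n' : ℕ} (d : Diagram m n) (d' : Diagram m' n') :
    tensorHom (k := k) (ofDiagram d) (ofDiagram d') = ofDiagram (d.tensor d') :=
  tensorL_single d d'

theorem tensor_id (X Y : LinDiag k) : tensorHom (𝟙 X) (𝟙 Y) = 𝟙 (tensorObj X Y) :=
  (tensorL_single _ _).trans (congrArg (fun d => Finsupp.single d 1) (Diagram.tensor_id _ _))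

theorem hom_induction {P : (X ⟶ Y) → Prop} (f : X ⟶ Y)
    (hadd : ∀ f g, P f → P g → P (f + g)) (hsmul : ∀ (c : ℂ) f, P f → P (c • f))
    (h : ∀ d : Diagram X.dots Y.dots, P (ofDiagram (k := k) d)) (h0 : P 0) : P f :=
  induction_diagram f h0 hadd hsmul h

theorem tensor_comp (f : X ⟶ Y) (g : Y ⟶ Z) (f' : X' ⟶ Y') (g' : Y' ⟶ Z') :
    tensorHom (f ≫ g) (f' ≫ g') = tensorHom f f' ≫ tensorHom g g' := by
  induction f using hom_induction with
  | h0 => simp only [zero_tensor, Limits.zero_comp]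
  | hadd f₁ f₂ h₁ h₂ => simp only [Preadditive.add_comp, add_tensor, h₁, h₂]
  | hsmul c f h => simp only [Linear.smul_comp, smul_tensor, h]
  | h d =>
  induction g using hom_induction with
  | h0 => simp only [zero_tensor, Limits.comp_zero]
  | hadd f₁ f₂ h₁ h₂ => simp only [Preadditive.comp_add, add_tensor, h₁, h₂]
  | hsmul c f h => simp only [Linear.comp_smul, smul_tensor, h]
  | h e =>
  induction f' using hom_induction with
  | h0 => simp only [tensor_zero, Limits.zero_comp]
  | hadd f₁ f₂ h₁ h₂ => simp only [Preadditive.add_comp, tensor_add, h₁, h₂]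
  | hsmul c f h => simp only [Linear.smul_comp, tensor_smul, h]
  | h d' =>
  induction g' using hom_induction with
  | h0 => simp only [tensor_zero, Limits.comp_zero]
  | hadd f₁ f₂ h₁ h₂ => simp only [Preadditive.comp_add, tensor_add, h₁, h₂]
  | hsmul c f h => simp only [Linear.comp_smul, tensor_smul, h]
  | h e' =>
    refine (congrArg₂ tensorHom (ofDiagram_comp d e) (ofDiagram_comp d' e')).trans ?_
    refine Eq.trans ?_ (congrArg₂ _ (tensor_ofDiagram d d') (tensor_ofDiagram e e')).symm
    refine Eq.trans ?_ (ofDiagram_comp _ _).symm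
    rw [(Diagram.tensor_comp d d' e e').1, (Diagram.tensor_comp d d' e e').2, smul_tensor,
      tensor_smul, smul_smul, pow_add]
    exact congrArg _ (tensor_ofDiagram _ _)

end

end LinDiag

namespace LinDiag

variable {k : ℕ}

/-- `n` parallel strands. -/
abbrev strands (k n : ℕ) : LinDiag k := mk n

/-- The cup `0 ⟶ 2`. -/
noncomputable def cup (k : ℕ) : strands k 0 ⟶ strands k 2 := ofDiagram Diagram.cup

/-- The cap `2 ⟶ 0`. -/
noncomputable def cap (k : ℕ) : strands k 2 ⟶ strands k 0 := ofDiagram Diagram.cap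

/-- The cap-cup morphism `n + 2 ⟶ n + 2` on the last two of `n + 2` strands. -/
noncomputable def capCup (k n : ℕ) : strands k (n + 2) ⟶ strands k (n + 2) :=
  tensorHom (𝟙 (strands k n)) (cap k ≫ cup k)

/-- Adding one vertical strand on the right. -/
noncomputable def addStrand {m n : ℕ} (f : strands k m ⟶ strands k n) :
    strands k (m + 1) ⟶ strands k (n + 1) :=
  tensorHom f (𝟙 (strands k 1))

/-- The Jones-Wenzl projections. -/
noncomputable def jonesWenzl (k : ℕ) : (n : ℕ) → (strands k n ⟶ strands k n)
  | 0 => 𝟙 _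
  | 1 => 𝟙 _
  | n + 2 => addStrand (jonesWenzl k (n + 1)) + (qint k (n + 1) / qint k (n + 2)) •
      (addStrand (jonesWenzl k (n + 1)) ≫ capCup k n ≫ addStrand (jonesWenzl k (n + 1)))

theorem addStrand_comp {m n p : ℕ} (f : strands k m ⟶ strands k n) (g : strands k n ⟶ strands k p) :
    addStrand (f ≫ g) = addStrand f ≫ addStrand g := by
  have := tensor_comp f g (𝟙 (strands k 1)) (𝟙 _)
  rwa [Category.comp_id] at this

theorem addStrand_id (n : ℕ) : addStrand (𝟙 (strands k n)) = 𝟙 _ := tensor_id _ _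

theorem addStrand_add {m n : ℕ} (f g : strands k m ⟶ strands k n) :
    addStrand (f + g) = addStrand f + addStrand g := add_tensor _ _ _

theorem addStrand_smul {m n : ℕ} (c : ℂ) (f : strands k m ⟶ strands k n) :
    addStrand (c • f) = c • addStrand f := smul_tensor _ _ _

theorem cup_cap (k : ℕ) : cup k ≫ cap k = loopValue k • 𝟙 _ := by
  refine (ofDiagram_comp Diagram.cup Diagram.cap).trans ?_
  rw [Diagram.cup_cap.1, Diagram.cup_cap.2, pow_one, ofDiagram_id]

theorem capCup_sq (k n : ℕ) : capCup k n ≫ capCup k n = loopValue k • capCup k n := by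
  have h : (cap k ≫ cup k) ≫ cap k ≫ cup k = loopValue k • (cap k ≫ cup k) := by
    rw [Category.assoc, ← Category.assoc (cup k), cup_cap, Linear.smul_comp, Category.id_comp,
      Linear.comp_smul]
  have := tensor_comp (𝟙 (strands k n)) (𝟙 _) (cap k ≫ cup k) (cap k ≫ cup k)
  rw [Category.comp_id, h, tensor_smul] at this
  exact this.symm

theorem tensor_one_one (m n : ℕ) (d : Diagram m n) :
    (d.tensor (Diagram.id 1)).tensor (Diagram.id 1) = d.tensor (Diagram.id 2) := by
  have h := fun x y => tensor_assoc_rel d (Diagram.id 1) (Diagram.id 1) x y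
  rw [Diagram.tensor_id] at h
  apply Diagram.ext
  ext x y
  refine (h x y).trans ?_
  rw [show (Fin.cast (Nat.add_assoc m 1 1)) = _root_.id from rfl,
    show (Fin.cast (Nat.add_assoc n 1 1)) = _root_.id from rfl, Sum.map_id_id]
  rfl

theorem addStrand_addStrand {m n : ℕ} (f : strands k m ⟶ strands k n) :
    addStrand (addStrand f) = tensorHom f (𝟙 (strands k 2)) := by
  induction f using hom_induction with
  | h0 => simp only [addStrand, zero_tensor]; rfl
  | hadd f g hf hg => rw [addStrand_add, addStrand_add, hf, hg, add_tensor]; rfl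
  | hsmul c f hf => rw [addStrand_smul, addStrand_smul, hf, smul_tensor]; rfl
  | h d =>
    have h1 : addStrand (k := k) (ofDiagram d) = ofDiagram (d.tensor (Diagram.id 1)) :=
      tensor_ofDiagram _ _
    have h2 : tensorHom (k := k) (ofDiagram d) (𝟙 (strands k 2)) =
      ofDiagram (d.tensor (Diagram.id 2)) := tensor_ofDiagram _ _
    refine (congrArg addStrand h1).trans (Eq.trans ?_ h2.symm)
    rw [← tensor_one_one]
    exact tensor_ofDiagram _ _

/-- Morphisms of the first `n` strands commute with the cap-cup on the last two strands. -/
theorem addStrand_capCup {n : ℕ} (f : strands k n ⟶ strands k n) :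
    addStrand (addStrand f) ≫ capCup k n = capCup k n ≫ addStrand (addStrand f) := by
  rw [addStrand_addStrand]
  refine (tensor_comp _ _ _ _).symm.trans (Eq.trans ?_ (tensor_comp _ _ _ _))
  simp

theorem zigzag (k : ℕ) : (tensorHom (𝟙 (strands k 1)) (cup k) : strands k 1 ⟶ strands k 3) ≫
    (tensorHom (cap k) (𝟙 (strands k 1)) : strands k 3 ⟶ strands k 1) = 𝟙 _ := by
  refine (congrArg₂ (fun (f : strands k 1 ⟶ strands k 3) (g : strands k 3 ⟶ strands k 1) => f ≫ g)
    (tensor_ofDiagram (Diagram.id 1) Diagram.cup)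
    (tensor_ofDiagram Diagram.cap (Diagram.id 1))).trans ?_
  refine (ofDiagram_comp (n := 3) _ _).trans ?_
  rw [Diagram.zigzag.1, Diagram.zigzag.2, pow_zero, one_smul]
  rfl

theorem zigzag' (k : ℕ) : (tensorHom (cup k) (𝟙 (strands k 1)) : strands k 1 ⟶ strands k 3) ≫
    (tensorHom (𝟙 (strands k 1)) (cap k) : strands k 3 ⟶ strands k 1) = 𝟙 _ := by
  refine (congrArg₂ (fun (f : strands k 1 ⟶ strands k 3) (g : strands k 3 ⟶ strands k 1) => f ≫ g)
    (tensor_ofDiagram Diagram.cup (Diagram.id 1))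
    (tensor_ofDiagram (Diagram.id 1) Diagram.cap)).trans ?_
  refine (ofDiagram_comp (n := 3) _ _).trans ?_
  rw [Diagram.zigzag'.1, Diagram.zigzag'.2, pow_zero, one_smul]
  rfl

theorem id_zero_tensor (d : Diagram 2 2) : (Diagram.id 0).tensor d = d := by
  apply Diagram.ext
  refine mat_inj (A := Fin 2) (B := Fin 2) ?_
  funext α β
  refine (mat_tensor (Diagram.id 0) d α β).trans ?_
  have h : ∀ i : Fin 2, (Fin.natAdd 0 i : Fin (0 + 2)) = i := fun i => Fin.ext (Nat.zero_add _)
  simp only [Diagram.id, mat_idRel, h]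
  rw [if_pos (Subsingleton.elim _ _), one_mul]

theorem capCup_zero (k : ℕ) : capCup k 0 = cap k ≫ cup k := by
  have : ∀ f : strands k 2 ⟶ strands k 2, tensorHom (𝟙 (strands k 0)) f = f := by
    intro f
    induction f using hom_induction with
    | h0 => exact tensor_zero _
    | hadd f g hf hg => exact (tensor_add _ _ _).trans (congrArg₂ _ hf hg)
    | hsmul c f hf => exact (tensor_smul _ _ _).trans (congrArg _ hf)
    | h d => exact (tensor_ofDiagram (Diagram.id 0) d).trans (congrArg ofDiagram (id_zero_tensor d))
  exact this _

theorem comp_cancel {C : Type*} [Category* C] {X Y : C} (a : X ⟶ Y) (b : Y ⟶ X) (c : X ⟶ Y)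
    (d : Y ⟶ X) (hbc : b ≫ c = 𝟙 _) (hda : d ≫ a = 𝟙 _) :
    (a ≫ b) ≫ (c ≫ d) ≫ a ≫ b = a ≫ b := by
  rw [Category.assoc, Category.assoc, ← Category.assoc b c, hbc, Category.id_comp,
    ← Category.assoc d a, hda, Category.id_comp]

theorem comp_slide {C : Type*} [Category* C] {X : C} (u v h : X ⟶ X) (hu : h ≫ u = u ≫ h)
    (hh : h ≫ h = h) (uvu : u ≫ v ≫ u = u) : u ≫ (h ≫ v ≫ h) ≫ u = h ≫ u := by
  calc u ≫ (h ≫ v ≫ h) ≫ u = (u ≫ h) ≫ v ≫ (h ≫ u) := by simp only [Category.assoc]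
    _ = (h ≫ u) ≫ v ≫ (u ≫ h) := by rw [hu]
    _ = h ≫ (u ≫ v ≫ u) ≫ h := by simp only [Category.assoc]
    _ = h ≫ u := by rw [uvu, ← hu, ← Category.assoc, hh]

/-- The relation `U₂ U₁ U₂ = U₂` on three strands. -/
theorem capCup_one (k : ℕ) :
    capCup k 1 ≫ addStrand (capCup k 0) ≫ capCup k 1 = capCup k 1 := by
  have h1 : capCup k 1 = (tensorHom (𝟙 (strands k 1)) (cap k) : strands k 3 ⟶ strands k 1) ≫
      (tensorHom (𝟙 (strands k 1)) (cup k) : strands k 1 ⟶ strands k 3) := by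
    refine Eq.trans ?_ (tensor_comp _ _ _ _)
    rw [Category.comp_id]
    rfl
  have h2 : addStrand (capCup k 0) =
      (tensorHom (cap k) (𝟙 (strands k 1)) : strands k 3 ⟶ strands k 1) ≫
      (tensorHom (cup k) (𝟙 (strands k 1)) : strands k 1 ⟶ strands k 3) := by
    rw [capCup_zero]
    exact addStrand_comp _ _
  rw [h1, h2]
  exact comp_cancel (X := strands k 3) (Y := strands k 1) _ _ _ _ (zigzag k) (zigzag' k)

theorem tensor_assoc_one_two {m n : ℕ} (d : Diagram m n) (e : Diagram 1 1) (e' : Diagram 2 2) :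
    (d.tensor e).tensor e' = d.tensor (e.tensor e') := by
  apply Diagram.ext
  ext x y
  refine (tensor_assoc_rel d e e' x y).trans ?_
  rw [show (Fin.cast (Nat.add_assoc m 1 2)) = _root_.id from rfl,
    show (Fin.cast (Nat.add_assoc n 1 2)) = _root_.id from rfl, Sum.map_id_id]
  rfl

theorem tensor_assoc_two_one {m n : ℕ} (d : Diagram m n) (e : Diagram 2 2) (e' : Diagram 1 1) :
    (d.tensor e).tensor e' = d.tensor (e.tensor e') := by
  apply Diagram.ext
  ext x y
  refine (tensor_assoc_rel d e e' x y).trans ?_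
  rw [show (Fin.cast (Nat.add_assoc m 2 1)) = _root_.id from rfl,
    show (Fin.cast (Nat.add_assoc n 2 1)) = _root_.id from rfl, Sum.map_id_id]
  rfl

theorem capCup_three (k n : ℕ) :
    capCup k (n + 1) ≫ addStrand (capCup k n) ≫ capCup k (n + 1) = capCup k (n + 1) := by
  have h1 : ∀ f : strands k 2 ⟶ strands k 2,
      @Eq (strands k (n + 3) ⟶ strands k (n + 3))
        (tensorHom (X := strands k (n + 1)) (Y := strands k (n + 1)) (𝟙 _) f)
        (tensorHom (𝟙 (strands k n))
          (tensorHom (𝟙 (strands k 1)) f : strands k 3 ⟶ strands k 3)) := by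
    intro f
    induction f using hom_induction with
    | h0 =>
      exact (tensor_zero _).trans
        ((congrArg (tensorHom (𝟙 (strands k n))) (tensor_zero (X' := strands k 2) (Y' := strands k 2)
          (𝟙 (strands k 1)))).trans (tensor_zero _)).symm
    | hadd f g hf hg =>
      exact (tensor_add _ _ _).trans ((congrArg₂ _ hf hg).trans
        ((congrArg (tensorHom (𝟙 (strands k n))) (tensor_add _ _ _)).trans
          (tensor_add _ _ _)).symm)
    | hsmul c f hf =>
      exact (tensor_smul _ _ _).trans ((congrArg _ hf).trans
        ((congrArg (tensorHom (𝟙 (strands k n))) (tensor_smul _ _ _)).trans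
          (tensor_smul _ _ _)).symm)
    | h d =>
      refine (tensor_ofDiagram (Diagram.id (n + 1)) d).trans (Eq.trans ?_
        ((congrArg (tensorHom (𝟙 (strands k n))) (tensor_ofDiagram (Diagram.id 1) d)).trans
          (tensor_ofDiagram (Diagram.id n) _)).symm)
      exact congrArg (ofDiagram (k := k) (m := n + 3) (n := n + 3))
        ((congrArg (fun e => Diagram.tensor e d) (Diagram.tensor_id n 1).symm).trans
          (tensor_assoc_one_two (Diagram.id n) (Diagram.id 1) d))
  have h2 : ∀ f : strands k 2 ⟶ strands k 2,
      (addStrand (tensorHom (𝟙 (strands k n)) f : strands k (n + 2) ⟶ strands k (n + 2))) =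
        tensorHom (𝟙 (strands k n)) (addStrand f) := by
    intro f
    induction f using hom_induction with
    | h0 =>
      exact (congrArg addStrand (tensor_zero _)).trans ((zero_tensor _).trans
        ((congrArg (tensorHom (𝟙 (strands k n))) (zero_tensor (X := strands k 2) (Y := strands k 2)
          (𝟙 (strands k 1)))).trans (tensor_zero _)).symm)
    | hadd f g hf hg =>
      exact (congrArg addStrand (tensor_add _ _ _)).trans
        ((addStrand_add _ _).trans ((congrArg₂ _ hf hg).trans
        ((congrArg (tensorHom (𝟙 (strands k n))) (addStrand_add _ _)).trans
          (tensor_add _ _ _)).symm))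
    | hsmul c f hf =>
      exact (congrArg addStrand (tensor_smul _ _ _)).trans
        ((addStrand_smul _ _).trans ((congrArg _ hf).trans
        ((congrArg (tensorHom (𝟙 (strands k n))) (addStrand_smul _ _)).trans
          (tensor_smul _ _ _)).symm))
    | h d =>
      refine (congrArg addStrand (tensor_ofDiagram (Diagram.id n) d)).trans
        ((tensor_ofDiagram _ (Diagram.id 1)).trans (Eq.trans ?_
        ((congrArg (tensorHom (𝟙 (strands k n))) (tensor_ofDiagram d (Diagram.id 1))).trans
          (tensor_ofDiagram (Diagram.id n) _)).symm))
      exact congrArg (ofDiagram (k := k) (m := n + 3) (n := n + 3))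
        (tensor_assoc_two_one (Diagram.id n) d (Diagram.id 1))
  have e1 : capCup k (n + 1) = tensorHom (𝟙 (strands k n)) (capCup k 1) := h1 _
  have e2 : addStrand (capCup k n) = tensorHom (𝟙 (strands k n)) (addStrand (capCup k 0)) := by
    rw [capCup_zero]
    exact h2 _
  rw [e1, e2]
  refine (congrArg (fun z => tensorHom (𝟙 (strands k n)) (capCup k 1) ≫ z)
    (tensor_comp _ _ _ _).symm).trans ((tensor_comp _ _ _ _).symm.trans ?_)
  exact congrArg₂ tensorHom ((Category.id_comp _).trans (Category.id_comp _)) (capCup_one k)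

theorem jonesWenzl_coeff (k n : ℕ) (h : n + 2 ≤ k + 1) :
    qint k (n + 1) / qint k (n + 2) * (loopValue k + qint k n / qint k (n + 1)) = -1 := by
  have h1 := qint_ne_zero k (n + 1) (by omega) (by omega)
  have h2 := qint_ne_zero k (n + 2) (by omega) (by omega)
  have h3 := qint_rec k n
  rw [loopValue]
  field_simp
  linear_combination -h3

theorem capCup_jonesWenzl_capCup (k n : ℕ)
    (hn : jonesWenzl k n ≫ jonesWenzl k n = jonesWenzl k n) :
    capCup k n ≫ addStrand (jonesWenzl k (n + 1)) ≫ capCup k n =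
      (loopValue k + qint k n / qint k (n + 1)) •
        (addStrand (addStrand (jonesWenzl k n)) ≫ capCup k n) := by
  cases n with
  | zero =>
    simp only [jonesWenzl, addStrand_id, Category.id_comp, capCup_sq, qint_zero, zero_div, add_zero]
  | succ n =>
    have hc := addStrand_capCup (jonesWenzl k (n + 1))
    rw [jonesWenzl, addStrand_add, addStrand_smul, Preadditive.add_comp, Preadditive.comp_add,
      Linear.smul_comp, Linear.comp_smul, addStrand_comp, addStrand_comp]
    set H := addStrand (addStrand (jonesWenzl k (n + 1))) with hH
    have hH2 : H ≫ H = H := by rw [hH, ← addStrand_comp, ← addStrand_comp, hn]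
    have e1 : capCup k (n + 1) ≫ H ≫ capCup k (n + 1) =
        loopValue k • (H ≫ capCup k (n + 1)) := by
      rw [← Category.assoc, ← hc, Category.assoc, capCup_sq, Linear.comp_smul]
    have e2 : capCup k (n + 1) ≫ (H ≫ addStrand (capCup k n) ≫ H) ≫ capCup k (n + 1) =
        H ≫ capCup k (n + 1) := comp_slide _ _ _ hc hH2 (capCup_three k n)
    rw [e1, e2, ← add_smul]

theorem jonesWenzl_absorb (k n : ℕ) (hn : jonesWenzl k n ≫ jonesWenzl k n = jonesWenzl k n) :
    jonesWenzl k (n + 1) ≫ addStrand (jonesWenzl k n) = jonesWenzl k (n + 1) := by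
  cases n with
  | zero => exact (congrArg _ (addStrand_id 0)).trans (Category.comp_id _)
  | succ n =>
    have h : addStrand (jonesWenzl k (n + 1)) ≫ addStrand (jonesWenzl k (n + 1)) =
        addStrand (jonesWenzl k (n + 1)) := by rw [← addStrand_comp, hn]
    rw [jonesWenzl, Preadditive.add_comp, Linear.smul_comp, Category.assoc, Category.assoc, h]

/-- The Jones-Wenzl projections are idempotent. -/
theorem jonesWenzl_idem (k n : ℕ) (hn : n ≤ k + 1) :
    jonesWenzl k n ≫ jonesWenzl k n = jonesWenzl k n := by
  induction n using Nat.strong_induction_on with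
  | _ n ih =>
  match n with
  | 0 => exact Category.id_comp _
  | 1 => exact Category.id_comp _
  | n + 2 =>
    have i1 := ih (n + 1) (by omega) (by omega)
    have i0 := ih n (by omega) (by omega)
    have key := capCup_jonesWenzl_capCup k n i0
    have hc := jonesWenzl_coeff k n hn
    rw [jonesWenzl]
    set g := addStrand (jonesWenzl k (n + 1)) with hg
    set a := qint k (n + 1) / qint k (n + 2)
    set U := capCup k n
    have gg : g ≫ g = g := by rw [hg, ← addStrand_comp, i1]
    have gH : g ≫ addStrand (addStrand (jonesWenzl k n)) = g := by
      rw [hg, ← addStrand_comp, jonesWenzl_absorb k n i0]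
    have e : (g ≫ U ≫ g) ≫ g ≫ U ≫ g =
        (loopValue k + qint k n / qint k (n + 1)) • (g ≫ U ≫ g) := by
      calc (g ≫ U ≫ g) ≫ g ≫ U ≫ g = g ≫ (U ≫ (g ≫ g) ≫ U) ≫ g := by simp only [Category.assoc]
        _ = _ := by
          rw [gg, key, Linear.smul_comp, Linear.comp_smul, Category.assoc, ← Category.assoc g, gH]
    have e1 : g ≫ g ≫ U ≫ g = g ≫ U ≫ g := by rw [← Category.assoc, gg]
    have e2 : (g ≫ U ≫ g) ≫ g = g ≫ U ≫ g := by simp only [Category.assoc, gg]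
    simp only [Preadditive.add_comp, Preadditive.comp_add, Linear.smul_comp, Linear.comp_smul]
    rw [gg, e1, e2, e, smul_smul, hc, neg_one_smul, add_neg_cancel, smul_zero, add_zero]

end LinDiag

namespace LinDiag

variable {k : ℕ}

/-- `n` nested cups `0 ⟶ n + n`, obtained from `n - 1` nested cups by inserting a cup in the
middle. -/
noncomputable def nestedCup (k : ℕ) : (n : ℕ) → (strands k 0 ⟶ strands k (n + n))
  | 0 => 𝟙 _
  | n + 1 => nestedCup k n ≫
      (tensorHom (tensorHom (𝟙 (strands k n)) (cup k)) (𝟙 (strands k n)) :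
        strands k (n + n) ⟶ strands k (n + 2 + n)) ≫
      eqToHom (congrArg mk (by change n + 2 + n = n + 1 + (n + 1); omega))

/-- `n` nested caps `n + n ⟶ 0`, the innermost one being in the middle. -/
noncomputable def nestedCap (k : ℕ) : (n : ℕ) → (strands k (n + n) ⟶ strands k 0)
  | 0 => 𝟙 _
  | n + 1 => eqToHom (congrArg mk (by change n + 1 + (n + 1) = n + 2 + n; omega)) ≫
      (tensorHom (tensorHom (𝟙 (strands k n)) (cap k)) (𝟙 (strands k n)) :
        strands k (n + 2 + n) ⟶ strands k (n + n)) ≫ nestedCap k n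

theorem sum_tensor {X Y X' Y' : LinDiag k} {ι : Type} (s : Finset ι) (f : ι → (X ⟶ Y))
    (g : X' ⟶ Y') : tensorHom (∑ i ∈ s, f i) g = ∑ i ∈ s, tensorHom (f i) g :=
  map_sum (AddMonoidHom.mk' (fun f : X ⟶ Y => tensorHom f g) fun _ _ => add_tensor _ _ _) f s

theorem tensor_sum {X Y X' Y' : LinDiag k} {ι : Type} (s : Finset ι) (f : X ⟶ Y)
    (g : ι → (X' ⟶ Y')) : tensorHom f (∑ i ∈ s, g i) = ∑ i ∈ s, tensorHom f (g i) :=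
  map_sum (AddMonoidHom.mk' (fun g : X' ⟶ Y' => tensorHom f g) fun _ _ => tensor_add _ _ _) g s

end LinDiag

/-- The additive completion of the linear diagram category. -/
abbrev AddTL (k : ℕ) : Type 1 := Mat_ (LinDiag k)

namespace AddTL

variable {k : ℕ}

/-- The monoidal product of formal direct sums. -/
def tensorObj (M N : AddTL k) : AddTL k :=
  ⟨M.ι × N.ι, fun i => LinDiag.tensorObj (M.X i.1) (N.X i.2)⟩

/-- The monoidal product of matrices (Kronecker product). -/
noncomputable def tensorHom {M N M' N' : AddTL k} (f : M ⟶ N) (g : M' ⟶ N') :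
    tensorObj M M' ⟶ tensorObj N N' :=
  fun i j => LinDiag.tensorHom (f i.1 j.1) (g i.2 j.2)

theorem tensor_id (M N : AddTL k) : tensorHom (𝟙 M) (𝟙 N) = 𝟙 (tensorObj M N) := by
  apply Mat_.hom_ext
  rintro ⟨i, i'⟩ ⟨j, j'⟩
  change LinDiag.tensorHom ((𝟙 M : M ⟶ M) i j) ((𝟙 N : N ⟶ N) i' j') = _
  by_cases h : i = j
  · subst h
    by_cases h' : i' = j'
    · subst h'
      rw [Mat_.id_apply_self, Mat_.id_apply_self]
      exact (LinDiag.tensor_id _ _).trans (Mat_.id_apply_self (tensorObj M N) (i, i')).symm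
    · rw [Mat_.id_apply_of_ne N _ _ h', LinDiag.tensor_zero]
      exact (Mat_.id_apply_of_ne (tensorObj M N) (i, i') (i, j')
        fun e => h' (congrArg Prod.snd e)).symm
  · rw [Mat_.id_apply_of_ne M _ _ h, LinDiag.zero_tensor]
    exact (Mat_.id_apply_of_ne (tensorObj M N) (i, i') (j, j')
      fun e => h (congrArg Prod.fst e)).symm

theorem tensor_comp {M N K M' N' K' : AddTL k} (f : M ⟶ N) (g : N ⟶ K) (f' : M' ⟶ N')
    (g' : N' ⟶ K') : tensorHom (f ≫ g) (f' ≫ g') = tensorHom f f' ≫ tensorHom g g' := by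
  apply Mat_.hom_ext
  rintro ⟨i, i'⟩ ⟨j, j'⟩
  change LinDiag.tensorHom (∑ a : N.ι, f i a ≫ g a j) (∑ b : N'.ι, f' i' b ≫ g' b j') =
    ∑ ab : N.ι × N'.ι, LinDiag.tensorHom (f i ab.1) (f' i' ab.2) ≫
      LinDiag.tensorHom (g ab.1 j) (g' ab.2 j')
  rw [LinDiag.sum_tensor, Fintype.sum_prod_type]
  refine Finset.sum_congr rfl fun a _ => ?_
  rw [LinDiag.tensor_sum]
  exact Finset.sum_congr rfl fun b _ => LinDiag.tensor_comp _ _ _ _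

theorem add_tensor {M N M' N' : AddTL k} (f f' : M ⟶ N) (g : M' ⟶ N') :
    tensorHom (f + f') g = tensorHom f g + tensorHom f' g :=
  Mat_.hom_ext _ _ fun _ _ => LinDiag.add_tensor _ _ _

theorem tensor_add {M N M' N' : AddTL k} (f : M ⟶ N) (g g' : M' ⟶ N') :
    tensorHom f (g + g') = tensorHom f g + tensorHom f g' :=
  Mat_.hom_ext _ _ fun _ _ => LinDiag.tensor_add _ _ _

/-- The object `n` of the diagram category, as an object of the additive completion. -/
noncomputable abbrev strands (k n : ℕ) : AddTL k :=
  (Mat_.embedding (LinDiag k)).obj (LinDiag.strands k n)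

/-- Nested cups, as a one by one matrix. -/
noncomputable def nestedCup (k n : ℕ) :
    strands k 0 ⟶ tensorObj (strands k n) (strands k n) :=
  fun _ _ => LinDiag.nestedCup k n

/-- Nested caps, as a one by one matrix. -/
noncomputable def nestedCap (k n : ℕ) :
    tensorObj (strands k n) (strands k n) ⟶ strands k 0 :=
  fun _ _ => LinDiag.nestedCap k n

end AddTL

/-- The Temperley-Lieb category `TL`: the idempotent completion of the additive completion of the
linear diagram category. -/
abbrev TL (k : ℕ) : Type 1 := Idempotents.Karoubi (AddTL k)

namespace TL

variable {k : ℕ}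

/-- The monoidal product of objects of `TL`. -/
noncomputable def tensorObj (P Q : TL k) : TL k where
  X := AddTL.tensorObj P.X Q.X
  p := AddTL.tensorHom P.p Q.p
  idem := by rw [← AddTL.tensor_comp, P.idem, Q.idem]

/-- The monoidal product of morphisms of `TL`. -/
noncomputable def tensorHom {P Q P' Q' : TL k} (f : P ⟶ Q) (g : P' ⟶ Q') :
    tensorObj P P' ⟶ tensorObj Q Q' where
  f := AddTL.tensorHom f.f g.f
  comm := by
    change AddTL.tensorHom P.p P'.p ≫ AddTL.tensorHom f.f g.f ≫ AddTL.tensorHom Q.p Q'.p = _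
    rw [← AddTL.tensor_comp, ← AddTL.tensor_comp, f.comm, g.comm]

theorem tensor_id (P Q : TL k) : tensorHom (𝟙 P) (𝟙 Q) = 𝟙 (tensorObj P Q) := rfl

theorem tensor_comp {P Q R P' Q' R' : TL k} (f : P ⟶ Q) (g : Q ⟶ R) (f' : P' ⟶ Q')
    (g' : Q' ⟶ R') : tensorHom (f ≫ g) (f' ≫ g') = tensorHom f f' ≫ tensorHom g g' :=
  Idempotents.Karoubi.hom_ext _ _ (AddTL.tensor_comp _ _ _ _)

theorem add_tensor {P Q P' Q' : TL k} (f f' : P ⟶ Q) (g : P' ⟶ Q') :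
    tensorHom (f + f') g = tensorHom f g + tensorHom f' g :=
  Idempotents.Karoubi.hom_ext _ _ (AddTL.add_tensor _ _ _)

theorem tensor_add {P Q P' Q' : TL k} (f : P ⟶ Q) (g g' : P' ⟶ Q') :
    tensorHom f (g + g') = tensorHom f g + tensorHom f g' :=
  Idempotents.Karoubi.hom_ext _ _ (AddTL.tensor_add _ _ _)

theorem sub_tensor {P Q P' Q' : TL k} (f f' : P ⟶ Q) (g : P' ⟶ Q') :
    tensorHom (f - f') g = tensorHom f g - tensorHom f' g := by
  rw [eq_sub_iff_add_eq, ← add_tensor, sub_add_cancel]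

theorem tensor_sub {P Q P' Q' : TL k} (f : P ⟶ Q) (g g' : P' ⟶ Q') :
    tensorHom f (g - g') = tensorHom f g - tensorHom f g' := by
  rw [eq_sub_iff_add_eq, ← tensor_add, sub_add_cancel]

/-- The unit object: no strands. -/
noncomputable def unit (k : ℕ) : TL k := ⟨AddTL.strands k 0, 𝟙 _, Category.comp_id _⟩

/-- The object `F n` given by the idempotent `jonesWenzl k n`. -/
noncomputable def F (k n : ℕ) (hn : n ≤ k + 1) : TL k where
  X := AddTL.strands k n
  p := (Mat_.embedding (LinDiag k)).map (LinDiag.jonesWenzl k n)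
  idem := by rw [← Functor.map_comp, LinDiag.jonesWenzl_idem k n hn]

/-- The evaluation `F n ⊗ F n ⟶ 𝟙`: nested caps composed with `f n ⊗ f n`. -/
noncomputable def ev (k n : ℕ) (hn : n ≤ k + 1) : tensorObj (F k n hn) (F k n hn) ⟶ unit k where
  f := (tensorObj (F k n hn) (F k n hn)).p ≫ AddTL.nestedCap k n
  comm := (congrArg ((tensorObj (F k n hn) (F k n hn)).p ≫ ·) (Category.comp_id _)).trans
    ((Category.assoc _ _ _).symm.trans
      (congrArg (· ≫ AddTL.nestedCap k n) (tensorObj (F k n hn) (F k n hn)).idem))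

/-- The coevaluation `𝟙 ⟶ F n ⊗ F n`: `f n ⊗ f n` composed with nested cups. -/
noncomputable def coev (k n : ℕ) (hn : n ≤ k + 1) :
    unit k ⟶ tensorObj (F k n hn) (F k n hn) where
  f := AddTL.nestedCup k n ≫ (tensorObj (F k n hn) (F k n hn)).p
  comm := (Category.id_comp _).trans ((Category.assoc _ _ _).trans
    (congrArg (AddTL.nestedCup k n ≫ ·) (tensorObj (F k n hn) (F k n hn)).idem))

/-- The ideal of morphisms generated by the object `F (k + 1)`: the smallest class of morphisms
which contains the identity of `F (k + 1)` and is closed under sums, under composition with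
arbitrary morphisms, and under the monoidal product with arbitrary morphisms. -/
inductive InIdeal (k : ℕ) : {P Q : TL k} → (P ⟶ Q) → Prop
  | gen : InIdeal k (𝟙 (F k (k + 1) le_rfl))
  | zero (P Q : TL k) : InIdeal k (0 : P ⟶ Q)
  | add {P Q : TL k} (f g : P ⟶ Q) : InIdeal k f → InIdeal k g → InIdeal k (f + g)
  | comp_left {P Q R : TL k} (f : P ⟶ Q) (g : Q ⟶ R) : InIdeal k g → InIdeal k (f ≫ g)
  | comp_right {P Q R : TL k} (f : P ⟶ Q) (g : Q ⟶ R) : InIdeal k f → InIdeal k (f ≫ g)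
  | tensor_left {P Q P' Q' : TL k} (f : P ⟶ Q) (g : P' ⟶ Q') :
      InIdeal k g → InIdeal k (tensorHom f g)
  | tensor_right {P Q P' Q' : TL k} (f : P ⟶ Q) (g : P' ⟶ Q') :
      InIdeal k f → InIdeal k (tensorHom f g)

theorem InIdeal.neg {P Q : TL k} {f : P ⟶ Q} (h : InIdeal k f) : InIdeal k (-f) := by
  have := InIdeal.comp_left (-𝟙 P) f h
  rwa [Preadditive.neg_comp, Category.id_comp] at this

/-- Two morphisms are identified if their difference lies in the ideal. -/
def idealRel (k : ℕ) : HomRel (TL k) := fun _ _ f g => InIdeal k (f - g)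

instance : Congruence (idealRel k) where
  equivalence :=
    { refl := fun f => by
        change InIdeal k (f - f)
        rw [sub_self]
        exact .zero _ _
      symm := fun {f g} h => by
        change InIdeal k (g - f)
        rw [← neg_sub]
        exact InIdeal.neg h
      trans := fun {f g h} h₁ h₂ => by
        change InIdeal k (f - h)
        rw [← sub_add_sub_cancel f g h]
        exact .add _ _ h₁ h₂ }
  comp_left f g g' h := by
    change InIdeal k (_ - _)
    rw [← Preadditive.comp_sub]
    exact .comp_left _ _ h
  comp_right g h := by
    change InIdeal k (_ - _)
    rw [← Preadditive.sub_comp]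
    exact .comp_right _ _ h

end TL

/-- The reduced Temperley-Lieb category: the quotient of `TL` by the ideal generated by
`F (k + 1)`. -/
abbrev ReducedTL (k : ℕ) : Type 1 := Quotient (TL.idealRel k)

namespace ReducedTL

variable {k : ℕ}

noncomputable instance : Preadditive (ReducedTL k) :=
  Quotient.preadditive _ fun _ _ f₁ f₂ g₁ g₂ h h' => by
    change TL.InIdeal k (f₁ + g₁ - (f₂ + g₂))
    rw [add_sub_add_comm]
    exact .add _ _ h h'

/-- The quotient functor from `TL` to the reduced Temperley-Lieb category. -/
noncomputable abbrev quotientFunctor (k : ℕ) : TL k ⥤ ReducedTL k := Quotient.functor (TL.idealRel k)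

/-- The monoidal product of objects, inherited from `TL`. -/
noncomputable def tensorObj (P Q : ReducedTL k) : ReducedTL k :=
  (quotientFunctor k).obj (TL.tensorObj P.as Q.as)

/-- The monoidal product of morphisms, inherited from `TL`. -/
noncomputable def tensorHom {P Q P' Q' : ReducedTL k} (f : P ⟶ Q) (g : P' ⟶ Q') :
    tensorObj P P' ⟶ tensorObj Q Q' :=
  Quot.liftOn₂ f g (fun a b => (quotientFunctor k).map (TL.tensorHom a b))
    (fun a b b' h => by
      rw [HomRel.compClosure_iff_self] at h
      refine (Quotient.functor_map_eq_iff _ _ _).2 ?_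
      change TL.InIdeal k (_ - _)
      rw [← TL.tensor_sub]
      exact .tensor_left _ _ h)
    (fun a a' b h => by
      rw [HomRel.compClosure_iff_self] at h
      refine (Quotient.functor_map_eq_iff _ _ _).2 ?_
      change TL.InIdeal k (_ - _)
      rw [← TL.sub_tensor]
      exact .tensor_right _ _ h)

/-- The unit object. -/
noncomputable def unit (k : ℕ) : ReducedTL k := (quotientFunctor k).obj (TL.unit k)

/-- The object `F n`, for `0 ≤ n ≤ k`. -/
noncomputable def F (k n : ℕ) (hn : n ≤ k) : ReducedTL k :=
  (quotientFunctor k).obj (TL.F k n (Nat.le_succ_of_le hn))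

/-- The evaluation `e n : F n ⊗ F n ⟶ 𝟙`. -/
noncomputable def ev (k n : ℕ) (hn : n ≤ k) : tensorObj (F k n hn) (F k n hn) ⟶ unit k :=
  (quotientFunctor k).map (TL.ev k n (Nat.le_succ_of_le hn))

/-- The coevaluation `c n : 𝟙 ⟶ F n ⊗ F n`. -/
noncomputable def coev (k n : ℕ) (hn : n ≤ k) : unit k ⟶ tensorObj (F k n hn) (F k n hn) :=
  (quotientFunctor k).map (TL.coev k n (Nat.le_succ_of_le hn))

end ReducedTL

end TemperleyLieb

/-! Let P and Q be f_k acting on the first and on the last k of 2k strands, so that f_k ⊗ f_k is P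
followed by Q. Modulo the ideal, f_k ⊗ f_k is joined to c_k ∘ e_k by a chain in which one more
nested cap and cup appear at a time: for m + j = k, P Q is congruent to (-1)^j [m+1] times P Q,
followed by j nested caps down to 2m strands, j nested cups back and P again
(`LinDiag.negligible_reduction`). At j = 0 the coefficient is [k+1], which equals 1 because q^(k+2)
= -1; at m = 0 it is (-1)^k [1] = (-1)^k and the middle is the full nest of caps and cups. Composing
with Q then gives the claim, as (-1)^(2k) = 1.

One link of the chain says that P Q, followed by the j caps and by f_{m+1} on the first m + 1 of the
2m remaining strands, is negligible for m ≥ 1 (`LinDiag.negligible_capsAt_comp_jonesWenzlAt`).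
Applied with m + 1 in place of m, it involves f_{m+2}; its recursion has a term f_{m+1}, which P
absorbs, and a term f_{m+1} U f_{m+1} with coefficient [m+1]/[m+2], in which the cap and the cup of
U enlarge the two nests. Hence each step costs the factor -[m+1]/[m+2], and the product telescopes.

The link itself is a rotation of f_{k+1} = 0. The projection f_{k+1} expands into f_k and the terms
f_k cap_{k-1} cup_i with quantum integer coefficients (`LinDiag.qint_smul_jonesWenzlAt_succ`).
Bending the last strand with a cup straightens every cap_{k-1} and leaves a negligible sum of [i+1]
f_k cup_i over 0 ≤ i ≤ k (`LinDiag.negligible_sum_cupAt`). This sum is put below a shifted Q, j + 1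
caps and f_{m+1}. Cups with i < m are killed by f_{m+1}; cups with i > m run through the caps, turn
into caps on the right-hand block and are killed by Q; the cup i = m is straightened against the
outermost cap and gives the required morphism, with the invertible coefficient [m+1].

Planar isotopies are checked on two-colourings: a diagram is determined by the colourings of its
dots which are constant on lines, and stacking becomes composition of relations. Everything is
proved on strands before completion; the result is carried to F_k ⊗ F_k by inserting the inclusion
into, and the projection from, the object 2k. -/

namespace TemperleyLieb

/-! ### Diagrams described by the two-colourings of their dots -/

namespace Diagram

/-- The colouring of the dots by `α` (bottom) and `β` (top) is constant on lines. -/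
def Col {m n : ℕ} (d : Diagram m n) (α β : ℕ → Bool) : Prop :=
  Resp d.rel (Sum.elim (fun i : Fin m => α i) (fun j : Fin n => β j))

theorem exists_extension {n : ℕ} (f : Fin n → Bool) :
    ∃ α : ℕ → Bool, (fun i : Fin n => α i) = f :=
  ⟨fun t => if h : t < n then f ⟨t, h⟩ else false, by ext i; simp⟩

/-- An equivalence relation is recovered from the two-valued functions constant on its classes.
Colourings are defined on all of ℕ, so that comparisons of diagrams become arithmetic of indices,
with no transport between finite types. -/
theorem ext_col {m n : ℕ} {d e : Diagram m n} (h : ∀ α β, d.Col α β ↔ e.Col α β) : d = e := by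
  apply Diagram.ext
  apply resp_ext
  intro φ
  obtain ⟨α, hα⟩ := exists_extension (φ ∘ Sum.inl)
  obtain ⟨β, hβ⟩ := exists_extension (φ ∘ Sum.inr)
  have := h α β
  unfold Col at this
  rwa [hα, hβ, Sum.elim_comp_inl_inr] at this

open Classical in
theorem mat_eq_col {m n : ℕ} (d : Diagram m n) (α β : ℕ → Bool) :
    mat d.rel (fun i => α i) (fun j => β j) = if d.Col α β then 1 else 0 := rfl

/-- The product of the colouring matrices is the matrix of the stacked diagram times a positive
power of 2, so an entry is nonzero exactly when some colouring of the middle row fits both diagrams.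
-/
theorem col_comp {m n p : ℕ} (d : Diagram m n) (e : Diagram n p) (α γ : ℕ → Bool) :
    (d.comp e).Col α γ ↔ ∃ β, d.Col α β ∧ e.Col β γ := by
  classical
  have h := mat_stack d.rel e.rel (fun i => α i) (fun j => γ j)
  constructor
  · intro hc
    have h1 : mat (stack d.rel e.rel) (fun i => α i) (fun j => γ j) = 1 := if_pos hc
    rw [h1, mul_one] at h
    have h2 : ∑ β, mat d.rel (fun i => α i) β * mat e.rel β (fun j => γ j) ≠ 0 := by
      rw [h]; positivity
    obtain ⟨b, -, hb⟩ := Finset.exists_ne_zero_of_sum_ne_zero h2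
    obtain ⟨β, rfl⟩ := exists_extension b
    rw [mat_eq_col, mat_eq_col] at hb
    refine ⟨β, ?_, ?_⟩ <;> by_contra hn <;> simp [hn] at hb
  · rintro ⟨β, h1, h2⟩
    by_contra hc
    have h3 : mat (stack d.rel e.rel) (fun i => α i) (fun j => γ j) = 0 := if_neg hc
    rw [h3, mul_zero] at h
    have h4 := (Finset.sum_eq_zero_iff.1 h) (fun i => β i) (Finset.mem_univ _)
    rw [mat_eq_col, mat_eq_col, if_pos h1, if_pos h2] at h4
    simp at h4

/-- Each closed loop can be coloured freely, so over the constant boundary colouring there are 2 to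
the number of loops middle rows. If the constant middle row is the only one, there is no loop. -/
theorem loops_eq_zero {m n p : ℕ} (d : Diagram m n) (e : Diagram n p)
    (h : ∀ β : ℕ → Bool, d.Col (fun _ => false) β → e.Col β (fun _ => false) →
      ∀ t < n, β t = false) : d.loops e = 0 := by
  classical
  have h1 := mat_stack d.rel e.rel (fun _ => false) (fun _ => false)
  rw [mat_false, mul_one, Finset.sum_eq_single (fun _ => false), mat_false, mat_false] at h1
  · exact (Nat.pow_eq_one.1 h1.symm).resolve_left (by norm_num)
  · intro b _ hb
    obtain ⟨β, rfl⟩ := exists_extension b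
    by_contra hn
    refine hb (funext fun i => h β ?_ ?_ i i.2)
    · by_contra hc
      exact hn (mul_eq_zero_of_left (if_neg hc) _)
    · by_contra hc
      exact hn (mul_eq_zero_of_right _ (if_neg hc))
  · intro hn
    exact absurd (Finset.mem_univ _) hn

theorem col_id (n : ℕ) (α β : ℕ → Bool) : (Diagram.id n).Col α β ↔ ∀ t < n, α t = β t := by
  classical
  have := mat_idRel (fun i : Fin n => α i) (fun i : Fin n => β i)
  have h2 := mat_eq_col (Diagram.id n) α β
  have h3 : (Diagram.id n).Col α β ↔ (fun i : Fin n => α i) = (fun i : Fin n => β i) := by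
    have h4 := h2.symm.trans this
    split_ifs at h4 <;> simp_all
  rw [h3, funext_iff]
  exact ⟨fun h t ht => h ⟨t, ht⟩, fun h i => h i i.2⟩

theorem col_cup (α β : ℕ → Bool) : Diagram.cup.Col α β ↔ β 0 = β 1 := by
  classical
  have h4 := (mat_eq_col Diagram.cup α β).symm.trans (mat_cup _ _)
  simp only [Fin.val_zero, Fin.val_one] at h4
  split_ifs at h4 <;> simp_all

theorem col_cap (α β : ℕ → Bool) : Diagram.cap.Col α β ↔ α 0 = α 1 := by
  classical
  have h4 := (mat_eq_col Diagram.cap α β).symm.trans (mat_cap _ _)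
  simp only [Fin.val_zero, Fin.val_one] at h4
  split_ifs at h4 <;> simp_all

theorem col_tensor {m m' n n' : ℕ} (d : Diagram m n) (e : Diagram m' n') (α β : ℕ → Bool) :
    (d.tensor e).Col α β ↔ d.Col α β ∧ e.Col (fun t => α (m + t)) (fun t => β (n + t)) := by
  classical
  have h4 := (mat_eq_col (d.tensor e) α β).symm.trans (mat_tensor d e _ _)
  have h1 := mat_eq_col d α β
  have h2 := mat_eq_col e (fun t => α (m + t)) (fun t => β (n + t))
  simp only [Fin.val_castAdd, Fin.val_natAdd] at h4
  rw [h1, h2] at h4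
  by_cases c1 : d.Col α β <;> by_cases c2 : e.Col (fun t => α (m + t)) (fun t => β (n + t)) <;>
    simp only [c1, c2, if_true, if_false, mul_one, mul_zero] at h4 <;> split_ifs at h4 <;> tauto

/-- Change of the numbers of dots along equalities. -/
def cast {m n m' n' : ℕ} (hm : m = m') (hn : n = n') (d : Diagram m n) : Diagram m' n' :=
  hm ▸ hn ▸ d

theorem col_cast {m n m' n' : ℕ} (hm : m = m') (hn : n = n') (d : Diagram m n)
    (α β : ℕ → Bool) : (d.cast hm hn).Col α β ↔ d.Col α β := by
  subst hm hn; rfl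

/-! ### Caps and cups at a given position, and their planar relations -/

/-- The index of the `t`-th dot which remains when the dots `i` and `i + 1` are removed. -/
def skip (i t : ℕ) : ℕ := if t < i then t else t + 2

/-- The cap joining the dots `i` and `i + 1`. -/
def capAt (m n i : ℕ) (hm : m = n + 2) (hi : i ≤ n) : Diagram m n :=
  (((Diagram.id i).tensor Diagram.cap).tensor (Diagram.id (n - i))).cast (by omega) (by omega)

/-- The cup joining the dots `i` and `i + 1`. -/
def cupAt (n m i : ℕ) (hm : m = n + 2) (hi : i ≤ n) : Diagram n m :=
  (((Diagram.id i).tensor Diagram.cup).tensor (Diagram.id (n - i))).cast (by omega) (by omega)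

/-- The cap and the cup joining the dots `i` and `i + 1`. -/
def capCupAt (n i : ℕ) (hi : i + 2 ≤ n) : Diagram n n :=
  (((Diagram.id i).tensor (Diagram.cap.comp Diagram.cup)).tensor (Diagram.id (n - i - 2))).cast
    (by omega) (by omega)

theorem col_capAt {m n i : ℕ} (hm : m = n + 2) (hi : i ≤ n) (α β : ℕ → Bool) :
    (capAt m n i hm hi).Col α β ↔ α i = α (i + 1) ∧ ∀ t < n, β t = α (skip i t) := by
  simp only [capAt, col_cast, col_tensor, col_id, col_cap, skip]
  constructor
  · rintro ⟨⟨h1, h2⟩, h3⟩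
    refine ⟨h2, fun t ht => ?_⟩
    split_ifs with h
    · exact (h1 t h).symm
    · have := h3 (t - i) (by omega)
      rw [show i + 2 + (t - i) = t + 2 by omega, show i + 0 + (t - i) = t by omega] at this
      exact this.symm
  · rintro ⟨h1, h2⟩
    refine ⟨⟨fun t ht => ?_, h1⟩, fun t ht => ?_⟩
    · rw [h2 t (by omega), if_pos ht]
    · rw [h2 (i + 0 + t) (by omega), if_neg (by omega)]
      congr 1; omega

theorem col_cupAt {n m i : ℕ} (hm : m = n + 2) (hi : i ≤ n) (α β : ℕ → Bool) :
    (cupAt n m i hm hi).Col α β ↔ β i = β (i + 1) ∧ ∀ t < n, α t = β (skip i t) := by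
  simp only [cupAt, col_cast, col_tensor, col_id, col_cup, skip]
  constructor
  · rintro ⟨⟨h1, h2⟩, h3⟩
    refine ⟨h2, fun t ht => ?_⟩
    split_ifs with h
    · exact h1 t h
    · have := h3 (t - i) (by omega)
      rwa [show i + 2 + (t - i) = t + 2 by omega, show i + 0 + (t - i) = t by omega] at this
  · rintro ⟨h1, h2⟩
    refine ⟨⟨fun t ht => ?_, h1⟩, fun t ht => ?_⟩
    · rw [h2 t (by omega), if_pos ht]
    · rw [h2 (i + 0 + t) (by omega), if_neg (by omega)]
      congr 1; omega

theorem col_capCupAt {n i : ℕ} (hi : i + 2 ≤ n) (α β : ℕ → Bool) :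
    (capCupAt n i hi).Col α β ↔ α i = α (i + 1) ∧ β i = β (i + 1) ∧
      ∀ t < n, t ≠ i → t ≠ i + 1 → α t = β t := by
  simp only [capCupAt, col_cast, col_tensor, col_id, col_comp, col_cup, col_cap]
  constructor
  · rintro ⟨⟨h1, -, h2, h4⟩, h3⟩
    refine ⟨h2, h4, fun t ht h5 h6 => ?_⟩
    rcases lt_or_ge t i with h | h
    · exact h1 t h
    · have := h3 (t - i - 2) (by omega)
      rwa [show i + 2 + (t - i - 2) = t by omega] at this
  · rintro ⟨h1, h2, h3⟩
    exact ⟨⟨fun t ht => h3 t (by omega) (by omega) (by omega), α, h1, h2⟩,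
      fun t ht => h3 _ (by omega) (by omega) (by omega)⟩

theorem col_congr {m n : ℕ} (d : Diagram m n) {α α' β β' : ℕ → Bool}
    (hα : ∀ t < m, α t = α' t) (hβ : ∀ t < n, β t = β' t) : d.Col α β ↔ d.Col α' β' := by
  unfold Col
  rw [show (fun i : Fin m => α i) = fun i : Fin m => α' i from funext fun i => hα i i.2,
    show (fun i : Fin n => β i) = fun i : Fin n => β' i from funext fun i => hβ i i.2]

theorem skip_lt {i n t : ℕ} (ht : t < n) : skip i t < n + 2 := by
  unfold skip; split_ifs <;> omega

theorem col_capAt_comp {m n p i : ℕ} (hm : m = n + 2) (hi : i ≤ n) (d : Diagram n p)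
    (α γ : ℕ → Bool) : ((capAt m n i hm hi).comp d).Col α γ ↔
      α i = α (i + 1) ∧ d.Col (fun t => α (skip i t)) γ := by
  simp only [col_comp, col_capAt]
  constructor
  · rintro ⟨β, ⟨h1, h2⟩, h3⟩
    exact ⟨h1, (col_congr d h2 fun _ _ => rfl).1 h3⟩
  · rintro ⟨h1, h2⟩
    exact ⟨_, ⟨h1, fun _ _ => rfl⟩, h2⟩

theorem col_comp_cupAt {m n p i : ℕ} (hm : m = n + 2) (hi : i ≤ n) (d : Diagram p n)
    (α γ : ℕ → Bool) : (d.comp (cupAt n m i hm hi)).Col α γ ↔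
      γ i = γ (i + 1) ∧ d.Col α (fun t => γ (skip i t)) := by
  simp only [col_comp, col_cupAt]
  constructor
  · rintro ⟨β, h3, h1, h2⟩
    exact ⟨h1, (col_congr d (fun _ _ => rfl) h2).1 h3⟩
  · rintro ⟨h1, h2⟩
    exact ⟨_, h2, h1, fun _ _ => rfl⟩

theorem loops_capAt {m n p i : ℕ} (hm : m = n + 2) (hi : i ≤ n) (d : Diagram n p) :
    (capAt m n i hm hi).loops d = 0 :=
  loops_eq_zero _ _ fun _ h _ => ((col_capAt hm hi _ _).1 h).2

theorem loops_cupAt {m n p i : ℕ} (hm : m = n + 2) (hi : i ≤ n) (d : Diagram p n) :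
    d.loops (cupAt n m i hm hi) = 0 :=
  loops_eq_zero _ _ fun _ _ h t ht => (((col_cupAt hm hi _ _).1 h).2 t ht)

theorem capAt_comp_cupAt {m n i : ℕ} (hm : m = n + 2) (hi : i ≤ n) :
    (capAt m n i hm hi).comp (cupAt n m i hm hi) = capCupAt m i (by omega) := by
  refine ext_col fun α β => ?_
  rw [col_capAt_comp, col_cupAt, col_capCupAt]
  refine and_congr_right fun _ => and_congr_right fun _ => ?_
  constructor
  · intro h t ht h1 h2
    rcases lt_or_ge t i with h3 | h3
    · have := h t (by omega)
      rwa [skip, if_pos h3] at this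
    · have := h (t - 2) (by omega)
      rwa [skip, if_neg (by omega), Nat.sub_add_cancel (by omega)] at this
  · intro h t ht
    exact h _ (hm ▸ skip_lt ht) (by unfold skip; split_ifs <;> omega)
      (by unfold skip; split_ifs <;> omega)

/-- Straightening a line which turns to the right and back. -/
theorem cupAt_comp_capAt_succ {m n i : ℕ} (hm : m = n + 2) (hi : i + 1 ≤ n) :
    (cupAt n m i hm (by omega)).comp (capAt m n (i + 1) hm hi) = Diagram.id n ∧
      (cupAt n m i hm (by omega)).loops (capAt m n (i + 1) hm hi) = 0 := by
  -- The middle row is forced by the bottom row: the three dots i, i + 1, i + 2 lie on the bent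
  -- line, and the dots beyond are shifted by two. This gives both the composite and the absence of
  -- loops.
  have key : ∀ α β γ : ℕ → Bool, (cupAt n m i hm (by omega)).Col α β →
      (capAt m n (i + 1) hm hi).Col β γ → ∀ t < m, (t < n → α t = γ t) ∧ β t =
        if t ≤ i then α t else if t = i + 1 then α i else α (t - 2) := by
    intro α β γ h1 h2 t ht
    rw [col_cupAt] at h1
    rw [col_capAt] at h2
    have e1 := h1.2 t
    have e2 := h2.2 t
    have e3 := h1.2 (t - 2) (by omega)
    have e4 := h1.2 i (by omega)
    simp only [skip] at e1 e2 e3 e4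
    grind
  refine ⟨ext_col fun α γ => ?_, loops_eq_zero _ _ fun β h1 h2 t ht => ?_⟩
  · rw [col_comp, col_id]
    refine ⟨fun ⟨β, h1, h2⟩ t ht => (key α β γ h1 h2 t (by omega)).1 ht, fun h => ?_⟩
    refine ⟨fun t => if t ≤ i then α t else if t = i + 1 then α i else α (t - 2), ?_, ?_⟩
    · rw [col_cupAt]
      simp only [skip]
      grind
    · rw [col_capAt]
      simp only [skip]
      grind
  · have := (key _ β _ h1 h2 t ht).2
    split_ifs at this <;> exact this

/-- Straightening a line which turns to the left and back. -/
theorem cupAt_succ_comp_capAt {m n i : ℕ} (hm : m = n + 2) (hi : i + 1 ≤ n) :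
    (cupAt n m (i + 1) hm hi).comp (capAt m n i hm (by omega)) = Diagram.id n ∧
      (cupAt n m (i + 1) hm hi).loops (capAt m n i hm (by omega)) = 0 := by
  have key : ∀ α β γ : ℕ → Bool, (cupAt n m (i + 1) hm hi).Col α β →
      (capAt m n i hm (by omega)).Col β γ → ∀ t < m, (t < n → α t = γ t) ∧ β t =
        if t ≤ i then α t else if t = i + 1 then α i else α (t - 2) := by
    intro α β γ h1 h2 t ht
    rw [col_cupAt] at h1
    rw [col_capAt] at h2
    have e1 := h1.2 t
    have e2 := h2.2 t
    have e3 := h1.2 (t - 2) (by omega)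
    have e4 := h1.2 i (by omega)
    simp only [skip] at e1 e2 e3 e4
    grind
  refine ⟨ext_col fun α γ => ?_, loops_eq_zero _ _ fun β h1 h2 t ht => ?_⟩
  · rw [col_comp, col_id]
    refine ⟨fun ⟨β, h1, h2⟩ t ht => (key α β γ h1 h2 t (by omega)).1 ht, fun h => ?_⟩
    refine ⟨fun t => if t ≤ i then α t else if t = i + 1 then α i else α (t - 2), ?_, ?_⟩
    · rw [col_cupAt]
      simp only [skip]
      grind
    · rw [col_capAt]
      simp only [skip]
      grind
  · have := (key _ β _ h1 h2 t ht).2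
    split_ifs at this <;> exact this

/-- The cup and the cap occupy disjoint groups of strands, so their heights may be exchanged;
without the two strands of the cup below it, the cap sits two places further left. -/
theorem cupAt_comp_capAt_right {m n p i l : ℕ} (hm : m = n + 2) (hp : n = p + 2) (hil : i ≤ l)
    (hl : l ≤ p) : (cupAt n m i hm (by omega)).comp (capAt m n (l + 2) hm (by omega)) =
      (capAt n p l hp hl).comp (cupAt p n i hp (by omega)) ∧
      (cupAt n m i hm (by omega)).loops (capAt m n (l + 2) hm (by omega)) = 0 := by
  refine ⟨ext_col fun α γ => ?_, loops_eq_zero _ _ fun β h1 h2 t ht => ?_⟩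
  · rw [col_comp, col_capAt_comp, col_cupAt]
    constructor
    · rintro ⟨β, h1, h2⟩
      rw [col_cupAt] at h1
      rw [col_capAt] at h2
      have e1 := h1.2 l (by omega)
      have e2 := h1.2 (l + 1) (by omega)
      have e3 := h2.2 i (by omega)
      have e4 := h2.2 (i + 1) (by omega)
      refine ⟨?_, ?_, fun t ht => ?_⟩
      · simp only [skip] at e1 e2; grind
      · simp only [skip] at e3 e4; grind
      · rw [h1.2 _ (hp ▸ skip_lt ht), h2.2 _ (hp ▸ skip_lt ht)]
        congr 1
        unfold skip; split_ifs <;> omega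
    · rintro ⟨h1, h2, h3⟩
      -- In the middle row the two dots of the new cup carry the colour that this cup has at the
      -- top; the other dots continue the bottom row.
      refine ⟨fun t => if t < i then α t else if t ≤ i + 1 then γ i else α (t - 2), ?_, ?_⟩
      · rw [col_cupAt]; simp only [skip]; grind
      · rw [col_capAt]
        refine ⟨by grind, fun t ht => ?_⟩
        have e1 := h3 t
        have e2 := h3 (t - 2)
        simp only [skip] at e1 e2 ⊢
        grind
  · rw [col_cupAt] at h1
    rw [col_capAt] at h2
    have e1 := h1.2 t
    have e2 := h1.2 (t - 2)
    have e3 := h2.2 t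
    simp only [skip] at e1 e2 e3
    grind

theorem cupAt_comp_capAt_left {m n p i l : ℕ} (hm : m = n + 2) (hp : n = p + 2) (hil : i ≤ l)
    (hl : l ≤ p) : (cupAt n m (l + 2) hm (by omega)).comp (capAt m n i hm (by omega)) =
      (capAt n p i hp (by omega)).comp (cupAt p n l hp hl) ∧
      (cupAt n m (l + 2) hm (by omega)).loops (capAt m n i hm (by omega)) = 0 := by
  refine ⟨ext_col fun α γ => ?_, loops_eq_zero _ _ fun β h1 h2 t ht => ?_⟩
  · rw [col_comp, col_capAt_comp, col_cupAt]
    constructor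
    · rintro ⟨β, h1, h2⟩
      rw [col_cupAt] at h1
      rw [col_capAt] at h2
      have e1 := h1.2 i (by omega)
      have e2 := h1.2 (i + 1) (by omega)
      have e3 := h2.2 l (by omega)
      have e4 := h2.2 (l + 1) (by omega)
      refine ⟨?_, ?_, fun t ht => ?_⟩
      · simp only [skip] at e1 e2; grind
      · simp only [skip] at e3 e4; grind
      · rw [h1.2 _ (hp ▸ skip_lt ht), h2.2 _ (hp ▸ skip_lt ht)]
        congr 1
        unfold skip; split_ifs <;> omega
    · rintro ⟨h1, h2, h3⟩
      refine ⟨fun t => if t < l + 2 then α t else if t ≤ l + 3 then γ l else α (t - 2), ?_, ?_⟩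
      · rw [col_cupAt]; simp only [skip]; grind
      · rw [col_capAt]
        refine ⟨by grind, fun t ht => ?_⟩
        have e1 := h3 t
        have e2 := h3 (t - 2)
        simp only [skip] at e1 e2 ⊢
        grind
  · rw [col_cupAt] at h1
    rw [col_capAt] at h2
    have e1 := h1.2 t
    have e2 := h1.2 (t - 2)
    have e3 := h2.2 t
    have e4 := h2.2 (t - 2)
    simp only [skip] at e1 e2 e3 e4
    grind

theorem capAt_comp_capAt {m n p i l : ℕ} (hm : m = n + 2) (hp : n = p + 2) (hil : i ≤ l)
    (hl : l ≤ p) : (capAt m n (l + 2) hm (by omega)).comp (capAt n p i hp (by omega)) =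
      (capAt m n i hm (by omega)).comp (capAt n p l hp hl) := by
  refine ext_col fun α γ => ?_
  rw [col_capAt_comp, col_capAt_comp, col_capAt, col_capAt]
  -- Removing the two distant pairs in either order leaves the same dots in the same order.
  have h : ∀ t, skip (l + 2) (skip i t) = skip i (skip l t) := by
    intro t; unfold skip; split_ifs <;> omega
  have h1 : skip (l + 2) i = i := if_pos (by omega)
  have h2 : skip (l + 2) (i + 1) = i + 1 := if_pos (by omega)
  have h3 : skip i l = l + 2 := if_neg (by omega)
  have h4 : skip i (l + 1) = l + 3 := if_neg (by omega)
  simp only [h, h1, h2, h3, h4]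
  tauto

theorem cupAt_comp_cupAt {m n p i l : ℕ} (hm : m = n + 2) (hp : n = p + 2) (hil : i ≤ l)
    (hl : l ≤ p) : (cupAt p n i hp (by omega)).comp (cupAt n m (l + 2) hm (by omega)) =
      (cupAt p n l hp hl).comp (cupAt n m i hm (by omega)) := by
  refine ext_col fun α γ => ?_
  rw [col_comp_cupAt, col_comp_cupAt, col_cupAt, col_cupAt]
  have h : ∀ t, skip (l + 2) (skip i t) = skip i (skip l t) := by
    intro t; unfold skip; split_ifs <;> omega
  have h1 : skip (l + 2) i = i := if_pos (by omega)
  have h2 : skip (l + 2) (i + 1) = i + 1 := if_pos (by omega)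
  have h3 : skip i l = l + 2 := if_neg (by omega)
  have h4 : skip i (l + 1) = l + 3 := if_neg (by omega)
  simp only [h, h1, h2, h3, h4]
  tauto

theorem capCupAt_tensor_id {n i : ℕ} (hi : i + 2 ≤ n) (r : ℕ) :
    (capCupAt n i hi).tensor (Diagram.id r) = capCupAt (n + r) i (by omega) := by
  refine ext_col fun α β => ?_
  rw [col_tensor, col_capCupAt, col_capCupAt, col_id]
  constructor
  · rintro ⟨⟨h1, h2, h3⟩, h4⟩
    refine ⟨h1, h2, fun t ht h5 h6 => ?_⟩
    rcases lt_or_ge t n with h | h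
    · exact h3 t h h5 h6
    · have := h4 (t - n) (by omega)
      rwa [Nat.add_sub_cancel' h] at this
  · rintro ⟨h1, h2, h3⟩
    exact ⟨⟨h1, h2, fun t ht => h3 t (by omega)⟩,
      fun t ht => h3 _ (by omega) (by omega) (by omega)⟩

theorem id_tensor_capCupAt {n i : ℕ} (hi : i + 2 ≤ n) (r : ℕ) :
    (Diagram.id r).tensor (capCupAt n i hi) = capCupAt (r + n) (r + i) (by omega) := by
  refine ext_col fun α β => ?_
  rw [col_tensor, col_capCupAt, col_capCupAt, col_id]
  constructor
  · rintro ⟨h4, h1, h2, h3⟩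
    refine ⟨h1, h2, fun t ht h5 h6 => ?_⟩
    rcases lt_or_ge t r with h | h
    · exact h4 t h
    · have := h3 (t - r) (by omega) (by omega) (by omega)
      rwa [Nat.add_sub_cancel' h] at this
  · rintro ⟨h1, h2, h3⟩
    exact ⟨fun t ht => h3 _ (by omega) (by omega) (by omega), h1, h2,
      fun t ht _ _ => h3 _ (by omega) (by omega) (by omega)⟩

end Diagram

/-! ### The elementary caps, cups and generators as morphisms -/

namespace LinDiag

variable {k : ℕ}

/-- The cap `m ⟶ n` joining the strands `i` and `i + 1`, for `m = n + 2` and `i ≤ n`. -/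
noncomputable def capAt (k m n i : ℕ) : strands k m ⟶ strands k n :=
  -- The junk value `0` keeps the range conditions out of the arguments, so that positions and
  -- numbers of strands can be rewritten freely.
  if h : m = n + 2 ∧ i ≤ n then ofDiagram (Diagram.capAt m n i h.1 h.2) else 0

/-- The cup `n ⟶ m` joining the strands `i` and `i + 1`, for `m = n + 2` and `i ≤ n`. -/
noncomputable def cupAt (k n m i : ℕ) : strands k n ⟶ strands k m :=
  if h : m = n + 2 ∧ i ≤ n then ofDiagram (Diagram.cupAt n m i h.1 h.2) else 0

/-- The generator of the Temperley-Lieb algebra on `n` strands acting on the strands `i` and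
`i + 1`, for `i + 2 ≤ n`. -/
noncomputable def capCupAt (k n i : ℕ) : strands k n ⟶ strands k n :=
  if h : i + 2 ≤ n then ofDiagram (Diagram.capCupAt n i h) else 0

theorem ofDiagram_comp_of_loops {m n p : ℕ} {d : Diagram m n} {d' : Diagram n p}
    (h : d.loops d' = 0) :
    (ofDiagram d : strands k m ⟶ strands k n) ≫ ofDiagram d' = ofDiagram (d.comp d') := by
  rw [ofDiagram_comp, h, pow_zero, one_smul]

theorem capAt_eq {m n i : ℕ} (hm : m = n + 2) (hi : i ≤ n) :
    capAt k m n i = ofDiagram (Diagram.capAt m n i hm hi) := dif_pos ⟨hm, hi⟩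

theorem cupAt_eq {m n i : ℕ} (hm : m = n + 2) (hi : i ≤ n) :
    cupAt k n m i = ofDiagram (Diagram.cupAt n m i hm hi) := dif_pos ⟨hm, hi⟩

theorem capCupAt_eq {n i : ℕ} (hi : i + 2 ≤ n) :
    capCupAt k n i = ofDiagram (Diagram.capCupAt n i hi) := dif_pos hi

theorem capAt_comp_cupAt {m n i : ℕ} (hm : m = n + 2) (hi : i ≤ n) :
    capAt k m n i ≫ cupAt k n m i = capCupAt k m i := by
  rw [capAt_eq hm hi, cupAt_eq hm hi, capCupAt_eq (by omega),
    ofDiagram_comp_of_loops (Diagram.loops_capAt _ _ _), Diagram.capAt_comp_cupAt]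

theorem cupAt_comp_capAt_succ {m n i : ℕ} (hm : m = n + 2) (hi : i + 1 ≤ n) :
    cupAt k n m i ≫ capAt k m n (i + 1) = 𝟙 _ := by
  rw [capAt_eq hm hi, cupAt_eq hm (by omega),
    ofDiagram_comp_of_loops (Diagram.cupAt_comp_capAt_succ hm hi).2,
    (Diagram.cupAt_comp_capAt_succ hm hi).1, ofDiagram_id]

theorem cupAt_succ_comp_capAt {m n i : ℕ} (hm : m = n + 2) (hi : i + 1 ≤ n) :
    cupAt k n m (i + 1) ≫ capAt k m n i = 𝟙 _ := by
  rw [capAt_eq hm (by omega), cupAt_eq hm hi,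
    ofDiagram_comp_of_loops (Diagram.cupAt_succ_comp_capAt hm hi).2,
    (Diagram.cupAt_succ_comp_capAt hm hi).1, ofDiagram_id]

section

variable {m n p i l : ℕ} (hm : m = n + 2) (hp : n = p + 2) (hil : i ≤ l) (hl : l ≤ p)

include hm hp hil hl

theorem cupAt_comp_capAt_right :
    cupAt k n m i ≫ capAt k m n (l + 2) = capAt k n p l ≫ cupAt k p n i := by
  rw [cupAt_eq hm (by omega), capAt_eq hm (by omega), capAt_eq hp hl, cupAt_eq hp (by omega),
    ofDiagram_comp_of_loops (Diagram.cupAt_comp_capAt_right hm hp hil hl).2,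
    (Diagram.cupAt_comp_capAt_right hm hp hil hl).1,
    ofDiagram_comp_of_loops (Diagram.loops_capAt _ _ _)]

theorem cupAt_comp_capAt_left :
    cupAt k n m (l + 2) ≫ capAt k m n i = capAt k n p i ≫ cupAt k p n l := by
  rw [cupAt_eq hm (by omega), capAt_eq hm (by omega), capAt_eq hp (by omega), cupAt_eq hp hl,
    ofDiagram_comp_of_loops (Diagram.cupAt_comp_capAt_left hm hp hil hl).2,
    (Diagram.cupAt_comp_capAt_left hm hp hil hl).1,
    ofDiagram_comp_of_loops (Diagram.loops_capAt _ _ _)]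

theorem capAt_comp_capAt :
    capAt k m n (l + 2) ≫ capAt k n p i = capAt k m n i ≫ capAt k n p l := by
  rw [capAt_eq hm (by omega), capAt_eq hm (by omega), capAt_eq hp (by omega), capAt_eq hp hl,
    ofDiagram_comp_of_loops (Diagram.loops_capAt _ _ _),
    ofDiagram_comp_of_loops (Diagram.loops_capAt _ _ _), Diagram.capAt_comp_capAt hm hp hil hl]

theorem cupAt_comp_cupAt :
    cupAt k p n i ≫ cupAt k n m (l + 2) = cupAt k p n l ≫ cupAt k n m i := by
  rw [cupAt_eq hm (by omega), cupAt_eq hm (by omega), cupAt_eq hp (by omega), cupAt_eq hp hl,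
    ofDiagram_comp_of_loops (Diagram.loops_cupAt _ _ _),
    ofDiagram_comp_of_loops (Diagram.loops_cupAt _ _ _), Diagram.cupAt_comp_cupAt hm hp hil hl]

end

/-- The generator is a cap followed by a cup, and each half slides past the distant cap. The
position of that cap changes to i - 2 between the two moves and returns to i. -/
theorem capCupAt_comp_capAt_left {m n i t : ℕ} (hm : m = n + 2) (ht : t + 2 ≤ i) (hi : i ≤ n) :
    capCupAt k m t ≫ capAt k m n i = capAt k m n i ≫ capCupAt k n t := by
  obtain ⟨p, rfl⟩ : ∃ p, n = p + 2 := ⟨n - 2, by omega⟩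
  obtain ⟨l, rfl⟩ : ∃ l, i = l + 2 := ⟨i - 2, by omega⟩
  rw [← capAt_comp_cupAt hm (by omega), ← capAt_comp_cupAt rfl (by omega : t ≤ p), Category.assoc,
    cupAt_comp_capAt_right hm rfl (by omega) (by omega), ← Category.assoc, ← Category.assoc,
    capAt_comp_capAt hm rfl (by omega) (by omega)]

theorem cupAt_comp_capCupAt_left {m n i t : ℕ} (hm : m = n + 2) (ht : t + 2 ≤ i) (hi : i ≤ n) :
    cupAt k n m i ≫ capCupAt k m t = capCupAt k n t ≫ cupAt k n m i := by
  obtain ⟨p, rfl⟩ : ∃ p, n = p + 2 := ⟨n - 2, by omega⟩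
  obtain ⟨l, rfl⟩ : ∃ l, i = l + 2 := ⟨i - 2, by omega⟩
  rw [← capAt_comp_cupAt hm (by omega), ← capAt_comp_cupAt rfl (by omega : t ≤ p),
    ← Category.assoc, cupAt_comp_capAt_left hm rfl (by omega) (by omega), Category.assoc,
    Category.assoc, cupAt_comp_cupAt hm rfl (by omega) (by omega)]

theorem cupAt_comp_capCupAt_right {m n i t : ℕ} (hm : m = n + 2) (ht : i ≤ t) (hi : t + 2 ≤ n) :
    cupAt k n m i ≫ capCupAt k m (t + 2) = capCupAt k n t ≫ cupAt k n m i := by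
  obtain ⟨p, rfl⟩ : ∃ p, n = p + 2 := ⟨n - 2, by omega⟩
  rw [← capAt_comp_cupAt hm (by omega), ← capAt_comp_cupAt rfl (by omega : t ≤ p),
    ← Category.assoc, cupAt_comp_capAt_right hm rfl (by omega) (by omega), Category.assoc,
    Category.assoc, cupAt_comp_cupAt hm rfl (by omega) (by omega)]

theorem capCupAt_comm {n i t : ℕ} (ht : t + 2 ≤ i) (hi : i + 2 ≤ n) :
    capCupAt k n t ≫ capCupAt k n i = capCupAt k n i ≫ capCupAt k n t := by
  obtain ⟨p, rfl⟩ : ∃ p, n = p + 2 := ⟨n - 2, by omega⟩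
  rw [← capAt_comp_cupAt rfl (by omega : i ≤ p), ← Category.assoc,
    capCupAt_comp_capAt_left rfl ht (by omega), Category.assoc, Category.assoc,
    cupAt_comp_capCupAt_left rfl ht (by omega)]

theorem capCupAt_tensor_id {n i : ℕ} (hi : i + 2 ≤ n) (r : ℕ) :
    (tensorHom (capCupAt k n i) (𝟙 (strands k r)) : strands k (n + r) ⟶ strands k (n + r)) =
      capCupAt k (n + r) i := by
  rw [capCupAt_eq hi, capCupAt_eq (by omega : i + 2 ≤ n + r), ← Diagram.capCupAt_tensor_id hi]
  exact tensor_ofDiagram _ _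

theorem id_tensor_capCupAt {n i : ℕ} (hi : i + 2 ≤ n) (r : ℕ) :
    (tensorHom (𝟙 (strands k r)) (capCupAt k n i) : strands k (r + n) ⟶ strands k (r + n)) =
      capCupAt k (r + n) (r + i) := by
  rw [capCupAt_eq hi, capCupAt_eq (by omega : r + i + 2 ≤ r + n), ← Diagram.id_tensor_capCupAt hi]
  exact tensor_ofDiagram _ _

theorem cap_comp_cup (k : ℕ) :
    cap k ≫ cup k = ofDiagram (Diagram.cap.comp Diagram.cup) :=
  ofDiagram_comp_of_loops (Diagram.loops_eq_zero _ _ fun _ _ _ t ht => absurd ht t.not_lt_zero)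

/-- This identifies the generator used in the recursion for the Jones-Wenzl projections with a
positioned generator, to which the planar relations apply. -/
theorem capCup_eq (k n : ℕ) : capCup k n = capCupAt k (n + 2) n := by
  rw [capCup, cap_comp_cup, capCupAt_eq le_rfl]
  refine (tensor_ofDiagram _ _).trans (congrArg _ (Diagram.ext_col fun α β => ?_))
  rw [Diagram.col_tensor, Diagram.col_id, Diagram.col_comp, Diagram.col_capCupAt]
  simp only [Diagram.col_cap, Diagram.col_cup]
  constructor
  · rintro ⟨h, _, h1, h2⟩
    exact ⟨h1, h2, fun t ht h3 h4 => h t (by omega)⟩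
  · rintro ⟨h1, h2, h⟩
    exact ⟨fun t ht => h t (by omega) (by omega) (by omega), α, h1, h2⟩

/-- The cap in the middle of `n + 2 + n` strands. -/
theorem id_tensor_cap_tensor_id (k n : ℕ) :
    (tensorHom (tensorHom (𝟙 (strands k n)) (cap k)) (𝟙 (strands k n)) :
      strands k (n + 2 + n) ⟶ strands k (n + n)) = capAt k (n + 2 + n) (n + n) n := by
  rw [capAt_eq (by omega) (by omega)]
  refine (congrArg (fun f => tensorHom f (𝟙 (strands k n)))
    (tensor_ofDiagram (Diagram.id n) Diagram.cap)).trans ((tensor_ofDiagram _ _).trans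
      (congrArg (ofDiagram (m := n + 2 + n) (n := n + n)) (Diagram.ext_col fun α β => ?_)))
  unfold Diagram.capAt
  rw [Diagram.col_cast, Diagram.col_tensor, Diagram.col_tensor, Diagram.col_id, Diagram.col_id]
  rw [Diagram.col_tensor, Diagram.col_tensor, Diagram.col_id, Diagram.col_id, Nat.add_sub_cancel]

/-- The cup in the middle of `n + 2 + n` strands. -/
theorem id_tensor_cup_tensor_id (k n : ℕ) :
    (tensorHom (tensorHom (𝟙 (strands k n)) (cup k)) (𝟙 (strands k n)) :
      strands k (n + n) ⟶ strands k (n + 2 + n)) = cupAt k (n + n) (n + 2 + n) n := by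
  rw [cupAt_eq (by omega) (by omega)]
  refine (congrArg (fun f => tensorHom f (𝟙 (strands k n)))
    (tensor_ofDiagram (Diagram.id n) Diagram.cup)).trans ((tensor_ofDiagram _ _).trans
      (congrArg (ofDiagram (m := n + n) (n := n + 2 + n)) (Diagram.ext_col fun α β => ?_)))
  unfold Diagram.cupAt
  rw [Diagram.col_cast, Diagram.col_tensor, Diagram.col_tensor, Diagram.col_id, Diagram.col_id]
  rw [Diagram.col_tensor, Diagram.col_tensor, Diagram.col_id, Diagram.col_id, Nat.add_sub_cancel]

/-! ### Jones-Wenzl projections on a block of consecutive strands -/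

section JonesWenzl

/-- The Jones-Wenzl projection acting on the `j` strands `s, …, s + j - 1` of `n` strands. -/
noncomputable def jonesWenzlAt (k n s : ℕ) : ℕ → (strands k n ⟶ strands k n)
  | 0 => 𝟙 _
  | 1 => 𝟙 _
  | j + 2 => jonesWenzlAt k n s (j + 1) + (qint k (j + 1) / qint k (j + 2)) •
      (jonesWenzlAt k n s (j + 1) ≫ capCupAt k n (s + j) ≫ jonesWenzlAt k n s (j + 1))

/-- A property of pairs of endomorphisms which passes from the generators to the Jones-Wenzl
projections. -/
theorem jonesWenzlAt_induction {n n' s s' : ℕ}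
    {P : (strands k n ⟶ strands k n) → (strands k n' ⟶ strands k n') → Prop}
    (hid : P (𝟙 _) (𝟙 _)) (hadd : ∀ f g f' g', P f f' → P g g' → P (f + g) (f' + g'))
    (hsmul : ∀ (c : ℂ) f f', P f f' → P (c • f) (c • f'))
    (hcomp : ∀ f g f' g', P f f' → P g g' → P (f ≫ g) (f' ≫ g')) (j : ℕ)
    (h : ∀ t, t + 2 ≤ j → P (capCupAt k n (s + t)) (capCupAt k n' (s' + t))) :
    P (jonesWenzlAt k n s j) (jonesWenzlAt k n' s' j) := by
  induction j using Nat.strong_induction_on with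
  | _ j ih =>
  match j with
  | 0 => exact hid
  | 1 => exact hid
  | j + 2 =>
    have h1 := ih (j + 1) (by omega) fun t ht => h t (by omega)
    exact hadd _ _ _ _ h1 (hsmul _ _ _ (hcomp _ _ _ _ h1 (hcomp _ _ _ _ (h j le_rfl) h1)))

/-- The projection is built from the generators of its block by sums, scalars and composition with
the same coefficients wherever the block lies, so whatever slides past the generators slides past
the projection. The commutation rules that follow are instances. -/
theorem jonesWenzlAt_slide {n n' s s' j : ℕ} (x : strands k n ⟶ strands k n')
    (h : ∀ t, t + 2 ≤ j → x ≫ capCupAt k n' (s' + t) = capCupAt k n (s + t) ≫ x) :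
    x ≫ jonesWenzlAt k n' s' j = jonesWenzlAt k n s j ≫ x := by
  refine jonesWenzlAt_induction (P := fun f f' => x ≫ f' = f ≫ x) ?_ ?_ ?_ ?_ j h
  · rw [Category.id_comp, Category.comp_id]
  · intro f g f' g' h1 h2
    rw [Preadditive.comp_add, Preadditive.add_comp, h1, h2]
  · intro c f f' h1
    rw [Linear.comp_smul, Linear.smul_comp, h1]
  · intro f g f' g' h1 h2
    rw [← Category.assoc, h1, Category.assoc, h2, Category.assoc]

theorem capAt_comp_jonesWenzlAt_left {m n i s j : ℕ} (hm : m = n + 2) (h : s + j ≤ i)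
    (hi : i ≤ n) : capAt k m n i ≫ jonesWenzlAt k n s j = jonesWenzlAt k m s j ≫ capAt k m n i :=
  jonesWenzlAt_slide _ fun t _ => (capCupAt_comp_capAt_left hm (by omega) hi).symm

theorem cupAt_comp_jonesWenzlAt_left {m n i s j : ℕ} (hm : m = n + 2) (h : s + j ≤ i)
    (hi : i ≤ n) : cupAt k n m i ≫ jonesWenzlAt k m s j = jonesWenzlAt k n s j ≫ cupAt k n m i :=
  jonesWenzlAt_slide _ fun t _ => cupAt_comp_capCupAt_left hm (by omega) hi

theorem cupAt_comp_jonesWenzlAt_right {m n i s j : ℕ} (hm : m = n + 2) (h : i ≤ s)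
    (hs : s + j ≤ n) :
    cupAt k n m i ≫ jonesWenzlAt k m (s + 2) j = jonesWenzlAt k n s j ≫ cupAt k n m i :=
  jonesWenzlAt_slide _ fun t _ => by
    rw [add_right_comm]; exact cupAt_comp_capCupAt_right hm (by omega) (by omega)

/-- Sliding is used twice: each generator of the right block passes the left projection, and
therefore so does the right projection. -/
theorem jonesWenzlAt_comm {n s j s' j' : ℕ} (h : s + j ≤ s') (hs : s' + j' ≤ n) :
    jonesWenzlAt k n s j ≫ jonesWenzlAt k n s' j' =
      jonesWenzlAt k n s' j' ≫ jonesWenzlAt k n s j :=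
  jonesWenzlAt_slide _ fun t' _ =>
    (jonesWenzlAt_slide (capCupAt k n (s' + t')) fun t _ =>
      (capCupAt_comm (by omega : s + t + 2 ≤ s' + t') (by omega)).symm).symm

theorem jonesWenzlAt_tensor_id {n s j : ℕ} (h : s + j ≤ n) (r : ℕ) :
    (tensorHom (jonesWenzlAt k n s j) (𝟙 (strands k r)) :
      strands k (n + r) ⟶ strands k (n + r)) = jonesWenzlAt k (n + r) s j := by
  refine jonesWenzlAt_induction (P := fun f f' => (tensorHom f (𝟙 (strands k r)) :
      strands k (n + r) ⟶ strands k (n + r)) = f') ?_ ?_ ?_ ?_ j ?_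
  · exact tensor_id _ _
  · rintro f g _ _ rfl rfl
    exact add_tensor _ _ _
  · rintro c f _ rfl
    exact smul_tensor _ _ _
  · rintro f g _ _ rfl rfl
    have := tensor_comp f g (𝟙 (strands k r)) (𝟙 _)
    rwa [Category.comp_id] at this
  · exact fun t ht => capCupAt_tensor_id (by omega) r

theorem id_tensor_jonesWenzlAt {n s j : ℕ} (h : s + j ≤ n) (r : ℕ) :
    (tensorHom (𝟙 (strands k r)) (jonesWenzlAt k n s j) :
      strands k (r + n) ⟶ strands k (r + n)) = jonesWenzlAt k (r + n) (r + s) j := by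
  refine jonesWenzlAt_induction (P := fun f f' => (tensorHom (𝟙 (strands k r)) f :
      strands k (r + n) ⟶ strands k (r + n)) = f') ?_ ?_ ?_ ?_ j ?_
  · exact tensor_id _ _
  · rintro f g _ _ rfl rfl
    exact tensor_add _ _ _
  · rintro c f _ rfl
    exact tensor_smul _ _ _
  · rintro f g _ _ rfl rfl
    have := tensor_comp (𝟙 (strands k r)) (𝟙 _) f g
    rwa [Category.comp_id] at this
  · intro t ht
    rw [add_assoc]
    exact id_tensor_capCupAt (by omega) r

theorem jonesWenzl_eq (k n : ℕ) : jonesWenzl k n = jonesWenzlAt k n 0 n := by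
  induction n using Nat.strong_induction_on with
  | _ n ih =>
  match n with
  | 0 => rfl
  | 1 => rfl
  | n + 2 =>
    have h : addStrand (jonesWenzlAt k (n + 1) 0 (n + 1)) = jonesWenzlAt k (n + 2) 0 (n + 1) :=
      jonesWenzlAt_tensor_id (n := n + 1) (s := 0) (j := n + 1) (by omega) 1
    rw [jonesWenzl, jonesWenzlAt, ih (n + 1) (by omega), h, capCup_eq, Nat.zero_add]

/-- `1_s ⊗ f_j ⊗ 1_r`. -/
theorem jonesWenzlAt_eq_tensor (k s j r : ℕ) :
    jonesWenzlAt k (s + (j + r)) s j = tensorHom (𝟙 (strands k s))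
      (tensorHom (jonesWenzl k j) (𝟙 (strands k r)) : strands k (j + r) ⟶ strands k (j + r)) := by
  have h : (tensorHom (jonesWenzl k j) (𝟙 (strands k r)) : strands k (j + r) ⟶ strands k (j + r))
      = jonesWenzlAt k (j + r) 0 j := by
    rw [jonesWenzl_eq]
    exact jonesWenzlAt_tensor_id (n := j) (s := 0) (j := j) (by omega) r
  rw [h]
  exact (id_tensor_jonesWenzlAt (n := j + r) (s := 0) (j := j) (by omega) s).symm

theorem capCupAt_eq_tensor (k s j r : ℕ) :
    capCupAt k (s + (j + 2 + r)) (s + j) = tensorHom (𝟙 (strands k s))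
      (tensorHom (capCup k j) (𝟙 (strands k r)) :
        strands k (j + 2 + r) ⟶ strands k (j + 2 + r)) := by
  have h : (tensorHom (capCup k j) (𝟙 (strands k r)) :
      strands k (j + 2 + r) ⟶ strands k (j + 2 + r)) = capCupAt k (j + 2 + r) j := by
    rw [capCup_eq]
    exact capCupAt_tensor_id (by omega) r
  rw [h]
  exact (id_tensor_capCupAt (n := j + 2 + r) (i := j) (by omega) s).symm

/-- By the interchange law, placing strands on both sides is multiplicative. This carries identities
for `jonesWenzl` over to an arbitrary block. -/
theorem id_tensor_tensor_id_comp {s j r : ℕ} (f g : strands k j ⟶ strands k j) :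
    (tensorHom (𝟙 (strands k s)) (tensorHom f (𝟙 (strands k r)) :
        strands k (j + r) ⟶ strands k (j + r)) :
        strands k (s + (j + r)) ⟶ strands k (s + (j + r))) ≫
      (tensorHom (𝟙 (strands k s)) (tensorHom g (𝟙 (strands k r)) :
        strands k (j + r) ⟶ strands k (j + r))) =
      tensorHom (𝟙 (strands k s)) (tensorHom (f ≫ g) (𝟙 (strands k r)) :
        strands k (j + r) ⟶ strands k (j + r)) := by
  have h1 := tensor_comp f g (𝟙 (strands k r)) (𝟙 _)
  have h2 := tensor_comp (𝟙 (strands k s)) (𝟙 _) (tensorHom f (𝟙 (strands k r)) :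
        strands k (j + r) ⟶ strands k (j + r)) (tensorHom g (𝟙 (strands k r)) :
        strands k (j + r) ⟶ strands k (j + r))
  rw [Category.comp_id] at h1 h2
  rw [h1]
  exact h2.symm

theorem jonesWenzlAt_idem {n s j : ℕ} (h : s + j ≤ n) (hj : j ≤ k + 1) :
    jonesWenzlAt k n s j ≫ jonesWenzlAt k n s j = jonesWenzlAt k n s j := by
  obtain ⟨r, rfl⟩ : ∃ r, n = s + (j + r) := ⟨n - s - j, by omega⟩
  rw [jonesWenzlAt_eq_tensor]
  exact (id_tensor_tensor_id_comp _ _).trans (by rw [jonesWenzl_idem k j hj])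

theorem addStrand_absorb (k n : ℕ) (hn : jonesWenzl k n ≫ jonesWenzl k n = jonesWenzl k n) :
    addStrand (jonesWenzl k n) ≫ jonesWenzl k (n + 1) = jonesWenzl k (n + 1) := by
  cases n with
  | zero => exact (congrArg (· ≫ _) (addStrand_id 0)).trans (Category.id_comp _)
  | succ n =>
    have h : addStrand (jonesWenzl k (n + 1)) ≫ addStrand (jonesWenzl k (n + 1)) =
        addStrand (jonesWenzl k (n + 1)) := by rw [← addStrand_comp, hn]
    rw [jonesWenzl, Preadditive.comp_add, Linear.comp_smul, ← Category.assoc, h]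

/-- With g = f_{n+1} ⊗ 1, U g U is a multiple of (f_n ⊗ 1_2) U, and g absorbs f_n ⊗ 1_2. The
coefficient in the recursion is the one for which the correction term becomes exactly -g U, by
`jonesWenzl_coeff`. -/
theorem jonesWenzl_comp_capCup (k n : ℕ) (hn : n + 2 ≤ k + 1) :
    jonesWenzl k (n + 2) ≫ capCup k n = 0 := by
  have i0 := jonesWenzl_idem k n (by omega)
  have gH : addStrand (jonesWenzl k (n + 1)) ≫ addStrand (addStrand (jonesWenzl k n)) =
      addStrand (jonesWenzl k (n + 1)) := by
    rw [← addStrand_comp, jonesWenzl_absorb k n i0]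
  rw [jonesWenzl, Preadditive.add_comp, Linear.smul_comp, Category.assoc, Category.assoc,
    capCup_jonesWenzl_capCup k n i0, Linear.comp_smul, smul_smul, jonesWenzl_coeff k n hn,
    ← Category.assoc, gH, neg_one_smul, add_neg_cancel]

theorem capCup_comp_jonesWenzl (k n : ℕ) (hn : n + 2 ≤ k + 1) :
    capCup k n ≫ jonesWenzl k (n + 2) = 0 := by
  have i0 := jonesWenzl_idem k n (by omega)
  have gH : addStrand (addStrand (jonesWenzl k n)) ≫ addStrand (jonesWenzl k (n + 1)) =
      addStrand (jonesWenzl k (n + 1)) := by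
    rw [← addStrand_comp, addStrand_absorb k n i0]
  have key := capCup_jonesWenzl_capCup k n i0
  -- The smaller projection is moved above the generator, where the projection that follows absorbs
  -- it.
  rw [addStrand_capCup] at key
  have key' : capCup k n ≫ addStrand (jonesWenzl k (n + 1)) ≫ capCup k n ≫
      addStrand (jonesWenzl k (n + 1)) = (loopValue k + qint k n / qint k (n + 1)) •
        (capCup k n ≫ addStrand (jonesWenzl k (n + 1))) := by
    have := congrArg (· ≫ addStrand (jonesWenzl k (n + 1))) key
    simpa only [Category.assoc, Linear.smul_comp, gH] using this
  rw [jonesWenzl, Preadditive.comp_add, Linear.comp_smul, key', smul_smul,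
    jonesWenzl_coeff k n hn, neg_one_smul, add_neg_cancel]

/-- Every term of the recursion for f_{j+1} begins and ends with f_j, so absorption of f_{j'} is
inherited upwards, starting from idempotency at j = j'. -/
theorem jonesWenzlAt_absorb {n s j j' : ℕ} (h : s + j ≤ n) (hj : j ≤ k + 1) (hj' : j' ≤ j) :
    jonesWenzlAt k n s j ≫ jonesWenzlAt k n s j' = jonesWenzlAt k n s j ∧
      jonesWenzlAt k n s j' ≫ jonesWenzlAt k n s j = jonesWenzlAt k n s j := by
  induction j, hj' using Nat.le_induction with
  | base => exact ⟨jonesWenzlAt_idem h hj, jonesWenzlAt_idem h hj⟩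
  | succ j hj' ih =>
    obtain ⟨h1, h2⟩ := ih (by omega) (by omega)
    match j with
    | 0 =>
      obtain rfl : j' = 0 := by omega
      exact ⟨Category.comp_id _, Category.id_comp _⟩
    | j + 1 =>
      rw [jonesWenzlAt]
      constructor
      · simp only [Preadditive.add_comp, Linear.smul_comp, Category.assoc, h1]
      · simp only [Preadditive.comp_add, Linear.comp_smul, ← Category.assoc, h2]

/-- A generator inside the block acts on the last two strands of a shorter block with the same left
end. The shorter projection annihilates it and is absorbed by the longer one. -/
theorem jonesWenzlAt_comp_capCupAt {n s j t : ℕ} (h : s + j ≤ n) (hj : j ≤ k + 1) (hs : s ≤ t)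
    (ht : t + 2 ≤ s + j) : jonesWenzlAt k n s j ≫ capCupAt k n t = 0 ∧
      capCupAt k n t ≫ jonesWenzlAt k n s j = 0 := by
  obtain ⟨i, rfl⟩ : ∃ i, t = s + i := ⟨t - s, by omega⟩
  have key : jonesWenzlAt k n s (i + 2) ≫ capCupAt k n (s + i) = 0 ∧
      capCupAt k n (s + i) ≫ jonesWenzlAt k n s (i + 2) = 0 := by
    obtain ⟨r, rfl⟩ : ∃ r, n = s + (i + 2 + r) := ⟨n - s - i - 2, by omega⟩
    rw [jonesWenzlAt_eq_tensor, capCupAt_eq_tensor]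
    have hz : tensorHom (𝟙 (strands k s)) (tensorHom (0 : strands k (i + 2) ⟶ strands k (i + 2))
        (𝟙 (strands k r)) : strands k (i + 2 + r) ⟶ strands k (i + 2 + r)) = 0 :=
      (congrArg (tensorHom (𝟙 (strands k s))) (zero_tensor _)).trans (tensor_zero _)
    constructor
    · exact (id_tensor_tensor_id_comp _ _).trans
        (by rw [jonesWenzl_comp_capCup k i (by omega)]; exact hz)
    · exact (id_tensor_tensor_id_comp _ _).trans
        (by rw [capCup_comp_jonesWenzl k i (by omega)]; exact hz)
  obtain ⟨a1, a2⟩ := jonesWenzlAt_absorb (k := k) h hj (by omega : i + 2 ≤ j)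
  constructor
  · rw [← a1, Category.assoc, key.1, Limits.comp_zero]
  · rw [← a2, ← Category.assoc, key.2, Limits.zero_comp]

/-- By a zigzag the cap at i is the generator at i followed by the cap at i - 1, so it dies with the
generator. The condition 1 ≤ i makes room for the neighbouring cap. -/
theorem jonesWenzlAt_comp_capAt {m n s j i : ℕ} (hm : m = n + 2) (h : s + j ≤ m)
    (hj : j ≤ k + 1) (hs : s ≤ i) (hi : i + 2 ≤ s + j) (hi1 : 1 ≤ i) :
    jonesWenzlAt k m s j ≫ capAt k m n i = 0 := by
  obtain ⟨l, rfl⟩ : ∃ l, i = l + 1 := ⟨i - 1, by omega⟩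
  have h1 := cupAt_succ_comp_capAt (k := k) hm (by omega : l + 1 ≤ n)
  rw [← Category.comp_id (capAt k m n (l + 1)), ← h1, ← Category.assoc (capAt k m n (l + 1)),
    capAt_comp_cupAt hm (by omega), ← Category.assoc,
    (jonesWenzlAt_comp_capCupAt h hj hs hi).1, Limits.zero_comp]

/-- By a zigzag the cup at i is the cup at i + 1 followed by the generator at i, which the
projection annihilates; i + 1 ≤ n makes room for the neighbouring cup. -/
theorem cupAt_comp_jonesWenzlAt {m n s j i : ℕ} (hm : m = n + 2) (h : s + j ≤ m)
    (hj : j ≤ k + 1) (hs : s ≤ i) (hi : i + 2 ≤ s + j) (hi1 : i + 1 ≤ n) :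
    cupAt k n m i ≫ jonesWenzlAt k m s j = 0 := by
  have h1 := cupAt_succ_comp_capAt (k := k) hm hi1
  rw [← Category.id_comp (cupAt k n m i), ← h1, Category.assoc, Category.assoc,
    ← Category.assoc (capAt k m n i), capAt_comp_cupAt hm (by omega),
    (jonesWenzlAt_comp_capCupAt h hj hs hi).2, Limits.comp_zero]

end JonesWenzl

end LinDiag

/-! ### The ideal generated by the last projection, seen on strands -/

section Ideal

variable {k : ℕ}

theorem AddTL.comp_apply_of_unique {M N K : AddTL k} (f : M ⟶ N) (g : N ⟶ K) (b : N.ι)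
    (hb : ∀ b', b' = b) (i : M.ι) (j : K.ι) : (f ≫ g) i j = f i b ≫ g b j :=
  Finset.sum_eq_single b (fun b' _ h => absurd (hb b') h)
    fun h => absurd (Finset.mem_univ _) h

/-- The inclusion of the linear diagram category in `TL`. -/
noncomputable def linToTL (k : ℕ) : LinDiag k ⥤ TL k :=
  Mat_.embedding (LinDiag k) ⋙ Idempotents.toKaroubi (AddTL k)

/-- A morphism of the linear diagram category is negligible if it lies in the ideal generated by
`F (k + 1)`. -/
def Negligible {X Y : LinDiag k} (f : X ⟶ Y) : Prop := TL.InIdeal k ((linToTL k).map f)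

namespace Negligible

theorem zero (X Y : LinDiag k) : Negligible (0 : X ⟶ Y) := TL.InIdeal.zero _ _

theorem add {X Y : LinDiag k} {f g : X ⟶ Y} (hf : Negligible f) (hg : Negligible g) :
    Negligible (f + g) := TL.InIdeal.add _ _ hf hg

theorem comp_left {X Y Z : LinDiag k} (f : X ⟶ Y) {g : Y ⟶ Z} (hg : Negligible g) :
    Negligible (f ≫ g) := by
  unfold Negligible
  rw [Functor.map_comp]
  exact .comp_left _ _ hg

theorem comp_right {X Y Z : LinDiag k} {f : X ⟶ Y} (hf : Negligible f) (g : Y ⟶ Z) :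
    Negligible (f ≫ g) := by
  unfold Negligible
  rw [Functor.map_comp]
  exact .comp_right _ _ hf

/-- Closure under scalars is not among the defining rules of the ideal; it follows from composition
with a multiple of the identity. -/
theorem smul {X Y : LinDiag k} {f : X ⟶ Y} (c : ℂ) (hf : Negligible f) : Negligible (c • f) := by
  have := comp_right hf (c • 𝟙 Y)
  rwa [Linear.comp_smul, Category.comp_id] at this

theorem of_smul {X Y : LinDiag k} {f : X ⟶ Y} {c : ℂ} (hc : c ≠ 0) (hf : Negligible (c • f)) :
    Negligible f := by
  have := hf.smul c⁻¹
  rwa [inv_smul_smul₀ hc] at this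

/-- In the idempotent completion this idempotent factors through the object F_{k+1} ⊗ r, whose
identity is the generator of the ideal tensored with an identity. -/
theorem tensorHom_jonesWenzl (k r : ℕ) : Negligible
    (LinDiag.tensorHom (LinDiag.jonesWenzl k (k + 1)) (𝟙 (LinDiag.strands k r))) := by
  set x := LinDiag.tensorHom (LinDiag.jonesWenzl k (k + 1)) (𝟙 (LinDiag.strands k r)) with hx
  have hxx : x ≫ x = x := by
    rw [hx, ← LinDiag.tensor_comp, LinDiag.jonesWenzl_idem k _ le_rfl, Category.comp_id]
  have hp : ∀ i j : PUnit × PUnit, (TL.tensorObj (TL.F k (k + 1) le_rfl)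
      ((linToTL k).obj (LinDiag.strands k r))).p i j = x := by
    rintro ⟨⟨⟩, ⟨⟩⟩ ⟨⟨⟩, ⟨⟩⟩
    exact congrArg (LinDiag.tensorHom (LinDiag.jonesWenzl k (k + 1))) (Mat_.id_apply_self _ _)
  -- The maps A to the image of the idempotent x and B back from it both have x as their only matrix
  -- entry; their composite is x x = x.
  let A : (linToTL k).obj (LinDiag.strands k (k + 1 + r)) ⟶
      TL.tensorObj (TL.F k (k + 1) le_rfl) ((linToTL k).obj (LinDiag.strands k r)) :=
    { f := fun _ _ => x
      comm := by
        refine (Category.id_comp _).trans ?_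
        apply Mat_.hom_ext
        intro i j
        refine (AddTL.comp_apply_of_unique _ _ (⟨⟩, ⟨⟩) (fun _ => rfl) _ _).trans ?_
        exact (congrArg (fun y => x ≫ y) (hp (⟨⟩, ⟨⟩) j)).trans hxx }
  let B : TL.tensorObj (TL.F k (k + 1) le_rfl) ((linToTL k).obj (LinDiag.strands k r)) ⟶
      (linToTL k).obj (LinDiag.strands k (k + 1 + r)) :=
    { f := fun _ _ => x
      comm := by
        refine (congrArg _ (Category.comp_id _)).trans ?_
        apply Mat_.hom_ext
        intro i j
        refine (AddTL.comp_apply_of_unique _ _ (⟨⟩, ⟨⟩) (fun _ => rfl) _ _).trans ?_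
        exact (congrArg (fun y => y ≫ x) (hp i (⟨⟩, ⟨⟩))).trans hxx }
  have h : (linToTL k).map x = A ≫ TL.tensorHom (𝟙 (TL.F k (k + 1) le_rfl))
      (𝟙 ((linToTL k).obj (LinDiag.strands k r))) ≫ B := by
    rw [TL.tensor_id, Category.id_comp]
    apply Idempotents.Karoubi.hom_ext
    apply Mat_.hom_ext
    intro i j
    exact hxx.symm.trans
      (AddTL.comp_apply_of_unique A.f B.f (⟨⟩, ⟨⟩) (fun _ => rfl) i j).symm
  unfold Negligible
  rw [h]
  exact .comp_left _ _ (.comp_right _ _ (.tensor_right _ _ .gen))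

end Negligible

namespace LinDiag

theorem negligible_jonesWenzlAt {n : ℕ} (h : k + 1 ≤ n) :
    Negligible (jonesWenzlAt k n 0 (k + 1)) := by
  obtain ⟨r, rfl⟩ : ∃ r, n = k + 1 + r := ⟨n - (k + 1), by omega⟩
  rw [← jonesWenzlAt_tensor_id (n := k + 1) (by omega) r, ← jonesWenzl_eq]
  exact Negligible.tensorHom_jonesWenzl k r

end LinDiag

end Ideal

/-! ### Expansion of a Jones-Wenzl projection and its rotation -/

namespace LinDiag

variable {k : ℕ}

/-- The Jones-Wenzl projection on `n + 1` strands in terms of the one on `n` strands. -/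
theorem qint_smul_jonesWenzlAt_succ {N N' n : ℕ} (hN : N = N' + 2) (h : n + 1 ≤ N)
    (hn : n ≤ k) : qint k (n + 1) • jonesWenzlAt k N 0 (n + 1) =
      ∑ i ∈ Finset.range n, qint k (i + 1) •
        (jonesWenzlAt k N 0 n ≫ capAt k N N' (n - 1) ≫ cupAt k N' N i) +
      qint k (n + 1) • jonesWenzlAt k N 0 n := by
  induction n with
  | zero => simp [jonesWenzlAt]
  | succ n ih =>
    have hq := qint_ne_zero k (n + 2) (by omega) (by omega)
    -- The projection lives on the strands below n, the generator on the strands n and n + 1.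
    have comm : capCupAt k N n ≫ jonesWenzlAt k N 0 n = jonesWenzlAt k N 0 n ≫ capCupAt k N n :=
      jonesWenzlAt_slide _ fun t _ => (capCupAt_comm (by omega) (by omega)).symm
    have abs := (jonesWenzlAt_absorb (k := k) (n := N) (s := 0) (j := n + 1) (j' := n) (by omega)
      (by omega) (by omega)).1
    have e1 : jonesWenzlAt k N 0 (n + 1) ≫ capCupAt k N n ≫ jonesWenzlAt k N 0 n =
        jonesWenzlAt k N 0 (n + 1) ≫ capCupAt k N n := by
      rw [comm, ← Category.assoc, abs]
    -- The generator at n followed by the cap at n - 1 is, by a zigzag, the cap at n. For n = 0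
    -- there is no such i, so the truncated subtraction does no harm.
    have e2 : ∀ i ∈ Finset.range n, jonesWenzlAt k N 0 (n + 1) ≫ capCupAt k N n ≫
        jonesWenzlAt k N 0 n ≫ capAt k N N' (n - 1) ≫ cupAt k N' N i =
        jonesWenzlAt k N 0 (n + 1) ≫ capAt k N N' n ≫ cupAt k N' N i := by
      intro i hi
      obtain ⟨l, rfl⟩ : ∃ l, n = l + 1 := ⟨n - 1, by have := Finset.mem_range.1 hi; omega⟩
      rw [← Category.assoc (capCupAt k N _), comm, Category.assoc, ← Category.assoc, abs,
        ← capAt_comp_cupAt hN (by omega), Nat.add_sub_cancel, Category.assoc,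
        ← Category.assoc (cupAt k N' N (l + 1)), cupAt_succ_comp_capAt hN (by omega),
        Category.id_comp]
    -- The induction hypothesis is inserted for the upper of the two projections only. Its sum gives
    -- the terms i < n, and its last term, f_n alone, gives the term i = n.
    have e3 : (qint k (n + 1)) • (jonesWenzlAt k N 0 (n + 1) ≫ capCupAt k N n ≫
        jonesWenzlAt k N 0 (n + 1)) = ∑ i ∈ Finset.range (n + 1), qint k (i + 1) •
        (jonesWenzlAt k N 0 (n + 1) ≫ capAt k N N' n ≫ cupAt k N' N i) := by
      rw [← Linear.comp_smul, ← Linear.comp_smul, ih (by omega) (by omega), Preadditive.comp_add,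
        Preadditive.comp_add, Linear.comp_smul, Linear.comp_smul, e1, Finset.sum_range_succ,
        capAt_comp_cupAt hN (by omega), Preadditive.comp_sum, Preadditive.comp_sum]
      refine congrArg (· + _) (Finset.sum_congr rfl fun i hi => ?_)
      rw [Linear.comp_smul, Linear.comp_smul, e2 i hi]
    rw [jonesWenzlAt, smul_add, smul_smul, mul_div_cancel₀ _ hq, Nat.zero_add, e3,
      Nat.add_sub_cancel, add_comm]

/-- The rotation of the relation `f (k + 1) = 0`. -/
theorem negligible_sum_cupAt {n m : ℕ} (hm : m = n + 2) (hk : 1 ≤ k) (h : k ≤ n) :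
    Negligible (∑ i ∈ Finset.range (k + 1),
      qint k (i + 1) • (jonesWenzlAt k n 0 k ≫ cupAt k n m i)) := by
  -- The cup at k bends the last strand of f_{k+1} around. It straightens against the cap at k - 1
  -- in every summand, which leaves the cup at i; the summand f_k alone contributes the cup at k.
  have h1 := ((negligible_jonesWenzlAt (k := k) (n := m) (by omega)).smul
    (qint k (k + 1))).comp_left (cupAt k n m k)
  rw [qint_smul_jonesWenzlAt_succ hm (by omega) le_rfl, Preadditive.comp_add, Linear.comp_smul,
    Preadditive.comp_sum, cupAt_comp_jonesWenzlAt_left hm (by omega) (by omega)] at h1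
  rw [Finset.sum_range_succ]
  convert h1 using 2
  refine Finset.sum_congr rfl fun i _ => ?_
  obtain ⟨l, rfl⟩ : ∃ l, k = l + 1 := ⟨k - 1, by omega⟩
  rw [Linear.comp_smul, ← Category.assoc,
    cupAt_comp_jonesWenzlAt_left hm (by omega) (by omega), Nat.add_sub_cancel, Category.assoc,
    ← Category.assoc (cupAt _ n m (l + 1)), cupAt_succ_comp_capAt hm (by omega),
    Category.id_comp]

end LinDiag

/-! ### Nested caps and cups -/

namespace LinDiag

variable {k : ℕ}

/-- The `j` nested caps `M ⟶ N`, for `M = N + 2 j`, the outermost one with left foot `a`. -/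
noncomputable def capsAt (k N a : ℕ) : (j M : ℕ) → (strands k M ⟶ strands k N)
  -- The number M of lower strands is a free index, with value `0` when the counts do not match;
  -- this avoids transports between different expressions for N + 2 j.
  | 0, M => if h : M = N then eqToHom (congrArg mk h) else 0
  | j + 1, M => capAt k M (N + 2 * j) (a + j) ≫ capsAt k N a j (N + 2 * j)

/-- The `j` nested cups `N ⟶ M`, for `M = N + 2 j`, the outermost one with left foot `a`. -/
noncomputable def cupsAt (k N a : ℕ) : (j M : ℕ) → (strands k N ⟶ strands k M)
  | 0, M => if h : N = M then eqToHom (congrArg mk h) else 0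
  | j + 1, M => cupsAt k N a j (N + 2 * j) ≫ cupAt k (N + 2 * j) M (a + j)

theorem capsAt_zero (k N a : ℕ) : capsAt k N a 0 N = 𝟙 _ := dif_pos rfl

theorem cupsAt_zero (k N a : ℕ) : cupsAt k N a 0 N = 𝟙 _ := dif_pos rfl

theorem capsAt_comp_jonesWenzlAt {N a j M n : ℕ} (hM : M = N + 2 * j) (ha : a ≤ N)
    (hn : n ≤ a) : capsAt k N a j M ≫ jonesWenzlAt k N 0 n =
      jonesWenzlAt k M 0 n ≫ capsAt k N a j M := by
  induction j generalizing M with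
  | zero =>
    obtain rfl : M = N := hM
    rw [capsAt_zero, Category.id_comp, Category.comp_id]
  | succ j ih =>
    rw [capsAt, Category.assoc, ih rfl, ← Category.assoc,
      capAt_comp_jonesWenzlAt_left (by omega) (by omega) (by omega), Category.assoc]

theorem jonesWenzlAt_comp_cupsAt {N a j M n : ℕ} (hM : M = N + 2 * j) (ha : a ≤ N)
    (hn : n ≤ a) : cupsAt k N a j M ≫ jonesWenzlAt k M 0 n =
      jonesWenzlAt k N 0 n ≫ cupsAt k N a j M := by
  induction j generalizing M with
  | zero =>
    obtain rfl : M = N := hM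
    rw [cupsAt_zero, Category.id_comp, Category.comp_id]
  | succ j ih =>
    rw [cupsAt, Category.assoc, cupAt_comp_jonesWenzlAt_left (by omega) (by omega) (by omega),
      ← Category.assoc, ih rfl, Category.assoc]

/-- Splitting off the outermost cap. -/
theorem capsAt_succ_comp_capAt {N N' a j M : ℕ} (hN : N' = N + 2) (hM : M = N' + 2 * j) :
    capsAt k N' (a + 1) j M ≫ capAt k N' N a = capsAt k N a (j + 1) M := by
  induction j generalizing M with
  | zero =>
    obtain rfl : M = N' := hM
    rw [capsAt_zero, Category.id_comp, capsAt]
    exact (Category.comp_id _).symm.trans (congrArg _ (capsAt_zero k N a).symm)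
  | succ j ih =>
    rw [capsAt, Category.assoc, ih rfl, capsAt, show a + 1 + j = a + (j + 1) by omega,
      show N' + 2 * j = N + 2 * (j + 1) by omega]
    rfl

/-- Splitting off the outermost cup. -/
theorem cupAt_comp_cupsAt_succ {N N' a j M : ℕ} (hN : N' = N + 2) (hM : M = N' + 2 * j) :
    cupAt k N N' a ≫ cupsAt k N' (a + 1) j M = cupsAt k N a (j + 1) M := by
  induction j generalizing M with
  | zero =>
    obtain rfl : M = N' := hM
    rw [cupsAt_zero, Category.comp_id, cupsAt]
    exact (Category.id_comp _).symm.trans (congrArg (· ≫ _) (cupsAt_zero k N a).symm)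
  | succ j ih =>
    rw [cupsAt, ← Category.assoc, ih rfl, cupsAt, show a + 1 + j = a + (j + 1) by omega,
      show N' + 2 * j = N + 2 * (j + 1) by omega]
    rfl

/-- A cup whose right foot is joined to the outermost of the nested caps. -/
theorem cupAt_comp_capsAt_succ {n a j N M : ℕ} (hM : M = N + 2) (hN : N = n + 2 * j)
    (ha : a + 1 ≤ n) : cupAt k N M a ≫ capsAt k n (a + 1) (j + 1) M = capsAt k n a j N := by
  induction j generalizing N M with
  | zero =>
    obtain rfl : N = n := hN
    change cupAt k N M a ≫ capAt k M N (a + 1) ≫ capsAt k N (a + 1) 0 N = capsAt k N a 0 N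
    rw [capsAt_zero, capsAt_zero, Category.comp_id, cupAt_comp_capAt_succ hM ha]
  | succ j ih =>
    have h := ih rfl rfl
    -- The innermost cap lies to the right of the cup and slides past it; the induction hypothesis
    -- applies to the rest.
    rw [capsAt, show a + 1 + (j + 1) = a + j + 2 by omega,
      show n + 2 * (j + 1) = n + 2 * j + 2 by omega, ← Category.assoc,
      show N = n + 2 * j + 2 by omega,
      cupAt_comp_capAt_right (p := n + 2 * j) (by omega) rfl (by omega) (by omega), Category.assoc,
      h, capsAt]

/-- A cup which ends in two of the nested caps turns into a cap on the other side. -/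
theorem cupAt_comp_capsAt {n a j N M i N' : ℕ} (hM : M = N + 2) (hN : N = N' + 2)
    (hj : M = n + 2 * j) (ha : a ≤ n) (hi : a ≤ i) (hij : i + 2 ≤ a + j) :
    ∃ W : strands k N' ⟶ strands k n,
      cupAt k N M i ≫ capsAt k n a j M = capAt k N N' (2 * (a + j - 2) - i) ≫ W := by
  -- Here s counts the caps inside the two which the cup meets. The partners of the strands i and i
  -- + 1 are 2 (a + j) - 1 - i and 2 (a + j) - 2 - i; removing the two strands of the cup gives the
  -- left foot 2 (a + j - 2) - i of the new cap.
  obtain ⟨s, rfl⟩ : ∃ s, j = i - a + 2 + s := ⟨j - (i - a + 2), by omega⟩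
  induction s generalizing N M N' with
  | zero =>
    obtain ⟨l, hl⟩ : ∃ l, i = a + l := ⟨i - a, by omega⟩
    -- For s = 0 the cup straightens against the innermost cap, and the next cap becomes the new
    -- one.
    refine ⟨capsAt k n a l N', ?_⟩
    rw [show i - a + 2 + 0 = l + 1 + 1 by omega, capsAt, capsAt, ← Category.assoc,
      show n + 2 * (l + 1) = N by omega, show a + (l + 1) = i + 1 by omega,
      cupAt_comp_capAt_succ hM (by omega), Category.id_comp, show n + 2 * l = N' by omega,
      show 2 * (a + (l + 1 + 1) - 2) - i = a + l by omega]
  | succ s ih =>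
    -- Once the innermost cap has slid below the cup, the induction hypothesis applies with two
    -- strands fewer. The new cap then passes below the innermost one, which moves its left foot two
    -- places to the right.
    obtain ⟨W, hW⟩ := ih (N := N') (M := N) (N' := N' - 2) hN (by omega) (by omega) (by omega)
    obtain ⟨l, hl⟩ : ∃ l, a + (i - a + 2 + s) = l + 2 := ⟨i + s, by omega⟩
    obtain ⟨t, ht⟩ : ∃ t, 2 * (a + (i - a + 2 + s) - 2) - i = t := ⟨_, rfl⟩
    refine ⟨capAt k N' (N' - 2) l ≫ W, ?_⟩
    rw [show i - a + 2 + (s + 1) = i - a + 2 + s + 1 by omega, capsAt, hl, ← Category.assoc,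
      show n + 2 * (i - a + 2 + s) = N by omega,
      cupAt_comp_capAt_right hM hN (by omega) (by omega), Category.assoc, hW, ht,
      show 2 * (a + (i - a + 2 + s + 1) - 2) - i = t + 2 by omega, ← Category.assoc,
      ← Category.assoc, capAt_comp_capAt hN (by omega) (by omega) (by omega)]

/-- Since q^(k+2) = -1, q^(k+1) is the negative of the inverse of q. This is the coefficient at
which the reduction starts. -/
theorem qint_succ_eq_one (k : ℕ) : qint k (k + 1) = 1 := by
  have h0 := q_ne_zero k
  have h : q k ^ (k + 1) * q k = -1 := by
    have hk : (k : ℂ) + 2 ≠ 0 := by exact_mod_cast (by omega : k + 2 ≠ 0)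
    rw [← pow_succ, q, ← Complex.exp_nat_mul, ← Complex.exp_pi_mul_I]
    congr 1
    push_cast
    field_simp
    ring
  have h1 : q k ^ (k + 1) = -(q k)⁻¹ := by
    rw [← mul_inv_cancel_right₀ h0 (q k ^ (k + 1)), h, neg_one_mul]
  rw [qint, h1, inv_neg, inv_inv, div_eq_one_iff_eq (q_sub_inv_ne k)]
  ring

/-! ### Reduction of the tensor square of the projection modulo the ideal -/

section Reduction

variable {m j K : ℕ}

/-- Composing `j` nested caps on `f k ⊗ f k` with the Jones-Wenzl projection on the first `m + 1` of
the remaining `2 m` strands gives a negligible morphism. -/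
theorem negligible_capsAt_comp_jonesWenzlAt (hK : K = 2 * k) (hm : 1 ≤ m) (hmj : m + j = k) :
    Negligible (jonesWenzlAt k K 0 k ≫ jonesWenzlAt k K k k ≫ capsAt k (2 * m) m j K ≫
      jonesWenzlAt k (2 * m) 0 (m + 1)) := by
  set P := jonesWenzlAt k K 0 k
  set Q := jonesWenzlAt k K k k
  set Z := jonesWenzlAt k (K + 2) (k + 2) k ≫ capsAt k (2 * m) (m + 1) (j + 1) (K + 2) ≫
    jonesWenzlAt k (2 * m) 0 (m + 1) with hZ
  -- The line from the strand where caps and f_{m+1} overlap is bent into a cup at m, whose right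
  -- foot meets an additional outermost cap. The block of Q moves two places to the right because
  -- two strands are inserted before it.
  have e : Q ≫ capsAt k (2 * m) m j K ≫ jonesWenzlAt k (2 * m) 0 (m + 1) =
      cupAt k K (K + 2) m ≫ Z := by
    rw [← cupAt_comp_capsAt_succ (k := k) (M := K + 2) rfl (by omega) (by omega), hZ,
      ← Category.assoc (cupAt k K (K + 2) m), cupAt_comp_jonesWenzlAt_right rfl (by omega)
      (by omega)]
    simp only [Q, Category.assoc]
  -- In the rotated relation only the cup at m, with one foot under f_{m+1} and the other under the
  -- caps, can survive.
  have h0 : ∀ i ∈ Finset.range (k + 1), i ≠ m →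
      qint k (i + 1) • (P ≫ cupAt k K (K + 2) i) ≫ Z = 0 := by
    intro i hi him
    rw [Finset.mem_range] at hi
    suffices h : cupAt k K (K + 2) i ≫ Z = 0 by
      rw [Category.assoc, h, Limits.comp_zero, smul_zero]
    rcases lt_or_gt_of_ne him with h | h
    -- For i < m both feet of the cup are among the first m + 1 strands. The projection f_{m+1}
    -- slides down past the caps and past Q and annihilates the cup.
    · rw [hZ, capsAt_comp_jonesWenzlAt (by omega) (by omega) le_rfl, ← Category.assoc (jonesWenzlAt _ _ _ _),
        ← jonesWenzlAt_comm (by omega) (by omega), Category.assoc, ← Category.assoc,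
        cupAt_comp_jonesWenzlAt rfl (by omega) (by omega) (by omega) (by omega) (by omega),
        Limits.zero_comp]
    -- For i > m both feet are left feet of caps, so the cup comes out as a cap with left foot 2k -
    -- i. As 2 ≤ m + 1 ≤ i ≤ k, that cap lies inside the block k, …, 2k - 1 of Q; this is where m ≥
    -- 1 is needed.
    · obtain ⟨W, hW⟩ := cupAt_comp_capsAt (k := k) (n := 2 * m) (a := m + 1) (j := j + 1) (N := K)
        (M := K + 2) (i := i) (N' := K - 2) rfl (by omega) (by omega) (by omega) (by omega)
        (by omega)
      rw [hZ, ← Category.assoc, cupAt_comp_jonesWenzlAt_right rfl (by omega) (by omega),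
        Category.assoc, ← Category.assoc (cupAt _ _ _ _), hW, Category.assoc, ← Category.assoc,
        jonesWenzlAt_comp_capAt (by omega) (by omega) (by omega) (by omega) (by omega) (by omega),
        Limits.zero_comp]
  have h1 := (negligible_sum_cupAt (k := k) (n := K) (m := K + 2) rfl (by omega)
    (by omega)).comp_right Z
  rw [Preadditive.sum_comp] at h1
  simp only [Linear.smul_comp] at h1
  rw [Finset.sum_eq_single m h0 (fun h => absurd (Finset.mem_range.2 (by omega)) h),
    Category.assoc, ← e] at h1
  exact h1.of_smul (qint_ne_zero k (m + 1) (by omega) (by omega))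

/-- Expanding f_{m+2} in the preceding negligible morphism by its recursion gives two terms. In
both, the copies of f_{m+1} slide past the nests and disappear into the two copies of P; in the
second, the cap and the cup of the generator become the new outermost ones. -/
theorem negligible_reduction_step (hK : K = 2 * k) (hmj : m + 1 + j = k) :
    Negligible (jonesWenzlAt k K 0 k ≫ jonesWenzlAt k K k k ≫ capsAt k (2 * (m + 1)) (m + 1) j K ≫
        cupsAt k (2 * (m + 1)) (m + 1) j K ≫ jonesWenzlAt k K 0 k +
      (qint k (m + 1) / qint k (m + 2)) • (jonesWenzlAt k K 0 k ≫ jonesWenzlAt k K k k ≫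
        capsAt k (2 * m) m (j + 1) K ≫ cupsAt k (2 * m) m (j + 1) K ≫ jonesWenzlAt k K 0 k)) := by
  have h := (negligible_capsAt_comp_jonesWenzlAt (k := k) (m := m + 1) (j := j) hK (by omega)
    hmj).comp_right (cupsAt k (2 * (m + 1)) (m + 1) j K ≫ jonesWenzlAt k K 0 k)
  have e1 : jonesWenzlAt k K 0 k ≫ jonesWenzlAt k K k k ≫ capsAt k (2 * (m + 1)) (m + 1) j K ≫
      jonesWenzlAt k (2 * (m + 1)) 0 (m + 1) =
      jonesWenzlAt k K 0 k ≫ jonesWenzlAt k K k k ≫ capsAt k (2 * (m + 1)) (m + 1) j K := by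
    rw [capsAt_comp_jonesWenzlAt (by omega) (by omega) le_rfl,
      ← Category.assoc (jonesWenzlAt k K k k), ← jonesWenzlAt_comm (by omega) (by omega),
      Category.assoc, ← Category.assoc,
      (jonesWenzlAt_absorb (k := k) (n := K) (s := 0) (j := k) (j' := m + 1) (by omega) (by omega)
        (by omega)).1]
  have e2 : jonesWenzlAt k (2 * (m + 1)) 0 (m + 1) ≫ cupsAt k (2 * (m + 1)) (m + 1) j K ≫
      jonesWenzlAt k K 0 k = cupsAt k (2 * (m + 1)) (m + 1) j K ≫ jonesWenzlAt k K 0 k := by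
    rw [← Category.assoc, ← jonesWenzlAt_comp_cupsAt (by omega) (by omega) le_rfl, Category.assoc,
      (jonesWenzlAt_absorb (k := k) (n := K) (s := 0) (j := k) (j' := m + 1) (by omega) (by omega)
        (by omega)).2]
  have e1' : ∀ {Z : LinDiag k} (g : strands k (2 * (m + 1)) ⟶ Z),
      jonesWenzlAt k K 0 k ≫ jonesWenzlAt k K k k ≫ capsAt k (2 * (m + 1)) (m + 1) j K ≫
        jonesWenzlAt k (2 * (m + 1)) 0 (m + 1) ≫ g = jonesWenzlAt k K 0 k ≫
        jonesWenzlAt k K k k ≫ capsAt k (2 * (m + 1)) (m + 1) j K ≫ g := by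
    intro Z g
    simpa only [Category.assoc] using congrArg (· ≫ g) e1
  have e3 : ∀ {Z : LinDiag k} (g : strands k (2 * m) ⟶ Z),
      capsAt k (2 * (m + 1)) (m + 1) j K ≫ capAt k (2 * (m + 1)) (2 * m) m ≫ g =
        capsAt k (2 * m) m (j + 1) K ≫ g := by
    intro Z g
    rw [← Category.assoc, capsAt_succ_comp_capAt (by omega) (by omega)]
  have e4 : ∀ {Z : LinDiag k} (g : strands k K ⟶ Z),
      cupAt k (2 * m) (2 * (m + 1)) m ≫ cupsAt k (2 * (m + 1)) (m + 1) j K ≫ g =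
        cupsAt k (2 * m) m (j + 1) K ≫ g := by
    intro Z g
    rw [← Category.assoc, cupAt_comp_cupsAt_succ (by omega) (by omega)]
  -- The generator is cut into its cap and its cup, so that each can join its nest.
  rw [jonesWenzlAt, Nat.zero_add, ← capAt_comp_cupAt (by omega : 2 * (m + 1) = 2 * m + 2)
    (by omega)] at h
  simpa only [Preadditive.comp_add, Preadditive.add_comp, Linear.comp_smul, Linear.smul_comp,
    Category.assoc, e1', e2, e3, e4] using h

/-- Modulo the ideal, `f k ⊗ f k` factors through `j` nested caps and cups. -/
theorem negligible_reduction (hK : K = 2 * k) (hmj : m + j = k) :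
    Negligible (jonesWenzlAt k K 0 k ≫ jonesWenzlAt k K k k -
      ((-1) ^ j * qint k (m + 1)) • (jonesWenzlAt k K 0 k ≫ jonesWenzlAt k K k k ≫
        capsAt k (2 * m) m j K ≫ cupsAt k (2 * m) m j K ≫ jonesWenzlAt k K 0 k)) := by
  induction j generalizing m with
  | zero =>
    obtain rfl : m = k := hmj
    subst hK
    have h : jonesWenzlAt m (2 * m) 0 m ≫ jonesWenzlAt m (2 * m) m m ≫ jonesWenzlAt m (2 * m) 0 m =
        jonesWenzlAt m (2 * m) 0 m ≫ jonesWenzlAt m (2 * m) m m := by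
      rw [← jonesWenzlAt_comm (by omega) (by omega), ← Category.assoc,
        jonesWenzlAt_idem (by omega) (by omega)]
    -- Without caps the second copy of P is absorbed, and the coefficient is [k+1] = 1.
    rw [capsAt_zero, cupsAt_zero, Category.id_comp, Category.id_comp, h, qint_succ_eq_one,
      pow_zero, mul_one, one_smul, sub_self]
    exact .zero _ _
  | succ j ih =>
    have h1 := ih (m := m + 1) (by omega)
    -- The factor is chosen so that the first term of the step cancels the subtracted term of the
    -- induction hypothesis; the denominator [m+2] of the second term cancels as well and leaves
    -- [m+1] with the opposite sign.
    have h2 := (negligible_reduction_step (k := k) (m := m) (j := j) hK (by omega)).smul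
      ((-1) ^ j * qint k (m + 2))
    have h3 := h1.add h2
    rw [smul_add, smul_smul, ← add_assoc, sub_add_cancel] at h3
    convert h3 using 1
    rw [sub_eq_add_neg, ← neg_smul]
    congr 2
    have := qint_ne_zero k (m + 2) (by omega) (by omega)
    field_simp
    ring

end Reduction

end LinDiag

/-! ### The reduced identity for the nested caps and cups of the statement -/

namespace LinDiag

variable {k : ℕ}

theorem eqToHom_comp_capAt {m m' n i : ℕ} (h : m = m') :
    eqToHom (congrArg mk h) ≫ capAt k m' n i = capAt k m n i := by
  subst h
  exact Category.id_comp _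

theorem cupAt_comp_eqToHom {m m' n i : ℕ} (h : m = m') :
    cupAt k n m i ≫ eqToHom (congrArg mk h) = cupAt k n m' i := by
  subst h
  exact Category.comp_id _

theorem nestedCap_eq (k n : ℕ) : nestedCap k n = capsAt k 0 0 n (n + n) := by
  induction n with
  | zero => exact (capsAt_zero k 0 0).symm
  | succ n ih =>
    have hn : n + 1 + (n + 1) = n + 2 + n := by omega
    have h : nestedCap k (n + 1) = (eqToHom (congrArg mk hn) :
        strands k (n + 1 + (n + 1)) ⟶ strands k (n + 2 + n)) ≫
          capAt k (n + 2 + n) (n + n) n ≫ nestedCap k n :=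
      congrArg (fun x : strands k (n + 2 + n) ⟶ strands k (n + n) =>
        (eqToHom (congrArg mk hn) : strands k (n + 1 + (n + 1)) ⟶ strands k (n + 2 + n)) ≫
          x ≫ nestedCap k n) (id_tensor_cap_tensor_id k n)
    rw [h, ← Category.assoc, eqToHom_comp_capAt hn, ih, capsAt, show 0 + 2 * n = n + n by omega,
      Nat.zero_add]

theorem nestedCup_eq (k n : ℕ) : nestedCup k n = cupsAt k 0 0 n (n + n) := by
  induction n with
  | zero => exact (cupsAt_zero k 0 0).symm
  | succ n ih =>
    have hn : n + 2 + n = n + 1 + (n + 1) := by omega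
    have h : nestedCup k (n + 1) = nestedCup k n ≫ cupAt k (n + n) (n + 2 + n) n ≫
        (eqToHom (congrArg mk hn) : strands k (n + 2 + n) ⟶ strands k (n + 1 + (n + 1))) :=
      congrArg (fun x : strands k (n + n) ⟶ strands k (n + 2 + n) => nestedCup k n ≫ x ≫
        (eqToHom (congrArg mk hn) : strands k (n + 2 + n) ⟶ strands k (n + 1 + (n + 1))))
        (id_tensor_cup_tensor_id k n)
    rw [h, cupAt_comp_eqToHom hn, ih, cupsAt, show 0 + 2 * n = n + n by omega, Nat.zero_add]

/-- The idempotent `f n ⊗ f n`. -/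
noncomputable def jonesWenzlPair (k n : ℕ) : strands k (n + n) ⟶ strands k (n + n) :=
  jonesWenzlAt k (n + n) 0 n ≫ jonesWenzlAt k (n + n) n n

theorem tensorHom_jonesWenzl_jonesWenzl (k n : ℕ) :
    tensorHom (jonesWenzl k n) (jonesWenzl k n) = jonesWenzlPair k n := by
  have h1 := tensor_comp (jonesWenzl k n) (𝟙 _) (𝟙 _) (jonesWenzl k n)
  rw [Category.id_comp, Category.comp_id] at h1
  refine h1.trans ?_
  rw [jonesWenzl_eq]
  exact congrArg₂ (fun f g : strands k (n + n) ⟶ strands k (n + n) => f ≫ g)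
    (jonesWenzlAt_tensor_id (n := n) (s := 0) (j := n) (by omega) n)
    (id_tensor_jonesWenzlAt (n := n) (s := 0) (j := n) (by omega) n)

theorem jonesWenzlPair_idem {k n : ℕ} (hn : n ≤ k + 1) :
    jonesWenzlPair k n ≫ jonesWenzlPair k n = jonesWenzlPair k n := by
  have := tensor_comp (jonesWenzl k n) (jonesWenzl k n) (jonesWenzl k n) (jonesWenzl k n)
  rw [jonesWenzl_idem k n hn] at this
  rw [← tensorHom_jonesWenzl_jonesWenzl]
  exact this.symm

/-- Before passing to the completions, `c k ∘ e k` agrees with `(-1) ^ k` modulo the ideal. -/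
theorem negligible_nested (k : ℕ) :
    Negligible (jonesWenzlPair k k ≫ nestedCap k k ≫ nestedCup k k ≫ jonesWenzlPair k k -
      ((-1 : ℤ) ^ k) • jonesWenzlPair k k) := by
  -- The reduction ends in P only; composing with Q completes the upper f_k ⊗ f_k, and Q Q = Q on
  -- the other term. Multiplication by -(-1)^k moves the sign to the multiple of the identity and
  -- reverses the difference.
  have h := ((negligible_reduction (k := k) (m := 0) (j := k) (K := k + k) (by omega)
    (by omega)).comp_right (jonesWenzlAt k (k + k) k k)).smul (-(-1) ^ k)
  have hs : (-(-1 : ℂ) ^ k) * (-1) ^ k = -1 := by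
    rw [neg_mul, ← mul_pow, neg_one_mul, neg_neg, one_pow]
  have hQ := jonesWenzlAt_idem (k := k) (n := k + k) (s := k) (j := k) le_rfl (by omega)
  rw [qint_one, mul_one, Preadditive.sub_comp, Linear.smul_comp, smul_sub, smul_smul, hs,
    neg_one_smul, neg_smul, Category.assoc, hQ, sub_neg_eq_add, neg_add_eq_sub] at h
  rw [nestedCap_eq, nestedCup_eq, ← Int.cast_smul_eq_zsmul ℂ, Int.cast_pow, Int.cast_neg,
    Int.cast_one, jonesWenzlPair]
  simpa only [Category.assoc, Nat.mul_zero] using h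

end LinDiag

/-! ### Transfer to the idempotent completion -/

namespace TL

variable {k : ℕ}

instance : (linToTL k).Additive := ⟨rfl⟩

theorem tensorObj_F_p_apply {n : ℕ} (hn : n ≤ k + 1) (i j) :
    (tensorObj (F k n hn) (F k n hn)).p i j = LinDiag.jonesWenzlPair k n :=
  LinDiag.tensorHom_jonesWenzl_jonesWenzl k n

/-- The inclusion of `F n ⊗ F n` in the object `n + n`. -/
noncomputable def incl (k n : ℕ) (hn : n ≤ k + 1) :
    tensorObj (F k n hn) (F k n hn) ⟶ (linToTL k).obj (LinDiag.strands k (n + n)) where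
  f := fun _ _ => LinDiag.jonesWenzlPair k n
  comm := by
    refine (congrArg _ (Category.comp_id _)).trans ?_
    apply Mat_.hom_ext
    intro i j
    exact (AddTL.comp_apply_of_unique _ _ (⟨⟩, ⟨⟩) (fun _ => rfl) _ _).trans
      ((congrArg (· ≫ LinDiag.jonesWenzlPair k n) (tensorObj_F_p_apply hn i (⟨⟩, ⟨⟩))).trans
        (LinDiag.jonesWenzlPair_idem hn))

/-- The projection of the object `n + n` onto `F n ⊗ F n`. -/
noncomputable def proj (k n : ℕ) (hn : n ≤ k + 1) :
    (linToTL k).obj (LinDiag.strands k (n + n)) ⟶ tensorObj (F k n hn) (F k n hn) where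
  f := fun _ _ => LinDiag.jonesWenzlPair k n
  comm := by
    refine (Category.id_comp _).trans ?_
    apply Mat_.hom_ext
    intro i j
    exact (AddTL.comp_apply_of_unique _ _ (⟨⟩, ⟨⟩) (fun _ => rfl) _ _).trans
      ((congrArg (LinDiag.jonesWenzlPair k n ≫ ·) (tensorObj_F_p_apply hn (⟨⟩, ⟨⟩) j)).trans
        (LinDiag.jonesWenzlPair_idem hn))

/-- Index sets with a single element turn matrix products into single composites. Thus endomorphisms
of n + n strands yield endomorphisms of F_n ⊗ F_n, although the two objects have different index
types. -/
theorem incl_comp_map_comp_proj_apply {n : ℕ} (hn : n ≤ k + 1)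
    (x : LinDiag.strands k (n + n) ⟶ LinDiag.strands k (n + n))
    (i j : (tensorObj (F k n hn) (F k n hn)).X.ι) :
    (incl k n hn ≫ (linToTL k).map x ≫ proj k n hn).f i j =
      LinDiag.jonesWenzlPair k n ≫ x ≫ LinDiag.jonesWenzlPair k n :=
  (AddTL.comp_apply_of_unique (incl k n hn).f ((linToTL k).map x ≫ proj k n hn).f PUnit.unit
    (fun _ => rfl) i j).trans
    (congrArg (fun y => LinDiag.jonesWenzlPair k n ≫ y)
      (AddTL.comp_apply_of_unique ((linToTL k).map x).f (proj k n hn).f PUnit.unit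
        (fun _ => rfl) PUnit.unit j))

theorem tensorHom_id_eq {n : ℕ} (hn : n ≤ k + 1) :
    tensorHom (𝟙 (F k n hn)) (𝟙 (F k n hn)) =
      incl k n hn ≫ (linToTL k).map (LinDiag.jonesWenzlPair k n) ≫ proj k n hn := by
  apply Idempotents.Karoubi.hom_ext
  apply Mat_.hom_ext
  intro i j
  have h := LinDiag.jonesWenzlPair_idem hn
  exact (tensorObj_F_p_apply hn i j).trans
    (((incl_comp_map_comp_proj_apply hn _ i j).trans (by rw [h, h])).symm)

theorem ev_apply {n : ℕ} (hn : n ≤ k + 1) (i : (tensorObj (F k n hn) (F k n hn)).X.ι) :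
    (ev k n hn).f i PUnit.unit = LinDiag.jonesWenzlPair k n ≫ LinDiag.nestedCap k n :=
  (AddTL.comp_apply_of_unique (tensorObj (F k n hn) (F k n hn)).p (AddTL.nestedCap k n)
    (PUnit.unit, PUnit.unit) (fun _ => rfl) i PUnit.unit).trans
    (congrArg (fun x : LinDiag.strands k (n + n) ⟶ LinDiag.strands k (n + n) =>
      x ≫ LinDiag.nestedCap k n) (tensorObj_F_p_apply hn i (PUnit.unit, PUnit.unit)))

theorem coev_apply {n : ℕ} (hn : n ≤ k + 1) (j : (tensorObj (F k n hn) (F k n hn)).X.ι) :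
    (coev k n hn).f PUnit.unit j = LinDiag.nestedCup k n ≫ LinDiag.jonesWenzlPair k n :=
  (AddTL.comp_apply_of_unique (AddTL.nestedCup k n) (tensorObj (F k n hn) (F k n hn)).p
    (PUnit.unit, PUnit.unit) (fun _ => rfl) PUnit.unit j).trans
    (congrArg (fun x : LinDiag.strands k (n + n) ⟶ LinDiag.strands k (n + n) =>
      LinDiag.nestedCup k n ≫ x) (tensorObj_F_p_apply hn (PUnit.unit, PUnit.unit) j))

theorem ev_comp_coev {n : ℕ} (hn : n ≤ k + 1) :
    ev k n hn ≫ coev k n hn = incl k n hn ≫ (linToTL k).map (LinDiag.jonesWenzlPair k n ≫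
      LinDiag.nestedCap k n ≫ LinDiag.nestedCup k n ≫ LinDiag.jonesWenzlPair k n) ≫
        proj k n hn := by
  apply Idempotents.Karoubi.hom_ext
  apply Mat_.hom_ext
  intro i j
  have h := LinDiag.jonesWenzlPair_idem hn
  have e := incl_comp_map_comp_proj_apply hn (LinDiag.jonesWenzlPair k n ≫
    LinDiag.nestedCap k n ≫ LinDiag.nestedCup k n ≫ LinDiag.jonesWenzlPair k n) i j
  have hc : LinDiag.jonesWenzlPair k n ≫ (LinDiag.jonesWenzlPair k n ≫ LinDiag.nestedCap k n ≫
      LinDiag.nestedCup k n ≫ LinDiag.jonesWenzlPair k n) ≫ LinDiag.jonesWenzlPair k n =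
      (LinDiag.jonesWenzlPair k n ≫ LinDiag.nestedCap k n) ≫ LinDiag.nestedCup k n ≫
        LinDiag.jonesWenzlPair k n := by
    simp only [Category.assoc, h]
    rw [← Category.assoc (LinDiag.jonesWenzlPair k n) (LinDiag.jonesWenzlPair k n), h]
  exact (AddTL.comp_apply_of_unique (ev k n hn).f (coev k n hn).f PUnit.unit
    (fun _ => rfl) i j).trans ((congrArg₂ (fun (x : LinDiag.strands k (n + n) ⟶
      LinDiag.strands k 0) (y : LinDiag.strands k 0 ⟶ LinDiag.strands k (n + n)) => x ≫ y)
      (ev_apply hn i) (coev_apply hn j)).trans (hc.symm.trans e.symm))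

/-- Both morphisms arise by inserting a morphism of strands between the same inclusion and
projection, so their difference arises from the negligible difference of `negligible_nested` and
stays in the ideal. -/
theorem inIdeal_ev_comp_coev (k : ℕ) (hk : k ≤ k + 1) : InIdeal k (ev k k hk ≫ coev k k hk -
    ((-1 : ℤ) ^ k) • tensorHom (𝟙 (F k k hk)) (𝟙 (F k k hk))) := by
  have h := LinDiag.negligible_nested k
  unfold Negligible at h
  rw [Functor.map_sub, Functor.map_zsmul] at h
  rw [ev_comp_coev, tensorHom_id_eq, ← Preadditive.comp_zsmul, ← Preadditive.zsmul_comp,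
    ← Preadditive.comp_sub, ← Preadditive.sub_comp]
  exact .comp_left _ _ (.comp_right _ _ h)

end TL

instance (k : ℕ) : (ReducedTL.quotientFunctor k).Additive := ⟨rfl⟩

end TemperleyLieb

theorem lemma3p14 (k : ℕ) (hk : 1 ≤ k) :
    TemperleyLieb.ReducedTL.ev k k le_rfl ≫ TemperleyLieb.ReducedTL.coev k k le_rfl =
      ((-1 : ℤ) ^ k) • TemperleyLieb.ReducedTL.tensorHom
        (𝟙 (TemperleyLieb.ReducedTL.F k k le_rfl)) (𝟙 (TemperleyLieb.ReducedTL.F k k le_rfl)) := by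
  have h : (TemperleyLieb.ReducedTL.quotientFunctor k).map
      (TemperleyLieb.TL.ev k k (Nat.le_succ k) ≫ TemperleyLieb.TL.coev k k (Nat.le_succ k)) =
      (TemperleyLieb.ReducedTL.quotientFunctor k).map (((-1 : ℤ) ^ k) •
        TemperleyLieb.TL.tensorHom (𝟙 (TemperleyLieb.TL.F k k (Nat.le_succ k)))
          (𝟙 (TemperleyLieb.TL.F k k (Nat.le_succ k)))) :=
    (Quotient.functor_map_eq_iff _ _ _).2 (TemperleyLieb.TL.inIdeal_ev_comp_coev k _)
  rw [Functor.map_comp, Functor.map_zsmul] at h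
  -- Evaluation, coevaluation and tensor product in the quotient are by definition the images of
  -- those in `TL`.
  exact h
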